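/- **The problem.** An instance of the unidirectional maintenance scheduling problem consists of a corridor $[0,L]$, a number $m\ge 0$ of up-paths with headway $\Delta$ and travel time $\delta$ ($L,\Delta,\delta$ positive rationals), and $n$ jobs. Job $j$ has a release time $r_j$, a due time $d_j$, a processing time $p_j$ and locations $l^s_j\le l^e_j$ in $[0,L]$, all non-negative rationals, with $r_j+p_j\le d_j$. For $i\in\mathbb Z$ let $\ell_i$ be the segment from $(i\Delta,0)$ to $(i\Delta+\delta,L)$ in the time-location plane; the train paths of the instance are $\mathcal P=\{\ell_1,\dots,\ell_m\}$. If job $j$ starts at time $s\in[r_j,d_j-p_j]$, the paths of $\mathcal P$ that meet the box $[s,s+p_j]\times[l^s_j,l^e_j]$ are cancelled. The task is to find start times $s_j\in[r_j,d_j-p_j]$ of all jobs that minimise the number of cancelled paths. **Notation.** Paths are identified with their indices. $\mathcal R_j$ is the set of inclusion-minimal sets among the sets $\{i\in\mathbb Z: \ell_i\text{ meets }[s,s+p_j]\times[l^s_j,l^e_j]\}$, $s\in[r_j,d_j-p_j]$ (for a job whose boxes meet no $\ell_i$ with $i\notin\{1,\dots,m\}$, these are the non-dominated sets of cancelled paths).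 $p'_j$ is the common cardinality of the members of $\mathcal R_j$, and $r'_j$, $d'_j$ are the least and the greatest element of $\bigcup\mathcal R_j$ (set to $0$ if this union is empty). For $P\subseteq\mathcal P$ let $J(P)$ be the set of jobs $j$ with $R\cap P\ne\emptyset$ for all $R\in\mathcal R_j$, and let $c(P)$ be the minimum of $|\bigcup_{j\in J(P)}(R_j\cap P)|$ over all choices $R_j\in\mathcal R_j$. For $X\subseteq\mathbb Z$ let $R(X,P)$ and $L(X,P)$ be the sets of elements of $P$ that are greater, respectively smaller, than all elements of $X$. A job $j\in J(P)$ is *splitting* for $P$ if for every $X\in\mathcal R_j$ each job $j'\in J(P\setminus X)$ satisfies $(Y\cap P)\setminus X\subseteq R(X,P)$ for all $Y\in\mathcal R_{j'}$, or $(Y\cap P)\setminus X\subseteq L(X,P)$ for all $Y\in\mathcal R_{j'}$. The candidate possessions of $j$ are the nonempty $X\in\mathcal R_j$ with $\min X\in\{r'_j\}\cup\{d'_{j'}-p'_{j'}+1 : j'\text{ a job}\}$; they form the set $\mathcal R^e_j$. Say that $P$ *arises* if $P=\mathcal P$, or if $P=R(X,P')$ or $P=L(X,P')$ where $P'$ arises,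 $X\in\mathcal R^e_j$, and $j\in J(P')$ is of maximal length $p'_j$ among the jobs in $J(P')$. **Theorem.** 1. The unidirectional maintenance scheduling problem with $n$ jobs can be solved in time $O(n^4)$: there is one program for an integer random access machine (unit cost for each literal, register or memory access, addition, subtraction, multiplication, integer division, assignment and comparison) and constants $K$, $C$ such that, on every instance, given by $n$, $m$ and the numerators and denominators of the data, the program stops after at most $K(n^4+1)$ steps with an optimal solution $(s_j)$ (as fractions) and the optimal value, while all numbers that occur have absolute value at most $(M+2)^C$, where $M$ is any bound on the absolute values of the input numbers. 2. There is a constant $K$ such that for every instance with $n$ jobs at most $K(n^3+1)$ sets $P$ arise. 3. For every instance with $n$ jobs: - every $P$ that arises is an interval of $\mathcal P$ (possibly empty); - for every job $j$, all members of $\mathcal R_j$ are finite and have the same cardinality $p'_j$, and $|\mathcal R^e_j|\le n+1$; - for every $P\subseteq\mathcal P$, every job of maximal length in $J(P)$ is splitting for $P$; - $c(\mathcal P)$ is the minimum number of cancelled paths, and for every $P$ that arises, $c(P)=0$ if $J(P)=\emptyset$, and otherwise, for every job $j$ of maximal length in $J(P)$, $$c(P)=\min_{X\in\mathcal R^e_j}\bigl(|X\cap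 P|+c(R(X,P))+c(L(X,P))\bigr).$$ -/

import Mathlib

namespace MaintenanceScheduling

/-! ### The unidirectional maintenance scheduling problem -/

/-- A maintenance job: earliest start time, latest finish time, processing time, and the two ends
of the part of the corridor that it possesses. -/
structure Job where
  release : ℚ
  due : ℚ
  proc : ℚ
  startLoc : ℚ
  endLoc : ℚ

/-- An instance with `n` jobs: the corridor is `[0, L]`, and there are `m` up-paths with headway `Δ`
and travel time `δ`. -/
structure Instance (n : ℕ) where
  m : ℕ
  L : ℚ
  Δ : ℚ
  δ : ℚ
  job : Fin n → Job
  L_pos : 0 < L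
  Δ_pos : 0 < Δ
  δ_pos : 0 < δ
  release_nonneg : ∀ j, 0 ≤ (job j).release
  proc_nonneg : ∀ j, 0 ≤ (job j).proc
  release_add_proc_le : ∀ j, (job j).release + (job j).proc ≤ (job j).due
  startLoc_nonneg : ∀ j, 0 ≤ (job j).startLoc
  startLoc_le_endLoc : ∀ j, (job j).startLoc ≤ (job j).endLoc
  endLoc_le : ∀ j, (job j).endLoc ≤ L

namespace Instance

variable {n : ℕ} (I : Instance n)

/-- The up-path with index `i`, as a segment in the time-location plane. The paths of the instance
are those with index `1, …, m`. -/
def trainPath (i : ℤ) : Set (ℝ × ℝ) :=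
  segment ℝ ((i : ℝ) * I.Δ, (0 : ℝ)) ((i : ℝ) * I.Δ + I.δ, (I.L : ℝ))

/-- The box occupied by job `j` when it starts at time `s`. -/
def box (j : Fin n) (s : ℝ) : Set (ℝ × ℝ) :=
  Set.Icc s (s + (I.job j).proc) ×ˢ
    Set.Icc ((I.job j).startLoc : ℝ) ((I.job j).endLoc : ℝ)

/-- The indices `i` for which the line `ℓ_i` meets the box of job `j` started at time `s`. All
integers `i` are allowed here; intersect with `I.paths` to get the paths of the instance. -/
def crossed (j : Fin n) (s : ℝ) : Set ℤ :=
  {i | (I.trainPath i ∩ I.box j s).Nonempty}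

/-- The (indices of the) train paths of the instance. -/
def paths : Set ℤ := Set.Icc 1 (I.m : ℤ)

/-- The start times allowed for job `j`. -/
def window (j : Fin n) : Set ℝ :=
  Set.Icc ((I.job j).release : ℝ) ((I.job j).due - (I.job j).proc)

def Feasible (s : Fin n → ℝ) : Prop := ∀ j, s j ∈ I.window j

/-- The paths of the instance cancelled by the start times `s`. -/
def cancelled (s : Fin n → ℝ) : Set ℤ := {i ∈ I.paths | ∃ j, i ∈ I.crossed j (s j)}

/-- `s` is an optimal solution. -/
def IsOptimal (s : Fin n → ℝ) : Prop :=
  I.Feasible s ∧ ∀ s', I.Feasible s' → (I.cancelled s).ncard ≤ (I.cancelled s').ncard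

/-! ### The notions of the interval dynamic program -/

/-- The non-dominated (inclusion-minimal) possessions of job `j`. -/
def possessions (j : Fin n) : Set (Set ℤ) :=
  {R | Minimal (fun R' : Set ℤ => ∃ s ∈ I.window j, R' = I.crossed j s) R}

/-- The length of job `j`: the number of elements of its possessions. -/
noncomputable def len (j : Fin n) : ℕ := sInf {k | ∃ R ∈ I.possessions j, R.ncard = k}

/-- The index of the leftmost path in a possession of `j`. -/
noncomputable def first (j : Fin n) : ℤ := sInf (⋃ R ∈ I.possessions j, R)

/-- The index of the rightmost path in a possession of `j`. -/
noncomputable def last (j : Fin n) : ℤ := sSup (⋃ R ∈ I.possessions j, R)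

/-- The jobs that possess at least one path in `P`, regardless of their start times. -/
def jobsOn (P : Set ℤ) : Set (Fin n) := {j | ∀ R ∈ I.possessions j, (R ∩ P).Nonempty}

/-- The minimum number of cancelled paths in `P` for scheduling the jobs in `jobsOn P`. -/
noncomputable def cost (P : Set ℤ) : ℕ :=
  sInf {k | ∃ R : Fin n → Set ℤ, (∀ j ∈ I.jobsOn P, R j ∈ I.possessions j) ∧
    k = (⋃ j ∈ I.jobsOn P, R j ∩ P).ncard}

/-- The elements of `P` on the right-hand side of all elements of `X`. -/
def rightOf (X P : Set ℤ) : Set ℤ := {i ∈ P | ∀ k ∈ X, k < i}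

/-- The elements of `P` on the left-hand side of all elements of `X`. -/
def leftOf (X P : Set ℤ) : Set ℤ := {i ∈ P | ∀ k ∈ X, i < k}

/-- Jobs in `jobsOn (P \ X)` all of whose paths in `P \ X` are to the right of `X`. -/
def jobsRight (X P : Set ℤ) : Set (Fin n) :=
  {j ∈ I.jobsOn (P \ X) | ∀ Y ∈ I.possessions j, (Y ∩ P) \ X ⊆ rightOf X P}

/-- Jobs in `jobsOn (P \ X)` all of whose paths in `P \ X` are to the left of `X`. -/
def jobsLeft (X P : Set ℤ) : Set (Fin n) :=
  {j ∈ I.jobsOn (P \ X) | ∀ Y ∈ I.possessions j, (Y ∩ P) \ X ⊆ leftOf X P}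

/-- `j` is a splitting job for `P`. -/
def IsSplitting (P : Set ℤ) (j : Fin n) : Prop :=
  j ∈ I.jobsOn P ∧
    ∀ X ∈ I.possessions j, I.jobsOn (P \ X) = I.jobsLeft X P ∪ I.jobsRight X P

/-- `j` is a job of maximal length in `jobsOn P`. -/
def IsLongest (P : Set ℤ) (j : Fin n) : Prop :=
  j ∈ I.jobsOn P ∧ ∀ j' ∈ I.jobsOn P, I.len j' ≤ I.len j

/-- The candidate possessions of `j`: those which start at the first path of `j` or at the latest
start path of some job. -/
def candidates (j : Fin n) : Set (Set ℤ) :=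
  {X ∈ I.possessions j | ∃ a, IsLeast X a ∧
    (a = I.first j ∨ ∃ j', a = I.last j' - I.len j' + 1)}

/-- The sets of paths that can come up in the dynamic program which starts with all paths and, at a
set `P`, branches on the candidate possessions `X` of a job of maximal length, leaving the parts of
`P` on the two sides of `X`. -/
inductive Arises : Set ℤ → Prop
  | all : Arises I.paths
  | left {P X : Set ℤ} {j : Fin n} :
      Arises P → I.IsLongest P j → X ∈ I.candidates j → Arises (leftOf X P)
  | right {P X : Set ℤ} {j : Fin n} :
      Arises P → I.IsLongest P j → X ∈ I.candidates j → Arises (rightOf X P)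

end Instance

/-! ### Random access machine with bounded words -/

/-- A machine state: registers, and a memory addressed by integers. -/
structure State where
  reg : ℕ → ℤ
  mem : ℤ → ℤ

inductive Expr where
  | lit (z : ℤ)
  | reg (k : ℕ)
  | mem (a : Expr)
  | add (a b : Expr)
  | sub (a b : Expr)
  | mul (a b : Expr)
  | div (a b : Expr)

namespace Expr

/-- The value of an expression (`div` is integer division, rounding down for positive divisors). -/
def eval (σ : State) : Expr → ℤ
  | lit z => z
  | reg k => σ.reg k
  | mem a => σ.mem (a.eval σ)
  | add a b => a.eval σ + b.eval σ
  | sub a b => a.eval σ - b.eval σ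
  | mul a b => a.eval σ * b.eval σ
  | div a b => a.eval σ / b.eval σ

/-- Each literal, register access, memory access and arithmetic operation takes one step. -/
def time : Expr → ℕ
  | lit _ => 1
  | reg _ => 1
  | mem a => a.time + 1
  | add a b => a.time + b.time + 1
  | sub a b => a.time + b.time + 1
  | mul a b => a.time + b.time + 1
  | div a b => a.time + b.time + 1

/-- All values occurring in the evaluation, including addresses, are words of absolute value at
most `W`. -/
def Fits (W : ℤ) (σ : State) : Expr → Prop
  | lit z => |z| ≤ W
  | reg k => |σ.reg k| ≤ W
  | mem a => a.Fits W σ ∧ |σ.mem (a.eval σ)| ≤ W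
  | add a b => a.Fits W σ ∧ b.Fits W σ ∧ |a.eval σ + b.eval σ| ≤ W
  | sub a b => a.Fits W σ ∧ b.Fits W σ ∧ |a.eval σ - b.eval σ| ≤ W
  | mul a b => a.Fits W σ ∧ b.Fits W σ ∧ |a.eval σ * b.eval σ| ≤ W
  | div a b => a.Fits W σ ∧ b.Fits W σ ∧ |a.eval σ / b.eval σ| ≤ W

end Expr

inductive Program where
  | skip
  | assign (k : ℕ) (e : Expr)
  | store (a e : Expr)
  | seq (p q : Program)
  | ifLe (a b : Expr) (p q : Program)
  | whileLe (a b : Expr) (p : Program)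

/-- `Exec W p σ σ' t`: with words bounded by `W`, the program `p` started in the state `σ` stops in
the state `σ'` after `t` steps. -/
inductive Exec (W : ℤ) : Program → State → State → ℕ → Prop
  | skip (σ : State) : Exec W .skip σ σ 1
  | assign (σ : State) (k : ℕ) (e : Expr) (h : e.Fits W σ) :
      Exec W (.assign k e) σ ⟨Function.update σ.reg k (e.eval σ), σ.mem⟩ (e.time + 1)
  | store (σ : State) (a e : Expr) (ha : a.Fits W σ) (he : e.Fits W σ) :
      Exec W (.store a e) σ ⟨σ.reg, Function.update σ.mem (a.eval σ) (e.eval σ)⟩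
        (a.time + e.time + 1)
  | seq {σ₁ σ₂ σ₃ : State} {p q : Program} {t u : ℕ}
      (hp : Exec W p σ₁ σ₂ t) (hq : Exec W q σ₂ σ₃ u) : Exec W (.seq p q) σ₁ σ₃ (t + u)
  | ifTrue {σ σ' : State} {a b : Expr} {p q : Program} {t : ℕ}
      (ha : a.Fits W σ) (hb : b.Fits W σ) (hab : a.eval σ ≤ b.eval σ) (hp : Exec W p σ σ' t) :
      Exec W (.ifLe a b p q) σ σ' (a.time + b.time + 1 + t)
  | ifFalse {σ σ' : State} {a b : Expr} {p q : Program} {t : ℕ}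
      (ha : a.Fits W σ) (hb : b.Fits W σ) (hab : b.eval σ < a.eval σ) (hq : Exec W q σ σ' t) :
      Exec W (.ifLe a b p q) σ σ' (a.time + b.time + 1 + t)
  | whileTrue {σ₁ σ₂ σ₃ : State} {a b : Expr} {p : Program} {t u : ℕ}
      (ha : a.Fits W σ₁) (hb : b.Fits W σ₁) (hab : a.eval σ₁ ≤ b.eval σ₁)
      (hp : Exec W p σ₁ σ₂ t) (hloop : Exec W (.whileLe a b p) σ₂ σ₃ u) :
      Exec W (.whileLe a b p) σ₁ σ₃ (a.time + b.time + 1 + t + u)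
  | whileFalse {σ : State} {a b : Expr} {p : Program}
      (ha : a.Fits W σ) (hb : b.Fits W σ) (hab : b.eval σ < a.eval σ) :
      Exec W (.whileLe a b p) σ σ (a.time + b.time + 1)

namespace Instance

variable {n : ℕ} (I : Instance n)

/-- The ten words that describe job `j`: numerators and denominators of its data. -/
def jobWords (j : Fin n) : List ℤ :=
  [(I.job j).release.num, (I.job j).release.den, (I.job j).due.num, (I.job j).due.den,
   (I.job j).proc.num, (I.job j).proc.den, (I.job j).startLoc.num, (I.job j).startLoc.den,
   (I.job j).endLoc.num, (I.job j).endLoc.den]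

/-- The input of the machine. -/
def words : List ℤ :=
  [(n : ℤ), (I.m : ℤ), I.L.num, I.L.den, I.Δ.num, I.Δ.den, I.δ.num, I.δ.den] ++
    (List.ofFn I.jobWords).flatten

/-- The initial state: the input stands in memory from address `0` on, everything else is `0`. -/
def initial : State where
  reg := fun _ => 0
  mem := fun a => if 0 ≤ a then I.words.getD a.toNat 0 else 0

/-- The start time of job `j` that is read off from a final state: its numerator and denominator
stand where those of the release time of `j` stood in the input. -/
def outputStart (_I : Instance n) (σ : State) (j : Fin n) : ℚ :=
  (σ.mem (8 + 10 * (j : ℤ)) : ℚ) / (σ.mem (8 + 10 * (j : ℤ) + 1) : ℚ)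

/-- The final state `σ` shows an optimal solution, written with positive denominators, and, in
register `0`, the optimal objective value. -/
def SolvedBy (σ : State) : Prop :=
  (∀ j : Fin n, 0 < σ.mem (8 + 10 * (j : ℤ) + 1)) ∧
    I.IsOptimal (fun j => (I.outputStart σ j : ℝ)) ∧
    σ.reg 0 = (I.cancelled (fun j => (I.outputStart σ j : ℝ))).ncard

end Instance

/-- One program solves every instance of the unidirectional maintenance scheduling problem with `n`
jobs in at most `T n` steps, using words that are polynomially bounded in the largest absolute value
of an input word (one of which is `n`), that is, words of logarithmic bit length. -/
def SolvableInTime (T : ℕ → ℕ) : Prop :=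
  ∃ (p : Program) (C : ℕ), ∀ (n : ℕ) (I : Instance n) (M : ℕ), (∀ z ∈ I.words, |z| ≤ (M : ℤ)) →
    ∃ (σ : State) (t : ℕ),
      Exec (((M : ℤ) + 2) ^ C) p I.initial σ t ∧ t ≤ T n ∧ I.SolvedBy σ

end MaintenanceScheduling

namespace MaintenanceScheduling

/-! ### Integer points of a sliding interval -/

/-! Measured in headways, the paths crossed by a job are the integers in an interval of fixed length
whose left end slides over a bounded range. Such an interval contains `⌊lam⌋` or `⌊lam⌋ + 1`
integers, and it follows that the minimal possessions of a job are blocks of one common length whose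
first elements run through all integers from `lo` to `hi` (`mem_possessions`). The rest of the
combinatorics concerns such blocks only.

Let `j` be a longest job on an interval of paths and `X` its block at `a`. A job that could reach
beyond `X` on both sides could also start at `a`, and there it would lie inside `X`, being no longer
than `j`. Hence the jobs that still need paths outside `X` separate into a right and a left part
(`IsLongest.isSplitting`), and the cost is at most that of `X` plus the costs of the two sides
(`cost_le_of_isLongest`); for the block of `j` in an optimal solution there is equality
(`le_ncard_covered`).

Few starts `a` suffice, by an exchange argument (`exists_candidate_start`). As long as another job
starts before `j` and reaches the first path of `j`, moving `j` one step to the left is free. If no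
such job exists, `j` and the jobs that start soon after it are pushed together to the nearest latest
start of a job, and the paths given up at the front pay for those gained at the back. So `j` may
start at its own earliest path or at the latest start of some job. A left end of an interval is
therefore given by a job and a candidate start, a right end by a candidate start alone, which makes
`O(n³)` intervals.

The program tabulates the costs for `O(n³)` pairs of ends. The number of jobs of an interval drops
in every branch, so the intervals are solved in the order of this number: each of `n` levels scans
all of them, and each one is solved on a single level with `O(n)` branches, in total `O(n⁴)` steps.
The solution is read off job by job, by descending along the recorded choices (`exists_descent`).
Stored words are bounded by a fixed power `V` of `M + 2`, and evaluating one of the finitely many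
expressions of the program only raises `V` to a fixed power (`Reads.fits`). -/

/-- The integers in `[x, x + lam]`. -/
def window (lam x : ℝ) : Set ℤ := {i | x ≤ i ∧ (i : ℝ) ≤ x + lam}

/-- The number of integers in the sparsest windows with left end in `[x₀, x₁]`. -/
noncomputable def windowSize (lam x₀ x₁ : ℝ) : ℤ :=
  if ⌊x₀ + lam⌋ - ⌊lam⌋ < ⌈x₁⌉ then ⌊lam⌋ else ⌊lam⌋ + 1

/-- The least element of the leftmost sparsest window. -/
noncomputable def windowStart (lam x₀ x₁ : ℝ) : ℤ :=
  if ⌊x₀ + lam⌋ - ⌊lam⌋ < ⌈x₁⌉ then ⌊x₀ + lam⌋ - ⌊lam⌋ + 1 else ⌈x₁⌉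

/-- A left end in `[x₀, x₁]` for which the window has least element `a`. -/
noncomputable def windowPoint (lam x₀ x₁ : ℝ) (k a : ℤ) : ℝ :=
  if x₁ + lam < a + k then x₁
  else if (a : ℝ) - 1 < x₀ then x₀
  else ((a - 1) + (a + k - lam)) / 2

section window

variable {lam x₀ x₁ : ℝ}

theorem windowSize_nonneg (hl : 0 ≤ lam) : 0 ≤ windowSize lam x₀ x₁ := by
  have := Int.floor_nonneg.2 hl
  unfold windowSize
  split_ifs <;> omega

theorem windowStart_le : windowStart lam x₀ x₁ ≤ ⌈x₁⌉ := by
  unfold windowStart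
  split_ifs <;> omega

/-- A window consists of the `k` integers from `a` on when its left end lies in `(a - 1, a]` and its
right end in `[a + k - 1, a + k)`. For `k = ⌊lam⌋` this allows every left end in the open interval
`(a - 1, a + k - lam)`, and `windowPoint` picks `x₁`, `x₀` or the midpoint, whichever is certain to
be both in that interval and in `[x₀, x₁]`. -/
theorem windowPoint_spec (h : x₀ ≤ x₁) {a : ℤ}
    (ha : windowStart lam x₀ x₁ ≤ a) (ha' : a ≤ ⌈x₁⌉) :
    windowPoint lam x₀ x₁ (windowSize lam x₀ x₁) a ∈ Set.Icc x₀ x₁ ∧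
      window lam (windowPoint lam x₀ x₁ (windowSize lam x₀ x₁) a) =
        Set.Icc a (a + windowSize lam x₀ x₁ - 1) := by
  have key : ∀ (x : ℝ) (k : ℤ), (a : ℝ) - 1 < x → x ≤ a → (a : ℝ) + k - 1 ≤ x + lam →
      x + lam < a + k → window lam x = Set.Icc a (a + k - 1) := by
    intro x k h1 h2 h3 h4
    ext i
    simp only [window, Set.mem_ofPred_eq, Set.mem_Icc]
    constructor
    · rintro ⟨h5, h6⟩
      have h7 : (a : ℝ) < i + 1 := by linarith
      have h8 : (i : ℝ) < a + k := by linarith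
      norm_cast at h7 h8
      omega
    · rintro ⟨h5, h6⟩
      have h5' : (a : ℝ) ≤ i := by exact_mod_cast h5
      have h6' : (i : ℝ) ≤ a + k - 1 := by exact_mod_cast h6
      constructor <;> linarith
  have e1 := Int.floor_le lam
  have e2 := Int.lt_floor_add_one lam
  have e3 := Int.floor_le (x₀ + lam)
  have e4 := Int.lt_floor_add_one (x₀ + lam)
  have e5 := Int.le_ceil x₁
  have e6 := Int.ceil_lt_add_one x₁
  by_cases hc : ⌊x₀ + lam⌋ - ⌊lam⌋ < ⌈x₁⌉
  · simp only [windowStart, if_pos hc] at ha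
    simp only [windowSize, if_pos hc]
    have ha1 : (⌊x₀ + lam⌋ : ℝ) - ⌊lam⌋ + 1 ≤ a := by exact_mod_cast ha
    have ha2 : (a : ℝ) ≤ ⌈x₁⌉ := by exact_mod_cast ha'
    unfold windowPoint
    split_ifs with h1 h2
    · exact ⟨⟨h, le_rfl⟩, key _ _ (by linarith) (by linarith) (by linarith) h1⟩
    · exact ⟨⟨le_rfl, h⟩, key _ _ h2 (by linarith) (by linarith) (by linarith)⟩
    · push Not at h1 h2
      exact ⟨⟨by linarith, by linarith⟩,
        key _ _ (by linarith) (by linarith) (by linarith) (by linarith)⟩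
  -- Here every window contains all integers from `⌈x₁⌉` to `⌊x₀ + lam⌋`, which are at least `⌊lam⌋
  -- + 1`, so the block at `⌈x₁⌉` is the only one.
  · simp only [windowStart, if_neg hc] at ha
    simp only [windowSize, if_neg hc]
    obtain rfl : a = ⌈x₁⌉ := le_antisymm ha' ha
    push Not at hc
    have hc1 : (⌈x₁⌉ : ℝ) ≤ ⌊x₀ + lam⌋ - ⌊lam⌋ := by exact_mod_cast hc
    have h1 : x₁ + lam < (⌈x₁⌉ : ℝ) + ((⌊lam⌋ + 1 : ℤ) : ℝ) := by push_cast; linarith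
    unfold windowPoint
    rw [if_pos h1]
    refine ⟨⟨h, le_rfl⟩, key _ _ (by linarith) e5 ?_ h1⟩
    push_cast
    linarith

/-- A window has at least `⌊lam⌋` elements, so its own first element serves as `a` unless it lies
before `windowStart`. In that case the window still reaches `⌊x₀ + lam⌋`, the last element of the
leftmost block. -/
theorem exists_Icc_subset_window (lam : ℝ) {x : ℝ} (hx : x ∈ Set.Icc x₀ x₁) :
    ∃ a, windowStart lam x₀ x₁ ≤ a ∧ a ≤ ⌈x₁⌉ ∧
      Set.Icc a (a + windowSize lam x₀ x₁ - 1) ⊆ window lam x := by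
  have key : ∀ a b : ℤ, ⌈x⌉ ≤ a → b ≤ ⌊x + lam⌋ → Set.Icc a b ⊆ window lam x := by
    rintro a b h1 h2 i ⟨h3, h4⟩
    exact ⟨Int.ceil_le.1 (h1.trans h3), Int.le_floor.1 (h4.trans h2)⟩
  have h1 : ⌈x⌉ ≤ ⌈x₁⌉ := Int.ceil_le_ceil hx.2
  have h2 : ⌊x₀ + lam⌋ ≤ ⌊x + lam⌋ := Int.floor_le_floor (by linarith [hx.1])
  have h3 : ⌈x⌉ + ⌊lam⌋ - 1 ≤ ⌊x + lam⌋ := by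
    rw [Int.le_floor]
    push_cast
    linarith [Int.ceil_lt_add_one x, Int.floor_le lam]
  unfold windowStart windowSize
  split_ifs with hc
  · by_cases h4 : ⌊x₀ + lam⌋ - ⌊lam⌋ + 1 ≤ ⌈x⌉
    · exact ⟨⌈x⌉, h4, h1, key _ _ le_rfl (by omega)⟩
    · exact ⟨_, le_rfl, by omega, key _ _ (by omega) (by omega)⟩
  · exact ⟨_, le_rfl, le_rfl, key _ _ h1 (by omega)⟩

/-- Blocks are windows and every window contains a block. Since all blocks have the same size, none
contains another properly, so the blocks are the minimal windows. -/
theorem minimal_window_iff (h : x₀ ≤ x₁) (R : Set ℤ) :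
    Minimal (fun R' => ∃ x ∈ Set.Icc x₀ x₁, R' = window lam x) R ↔
      ∃ a, windowStart lam x₀ x₁ ≤ a ∧ a ≤ ⌈x₁⌉ ∧
        R = Set.Icc a (a + windowSize lam x₀ x₁ - 1) := by
  constructor
  · rintro ⟨⟨x, hx, rfl⟩, hmin⟩
    obtain ⟨a, h1, h2, h3⟩ := exists_Icc_subset_window lam hx
    obtain ⟨h4, h5⟩ := windowPoint_spec h h1 h2
    exact ⟨a, h1, h2, (hmin ⟨_, h4, h5.symm⟩ h3).antisymm h3⟩
  · rintro ⟨a, h1, h2, rfl⟩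
    obtain ⟨h4, h5⟩ := windowPoint_spec h h1 h2
    refine ⟨⟨_, h4, h5.symm⟩, ?_⟩
    rintro _ ⟨x, hx, rfl⟩ hle
    obtain ⟨a', h1', h2', h3'⟩ := exists_Icc_subset_window lam hx
    refine le_trans ?_ h3'
    have hs := h3'.trans hle
    generalize windowSize lam x₀ x₁ = k at *
    rintro i ⟨hi1, hi2⟩
    have m1 := hs (show a' ∈ Set.Icc a' (a' + k - 1) from ⟨le_rfl, by omega⟩)
    have m2 := hs (show a' + k - 1 ∈ Set.Icc a' (a' + k - 1) from ⟨by omega, le_rfl⟩)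
    simp only [Set.mem_Icc] at m1 m2 ⊢
    omega

end window

namespace Instance

variable {n : ℕ} (I : Instance n)

/-! ### The possessions of a job -/

/-- A path moves monotonically, so it misses the box only by entering the possessed part of the
corridor after the end of the job or by leaving it before the start. -/
theorem mem_crossed {j : Fin n} {s : ℝ} {i : ℤ} : i ∈ I.crossed j s ↔
    (i : ℝ) * I.Δ + I.δ * (I.job j).startLoc / I.L ≤ s + (I.job j).proc ∧
      s ≤ i * I.Δ + I.δ * (I.job j).endLoc / I.L := by
  have hL : (0 : ℝ) < I.L := by exact_mod_cast I.L_pos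
  have hδ : (0 : ℝ) < I.δ := by exact_mod_cast I.δ_pos
  have hp : (0 : ℝ) ≤ (I.job j).proc := by exact_mod_cast I.proc_nonneg j
  have h0 : (0 : ℝ) ≤ (I.job j).startLoc := by exact_mod_cast I.startLoc_nonneg j
  have h1 : ((I.job j).startLoc : ℝ) ≤ (I.job j).endLoc := by
    exact_mod_cast I.startLoc_le_endLoc j
  have h2 : ((I.job j).endLoc : ℝ) ≤ I.L := by exact_mod_cast I.endLoc_le j
  generalize hls : ((I.job j).startLoc : ℝ) = ls at *
  generalize hle : ((I.job j).endLoc : ℝ) = le at *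
  simp only [crossed, trainPath, box, segment_eq_image', Set.mem_ofPred_eq, Set.Nonempty,
    Set.mem_inter_iff, Set.mem_image, Set.mem_prod, Set.mem_Icc, hls, hle]
  constructor
  · rintro ⟨_, ⟨θ, ⟨hθ0, hθ1⟩, rfl⟩, ⟨h3, h4⟩, h5, h6⟩
    simp only [Prod.smul_mk, Prod.mk_sub_mk, Prod.mk_add_mk, smul_eq_mul, sub_zero, zero_add,
      add_sub_cancel_left] at h3 h4 h5 h6
    have h7 : I.δ * ls / I.L ≤ θ * I.δ := by
      rw [div_le_iff₀ hL]; nlinarith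
    have h8 : θ * I.δ ≤ I.δ * le / I.L := by
      rw [le_div_iff₀ hL]; nlinarith
    constructor <;> linarith
  · rintro ⟨h3, h4⟩
    have hle : ls / I.L ≤ le / I.L := by gcongr
    have h5 : (s - i * I.Δ) / I.δ ≤ le / I.L := by
      rw [div_le_iff₀ hδ]
      have : le / I.L * I.δ = I.δ * le / I.L := by ring
      linarith
    have h6 : le / I.L ≤ 1 := by rw [div_le_one hL]; exact h2
    have h7 : 0 ≤ ls / I.L := by positivity
    have h8 : max (ls / I.L) ((s - i * I.Δ) / I.δ) * I.δ =
        max (I.δ * ls / I.L) (s - i * I.Δ) := by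
      rw [max_mul_of_nonneg _ _ hδ.le]
      congr 1 <;> field_simp
    -- The common point is the earliest point of the path that is inside the possessed part and not
    -- before time `s`.
    refine ⟨_, ⟨max (ls / I.L) ((s - i * I.Δ) / I.δ),
      ⟨h7.trans (le_max_left _ _), (max_le hle h5).trans h6⟩, rfl⟩, ?_⟩
    simp only [Prod.smul_mk, Prod.mk_sub_mk, Prod.mk_add_mk, smul_eq_mul, sub_zero, zero_add,
      add_sub_cancel_left, h8]
    refine ⟨⟨?_, ?_⟩, ?_, ?_⟩
    · linarith [le_max_right (I.δ * ls / I.L) (s - i * I.Δ)]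
    · have : max (I.δ * ls / I.L : ℝ) (s - i * I.Δ) ≤ s + (I.job j).proc - i * I.Δ :=
        max_le (by linarith) (by linarith)
      linarith
    · rw [← div_le_iff₀ hL]; exact le_max_left _ _
    · rw [← le_div_iff₀ hL]; exact max_le hle h5

/-- The number of headways spanned by the possessions of `j`. -/
noncomputable def spread (j : Fin n) : ℝ :=
  ((I.job j).proc + I.δ * (I.job j).endLoc / I.L - I.δ * (I.job j).startLoc / I.L) / I.Δ

/-- The position, in headways, of a possession of `j` with start time `s`. -/
noncomputable def position (j : Fin n) (s : ℝ) : ℝ :=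
  (s - I.δ * (I.job j).endLoc / I.L) / I.Δ

/-- The earliest position of `j`. -/
noncomputable def earliest (j : Fin n) : ℝ := I.position j (I.job j).release

/-- The latest position of `j`. -/
noncomputable def latest (j : Fin n) : ℝ := I.position j ((I.job j).due - (I.job j).proc)

/-- The number of paths in a non-dominated possession of `j`. -/
noncomputable def size (j : Fin n) : ℤ := windowSize (I.spread j) (I.earliest j) (I.latest j)

/-- The least first path of a non-dominated possession of `j`. -/
noncomputable def lo (j : Fin n) : ℤ := windowStart (I.spread j) (I.earliest j) (I.latest j)

/-- The greatest first path of a non-dominated possession of `j`. -/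
noncomputable def hi (j : Fin n) : ℤ := ⌈I.latest j⌉

theorem Δ_pos' : (0 : ℝ) < I.Δ := by exact_mod_cast I.Δ_pos

theorem spread_nonneg (j : Fin n) : 0 ≤ I.spread j := by
  have hL : (0 : ℝ) < I.L := by exact_mod_cast I.L_pos
  have hδ : (0 : ℝ) < I.δ := by exact_mod_cast I.δ_pos
  have hp : (0 : ℝ) ≤ (I.job j).proc := by exact_mod_cast I.proc_nonneg j
  have h1 : ((I.job j).startLoc : ℝ) ≤ (I.job j).endLoc := by
    exact_mod_cast I.startLoc_le_endLoc j
  have h2 : I.δ * (I.job j).startLoc / I.L ≤ (I.δ * (I.job j).endLoc / I.L : ℝ) := by gcongr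
  exact div_nonneg (by linarith) I.Δ_pos'.le

theorem earliest_le_latest (j : Fin n) : I.earliest j ≤ I.latest j := by
  have h : ((I.job j).release : ℝ) + (I.job j).proc ≤ (I.job j).due := by
    exact_mod_cast I.release_add_proc_le j
  exact div_le_div_of_nonneg_right (by linarith) I.Δ_pos'.le

/-- Dividing both inequalities of `mem_crossed` by the headway turns times into path indices; the
start time enters only through the left end of the window. -/
theorem crossed_eq_window (j : Fin n) (s : ℝ) :
    I.crossed j s = MaintenanceScheduling.window (I.spread j) (I.position j s) := by
  ext i
  have hΔ := I.Δ_pos'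
  rw [mem_crossed, and_comm, MaintenanceScheduling.window, Set.mem_ofPred_eq, position, spread,
    div_le_iff₀ hΔ, ← add_div, le_div_iff₀ hΔ]
  constructor <;> rintro ⟨h1, h2⟩ <;> constructor <;> linarith

theorem mem_window_iff_position {j : Fin n} {s : ℝ} :
    s ∈ I.window j ↔ I.position j s ∈ Set.Icc (I.earliest j) (I.latest j) := by
  have hΔ := I.Δ_pos'
  simp only [window, Set.mem_Icc, earliest, latest, position, div_le_div_iff_of_pos_right hΔ,
    sub_le_sub_iff_right]

theorem lo_le_hi (j : Fin n) : I.lo j ≤ I.hi j := windowStart_le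

theorem size_nonneg (j : Fin n) : 0 ≤ I.size j := windowSize_nonneg (I.spread_nonneg j)

theorem position_surjective (j : Fin n) (x : ℝ) :
    I.position j (x * I.Δ + I.δ * (I.job j).endLoc / I.L) = x := by
  have hΔ := I.Δ_pos'
  rw [position]
  field_simp
  ring

/-- The affine map `position` carries the allowed start times onto `[earliest, latest]`, which
reduces the claim to `minimal_window_iff`. -/
theorem mem_possessions_iff_size {j : Fin n} {R : Set ℤ} : R ∈ I.possessions j ↔
    ∃ a, I.lo j ≤ a ∧ a ≤ I.hi j ∧ R = Set.Icc a (a + I.size j - 1) := by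
  have h := minimal_window_iff (lam := I.spread j) (I.earliest_le_latest j) R
  rw [lo, hi, size, ← h, possessions, Set.mem_ofPred_eq]
  have : (fun R' => ∃ s ∈ I.window j, R' = I.crossed j s) =
      (fun R' => ∃ x ∈ Set.Icc (I.earliest j) (I.latest j),
        R' = MaintenanceScheduling.window (I.spread j) x) := by
    ext R'
    constructor
    · rintro ⟨s, hs, rfl⟩
      exact ⟨_, I.mem_window_iff_position.1 hs, I.crossed_eq_window j s⟩
    · rintro ⟨x, hx, rfl⟩
      rw [← I.position_surjective j x] at hx
      refine ⟨_, I.mem_window_iff_position.2 hx, ?_⟩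
      rw [crossed_eq_window, position_surjective]
  rw [this]

theorem ncard_Icc (a b : ℤ) : (Set.Icc a b).ncard = (b + 1 - a).toNat := by
  rw [← Finset.coe_Icc, Set.ncard_coe_finset, Int.card_Icc]

theorem len_eq_size (j : Fin n) : (I.len j : ℤ) = I.size j := by
  have : {k | ∃ R ∈ I.possessions j, R.ncard = k} = {(I.size j).toNat} := by
    ext k
    constructor
    · rintro ⟨R, hR, rfl⟩
      obtain ⟨a, -, -, rfl⟩ := I.mem_possessions_iff_size.1 hR
      rw [ncard_Icc, Set.mem_singleton_iff]
      congr 1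
      ring
    · rintro rfl
      refine ⟨_, I.mem_possessions_iff_size.2 ⟨I.lo j, le_rfl, I.lo_le_hi j, rfl⟩, ?_⟩
      rw [ncard_Icc]
      congr 1
      ring
  rw [len, this, csInf_singleton, Int.toNat_of_nonneg (I.size_nonneg j)]

/-- The block of paths of the length of `j` which starts at `a`. -/
def block (j : Fin n) (a : ℤ) : Set ℤ := Set.Icc a (a + I.len j - 1)

theorem mem_block {j : Fin n} {a i : ℤ} : i ∈ I.block j a ↔ a ≤ i ∧ i ≤ a + I.len j - 1 := Iff.rfl

theorem block_finite (j : Fin n) (a : ℤ) : (I.block j a).Finite := Set.finite_Icc _ _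

theorem ncard_block (j : Fin n) (a : ℤ) : (I.block j a).ncard = I.len j := by
  rw [block, ncard_Icc]
  omega

theorem mem_possessions {j : Fin n} {R : Set ℤ} : R ∈ I.possessions j ↔
    ∃ a, I.lo j ≤ a ∧ a ≤ I.hi j ∧ R = I.block j a := by
  rw [mem_possessions_iff_size, ← len_eq_size]
  rfl

theorem block_mem_possessions {j : Fin n} {a : ℤ} (h : I.lo j ≤ a) (h' : a ≤ I.hi j) :
    I.block j a ∈ I.possessions j := I.mem_possessions.2 ⟨a, h, h', rfl⟩

/-- A start time of `j` for which it crosses exactly the block which starts at `a`. -/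
noncomputable def startTime (j : Fin n) (a : ℤ) : ℝ :=
  windowPoint (I.spread j) (I.earliest j) (I.latest j) (I.size j) a * I.Δ
    + I.δ * (I.job j).endLoc / I.L

theorem startTime_spec {j : Fin n} {a : ℤ} (h : I.lo j ≤ a) (h' : a ≤ I.hi j) :
    I.startTime j a ∈ I.window j ∧ I.crossed j (I.startTime j a) = I.block j a := by
  obtain ⟨h1, h2⟩ := windowPoint_spec (I.earliest_le_latest j) h h'
  rw [mem_window_iff_position, crossed_eq_window, startTime, position_surjective, size, h2, block,
    len_eq_size]
  exact ⟨h1, rfl⟩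

theorem exists_block_subset_crossed {j : Fin n} {s : ℝ} (hs : s ∈ I.window j) :
    ∃ a, I.lo j ≤ a ∧ a ≤ I.hi j ∧ I.block j a ⊆ I.crossed j s := by
  rw [mem_window_iff_position] at hs
  rw [crossed_eq_window]
  obtain ⟨a, h1, h2, h3⟩ := exists_Icc_subset_window (I.spread j) hs
  refine ⟨a, h1, h2, ?_⟩
  rw [block, len_eq_size]
  exact h3

end Instance

namespace Instance

variable {n : ℕ} (I : Instance n)

/-! ### Blocks and splitting jobs -/

theorem mem_rightOf {X P : Set ℤ} {i : ℤ} : i ∈ rightOf X P ↔ i ∈ P ∧ ∀ k ∈ X, k < i := Iff.rfl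

theorem mem_leftOf {X P : Set ℤ} {i : ℤ} : i ∈ leftOf X P ↔ i ∈ P ∧ ∀ k ∈ X, i < k := Iff.rfl

theorem mem_jobsOn {P : Set ℤ} {j : Fin n} :
    j ∈ I.jobsOn P ↔ ∀ a, I.lo j ≤ a → a ≤ I.hi j → (I.block j a ∩ P).Nonempty := by
  constructor
  · exact fun h a h1 h2 => h _ (I.block_mem_possessions h1 h2)
  · intro h R hR
    obtain ⟨a, h1, h2, rfl⟩ := I.mem_possessions.1 hR
    exact h a h1 h2

theorem jobsOn_mono {P Q : Set ℤ} (h : P ⊆ Q) : I.jobsOn P ⊆ I.jobsOn Q :=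
  fun _ hj R hR => (hj R hR).mono (Set.inter_subset_inter_right R h)

/-- Only the two extreme blocks matter: the earliest must not end before `p` and the latest must not
start after `q`. This arithmetic form is also the test that the program performs. -/
theorem mem_jobsOn_Icc {p q : ℤ} {j : Fin n} : j ∈ I.jobsOn (Set.Icc p q) ↔
    1 ≤ I.len j ∧ p ≤ q ∧ I.hi j ≤ q ∧ p ≤ I.lo j + I.len j - 1 := by
  have hj := I.lo_le_hi j
  rw [mem_jobsOn]
  constructor
  · intro h
    obtain ⟨x, h1, h2⟩ := h _ le_rfl hj
    obtain ⟨y, h3, h4⟩ := h _ hj le_rfl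
    simp only [mem_block, Set.mem_Icc] at *
    omega
  · rintro ⟨h1, h2, h3, h4⟩ a h5 h6
    refine ⟨max a p, ?_, ?_⟩ <;> simp only [mem_block, Set.mem_Icc] <;> omega

theorem len_pos {P : Set ℤ} {j : Fin n} (h : j ∈ I.jobsOn P) : 1 ≤ I.len j := by
  obtain ⟨x, h1, -⟩ := I.mem_jobsOn.1 h _ le_rfl (I.lo_le_hi j)
  rw [mem_block] at h1
  omega

theorem mem_rightOf_block {j : Fin n} (hj : 1 ≤ I.len j) {a i : ℤ} {P : Set ℤ} :
    i ∈ rightOf (I.block j a) P ↔ i ∈ P ∧ a + I.len j ≤ i := by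
  rw [mem_rightOf]
  refine and_congr_right fun _ => ⟨fun h => ?_, fun h k hk => ?_⟩
  · have := h (a + I.len j - 1) ⟨by omega, le_rfl⟩
    omega
  · rw [mem_block] at hk
    omega

theorem mem_leftOf_block {j : Fin n} (hj : 1 ≤ I.len j) {a i : ℤ} {P : Set ℤ} :
    i ∈ leftOf (I.block j a) P ↔ i ∈ P ∧ i < a := by
  rw [mem_leftOf]
  refine and_congr_right fun _ => ⟨fun h => h a ⟨le_rfl, by omega⟩, fun h k hk => ?_⟩
  rw [mem_block] at hk
  omega

theorem rightOf_block {j : Fin n} (hj : 1 ≤ I.len j) (a p q : ℤ) :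
    rightOf (I.block j a) (Set.Icc p q) = Set.Icc (max p (a + I.len j)) q := by
  ext i
  rw [I.mem_rightOf_block hj, Set.mem_Icc, Set.mem_Icc]
  omega

theorem leftOf_block {j : Fin n} (hj : 1 ≤ I.len j) (a p q : ℤ) :
    leftOf (I.block j a) (Set.Icc p q) = Set.Icc p (min q (a - 1)) := by
  ext i
  rw [I.mem_leftOf_block hj, Set.mem_Icc, Set.mem_Icc]
  omega

theorem rightOf_block_of_mem {j : Fin n} {a p q : ℤ} (hj : j ∈ I.jobsOn (Set.Icc p q))
    (h : I.lo j ≤ a) : rightOf (I.block j a) (Set.Icc p q) = Set.Icc (a + I.len j) q := by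
  rw [I.rightOf_block (I.len_pos hj)]
  rw [mem_jobsOn_Icc] at hj
  congr 1
  omega

theorem leftOf_block_of_mem {j : Fin n} {a p q : ℤ} (hj : j ∈ I.jobsOn (Set.Icc p q))
    (h : a ≤ I.hi j) : leftOf (I.block j a) (Set.Icc p q) = Set.Icc p (a - 1) := by
  rw [I.leftOf_block (I.len_pos hj)]
  rw [mem_jobsOn_Icc] at hj
  congr 1
  omega

/-- Suppose that job `i` has a path of `P` beyond `X` on each side. A block of `i` that reaches
beyond the right end of `X` starts after `a`, because `i` is no longer than `j`, and one with a path
left of `X` starts before `a`. Hence `a` itself is an admissible start of `i`, and the block of `i`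
there lies in `X`, so that `i` does not need a path of `P \ X`. -/
theorem IsLongest.isSplitting {P : Set ℤ} {j : Fin n} (h : I.IsLongest P j) :
    I.IsSplitting P j := by
  refine ⟨h.1, fun X hX => Set.Subset.antisymm ?_ (Set.union_subset (fun i hi => hi.1)
    fun i hi => hi.1)⟩
  intro i hi
  obtain ⟨a, ha1, ha2, rfl⟩ := I.mem_possessions.1 hX
  have hj := I.len_pos h.1
  have hlen := h.2 i (I.jobsOn_mono Set.sdiff_subset hi)
  have hi' := I.mem_jobsOn.1 hi
  by_contra hcon
  have h1 : ∃ b x, I.lo i ≤ b ∧ b ≤ I.hi i ∧ x ∈ I.block i b ∧ x ∈ P ∧ a + I.len j ≤ x := by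
    by_contra! h1
    refine hcon (Or.inl ⟨hi, fun Y hY x hx => ?_⟩)
    obtain ⟨b, hb1, hb2, rfl⟩ := I.mem_possessions.1 hY
    have h2 := h1 b x hb1 hb2 hx.1.1 hx.1.2
    have h3 := hx.2
    rw [mem_block] at h3
    rw [I.mem_leftOf_block hj]
    exact ⟨hx.1.2, by omega⟩
  have h2 : ∃ b x, I.lo i ≤ b ∧ b ≤ I.hi i ∧ x ∈ I.block i b ∧ x ∈ P ∧ x < a := by
    by_contra! h1
    refine hcon (Or.inr ⟨hi, fun Y hY x hx => ?_⟩)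
    obtain ⟨b, hb1, hb2, rfl⟩ := I.mem_possessions.1 hY
    have h2 := h1 b x hb1 hb2 hx.1.1 hx.1.2
    have h3 := hx.2
    rw [mem_block] at h3
    rw [I.mem_rightOf_block hj]
    exact ⟨hx.1.2, by omega⟩
  obtain ⟨b, x, h3, h4, h5, h6, h7⟩ := h1
  obtain ⟨b', x', h3', h4', h5', h6', h7'⟩ := h2
  rw [mem_block] at h5 h5'
  obtain ⟨y, h8, h9⟩ := hi' a (by omega) (by omega)
  refine h9.2 ?_
  rw [mem_block] at h8 ⊢
  omega

/-! ### The cost of a choice of starts -/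

/-- Every job starts at an admissible path. -/
def Valid (b : Fin n → ℤ) : Prop := ∀ j, I.lo j ≤ b j ∧ b j ≤ I.hi j

/-- The paths in `P` possessed by the jobs in `jobsOn P`, started at `b`. -/
def covered (b : Fin n → ℤ) (P : Set ℤ) : Set ℤ := ⋃ j ∈ I.jobsOn P, I.block j (b j) ∩ P

theorem mem_covered {b : Fin n → ℤ} {P : Set ℤ} {i : ℤ} :
    i ∈ I.covered b P ↔ i ∈ P ∧ ∃ j ∈ I.jobsOn P, i ∈ I.block j (b j) := by
  simp only [covered, Set.mem_iUnion, Set.mem_inter_iff, exists_prop]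
  tauto

theorem covered_finite (b : Fin n → ℤ) (P : Set ℤ) : (I.covered b P).Finite :=
  Set.Finite.subset (Set.finite_iUnion fun j => I.block_finite j (b j)) fun _ hi =>
    let ⟨_, j, _, hj⟩ := I.mem_covered.1 hi
    Set.mem_iUnion.2 ⟨j, hj⟩

theorem valid_lo : I.Valid I.lo := fun j => ⟨le_rfl, I.lo_le_hi j⟩

/-- Possessions of jobs outside `jobsOn P` do not enter the cost, so they may be set to the block at
`lo`. -/
theorem costs_eq (P : Set ℤ) :
    {k | ∃ R : Fin n → Set ℤ, (∀ j ∈ I.jobsOn P, R j ∈ I.possessions j) ∧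
      k = (⋃ j ∈ I.jobsOn P, R j ∩ P).ncard} =
    {k | ∃ b, I.Valid b ∧ k = (I.covered b P).ncard} := by
  classical
  ext k
  constructor
  · rintro ⟨R, hR, rfl⟩
    choose! a h1 h2 h3 using fun j hj => I.mem_possessions.1 (hR j hj)
    refine ⟨fun j => if j ∈ I.jobsOn P then a j else I.lo j, fun j => ?_, ?_⟩
    · dsimp only
      split_ifs with hj
      · exact ⟨h1 j hj, h2 j hj⟩
      · exact I.valid_lo j
    · congr 1
      refine Set.iUnion₂_congr fun j hj => ?_
      dsimp only
      rw [if_pos hj, h3 j hj]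
  · rintro ⟨b, hb, rfl⟩
    exact ⟨fun j => I.block j (b j), fun j _ => I.block_mem_possessions (hb j).1 (hb j).2, rfl⟩

theorem isLeast_cost (P : Set ℤ) :
    IsLeast {k | ∃ b, I.Valid b ∧ k = (I.covered b P).ncard} (I.cost P) := by
  rw [cost, costs_eq]
  exact ⟨Nat.sInf_mem ⟨_, I.lo, I.valid_lo, rfl⟩, fun k hk => Nat.sInf_le hk⟩

theorem cost_le {b : Fin n → ℤ} (hb : I.Valid b) (P : Set ℤ) :
    I.cost P ≤ (I.covered b P).ncard := (I.isLeast_cost P).2 ⟨b, hb, rfl⟩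

theorem exists_cost_eq (P : Set ℤ) : ∃ b, I.Valid b ∧ I.cost P = (I.covered b P).ncard :=
  (I.isLeast_cost P).1

theorem cost_le_ncard {P : Set ℤ} (hP : P.Finite) : I.cost P ≤ P.ncard :=
  (I.cost_le I.valid_lo P).trans
    (Set.ncard_le_ncard (fun _ hi => (I.mem_covered.1 hi).1) hP)

theorem cost_eq_zero {P : Set ℤ} (h : I.jobsOn P = ∅) : I.cost P = 0 := by
  have := I.cost_le I.valid_lo P
  have h0 : I.covered I.lo P = ∅ := by
    ext i
    simp [mem_covered, h]
  rw [h0, Set.ncard_empty] at this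
  omega

/-! ### The recursion -/

open Classical in
/-- The starts obtained from starts `bR` on the right and `bL` on the left of the block of `j` at
`a`: all other jobs start as close to `a` as they can. -/
noncomputable def combine (j : Fin n) (p q a : ℤ) (bR bL : Fin n → ℤ) (i : Fin n) : ℤ :=
  if i ∈ I.jobsOn (Set.Icc (a + I.len j) q) then bR i
  else if i ∈ I.jobsOn (Set.Icc p (a - 1)) then bL i
  else max (I.lo i) (min (I.hi i) a)

theorem Valid.combine {bR bL : Fin n → ℤ} (hR : I.Valid bR) (hL : I.Valid bL)
    (j : Fin n) (p q a : ℤ) : I.Valid (I.combine j p q a bR bL) := by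
  intro i
  have := I.lo_le_hi i
  unfold Instance.combine
  split_ifs
  · exact hR i
  · exact hL i
  · omega

/-- A job needed on the right side can only start after `a`, so the part of its block before the
right side lies in the block of `j`; the left side is symmetric. A job needed on neither side,
started as close to `a` as possible, has all its paths from `[p, q]` inside the block of `j`,
because it is no longer than `j`. The start `a` does not have to be admissible for `j`. -/
theorem ncard_covered_combine_le {j : Fin n} {p q a : ℤ} {bR bL : Fin n → ℤ}
    (hj : I.IsLongest (Set.Icc p q) j) (hR : I.Valid bR) (hL : I.Valid bL) :
    (I.covered (I.combine j p q a bR bL) (Set.Icc p q)).ncard ≤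
      (I.block j a ∩ Set.Icc p q).ncard + (I.covered bR (Set.Icc (a + I.len j) q)).ncard
        + (I.covered bL (Set.Icc p (a - 1))).ncard := by
  refine (Set.ncard_le_ncard (t := I.block j a ∩ Set.Icc p q ∪
    I.covered bR (Set.Icc (a + I.len j) q) ∪ I.covered bL (Set.Icc p (a - 1))) ?_
    ((((I.block_finite j a).inter_of_left _).union (I.covered_finite _ _)).union
      (I.covered_finite _ _))).trans ((Set.ncard_union_le _ _).trans
        (Nat.add_le_add_right (Set.ncard_union_le _ _) _))
  intro x hx
  obtain ⟨hxP, i, hi, hxi⟩ := I.mem_covered.1 hx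
  have hlen := hj.2 i hi
  have hlo := I.lo_le_hi i
  have hRi := hR i
  have hLi := hL i
  simp only [Set.mem_union, Set.mem_inter_iff, mem_covered, mem_block, Set.mem_Icc] at hxi hxP ⊢
  unfold combine at hxi
  split_ifs at hxi with h1 h2
  · by_cases hx : a + I.len j ≤ x
    · exact Or.inl (Or.inr ⟨⟨hx, hxP.2⟩, i, h1, hxi⟩)
    · rw [mem_jobsOn_Icc] at h1
      omega
  · by_cases hx : x ≤ a - 1
    · exact Or.inr ⟨⟨hxP.1, hx⟩, i, h2, hxi⟩
    · rw [mem_jobsOn_Icc] at h2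
      omega
  · rw [mem_jobsOn_Icc] at h1 h2 hi
    omega

theorem cost_le_of_isLongest {j : Fin n} {p q a : ℤ} (hj : I.IsLongest (Set.Icc p q) j) :
    I.cost (Set.Icc p q) ≤ (I.block j a ∩ Set.Icc p q).ncard
      + I.cost (Set.Icc (a + I.len j) q) + I.cost (Set.Icc p (a - 1)) := by
  obtain ⟨bR, hR, eR⟩ := I.exists_cost_eq (Set.Icc (a + I.len j) q)
  obtain ⟨bL, hL, eL⟩ := I.exists_cost_eq (Set.Icc p (a - 1))
  rw [eR, eL]
  exact (I.cost_le (hR.combine I hL j p q a) _).trans (I.ncard_covered_combine_le hj hR hL)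

/-- The block of `j` and the two sides are disjoint, and a job needed on a side is needed on the
whole interval, so the restrictions of one schedule to the three parts add up to at most its cost.
-/
theorem le_ncard_covered {j : Fin n} {p q : ℤ} {b : Fin n → ℤ} (hb : I.Valid b)
    (hj : j ∈ I.jobsOn (Set.Icc p q)) :
    (I.block j (b j) ∩ Set.Icc p q).ncard + I.cost (Set.Icc (b j + I.len j) q)
      + I.cost (Set.Icc p (b j - 1)) ≤ (I.covered b (Set.Icc p q)).ncard := by
  have hbj := hb j
  have hj' := I.mem_jobsOn_Icc.1 hj
  have hR : Set.Icc (b j + I.len j) q ⊆ Set.Icc p q := Set.Icc_subset_Icc (by omega) le_rfl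
  have hL : Set.Icc p (b j - 1) ⊆ Set.Icc p q := Set.Icc_subset_Icc le_rfl (by omega)
  have hsub : ∀ {Q : Set ℤ}, Q ⊆ Set.Icc p q → I.covered b Q ⊆ I.covered b (Set.Icc p q) := by
    intro Q hQ x hx
    rw [mem_covered] at hx ⊢
    obtain ⟨h1, i, h2, h3⟩ := hx
    exact ⟨hQ h1, i, I.jobsOn_mono hQ h2, h3⟩
  refine (add_le_add (add_le_add_right (I.cost_le hb _) _) (I.cost_le hb _)).trans ?_
  have f0 := (I.block_finite j (b j)).inter_of_left (Set.Icc p q)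
  have f1 := I.covered_finite b (Set.Icc (b j + I.len j) q)
  have f2 := I.covered_finite b (Set.Icc p (b j - 1))
  rw [← Set.ncard_union_eq _ f0 f1, ← Set.ncard_union_eq _ (f0.union f1) f2]
  · refine Set.ncard_le_ncard ?_ (I.covered_finite _ _)
    refine Set.union_subset (Set.union_subset ?_ (hsub hR)) (hsub hL)
    exact fun x hx => I.mem_covered.2 ⟨hx.2, j, hj, hx.1⟩
  · rw [Set.disjoint_left]
    rintro x (⟨hx, -⟩ | hx) hx'
    · have := (I.mem_covered.1 hx').1
      rw [mem_block] at hx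
      rw [Set.mem_Icc] at this
      omega
    · have h1 := (I.mem_covered.1 hx').1
      have h2 := (I.mem_covered.1 hx).1
      rw [Set.mem_Icc] at h1 h2
      omega
  · rw [Set.disjoint_left]
    rintro x ⟨hx, -⟩ hx'
    have := (I.mem_covered.1 hx').1
    rw [mem_block] at hx
    rw [Set.mem_Icc] at this
    omega

/-- This is the exchange to the right. If no block from the left reaches `b j`, all jobs that start
in `[b j, c)` can be moved to `c`, where `c` is the nearest latest start. This empties the front of
the block of `j`, and since `j` is longest, it adds at most as many paths at the back. -/
theorem exists_shift_right {j : Fin n} {p q : ℤ} {b : Fin n → ℤ} (hb : I.Valid b)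
    (hj : I.IsLongest (Set.Icc p q) j) (hp : p ≤ b j)
    (hfree : ∀ i ∈ I.jobsOn (Set.Icc p q), b i < b j → b i + I.len i - 1 < b j) :
    ∃ b', I.Valid b' ∧
      (I.covered b' (Set.Icc p q)).ncard ≤ (I.covered b (Set.Icc p q)).ncard ∧
      ∃ i ∈ I.jobsOn (Set.Icc p q), b' j = I.hi i := by
  classical
  have hbj := hb j
  have hj' := I.mem_jobsOn_Icc.1 hj.1
  -- By minimality of `c`, a job that starts at or after `b j` has its latest start at or after `c`,
  -- so moving it to `c` is admissible.
  obtain ⟨i₀, hi₀, hmin⟩ := Set.exists_min_image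
    {i | i ∈ I.jobsOn (Set.Icc p q) ∧ b j ≤ I.hi i} I.hi (Set.toFinite _) ⟨j, hj.1, hbj.2⟩
  have hi₀j : I.hi i₀ ≤ I.hi j := hmin j ⟨hj.1, hbj.2⟩
  obtain ⟨hi₀P, hi₀b⟩ := hi₀
  generalize hc : I.hi i₀ = c at *
  refine ⟨fun i => if i ∈ I.jobsOn (Set.Icc p q) ∧ b j ≤ b i ∧ b i < c then c else b i,
    fun i => ?_, ?_, i₀, hi₀P, ?_⟩
  · have hbi := hb i
    dsimp only
    split_ifs with h
    · have := hmin i ⟨h.1, by omega⟩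
      omega
    · exact hbi
  -- `D₁` is vacated entirely and `D₂` contains everything that is gained; they are the two
  -- differences between the blocks of `j` at `b j` and at `c`, hence of equal size.
  · set U := I.covered b (Set.Icc p q) with hU
    set D₁ := Set.Icc (b j) (min (c - 1) (b j + I.len j - 1)) with hD₁
    set D₂ := Set.Icc (max c (b j + I.len j)) (c + I.len j - 1) with hD₂
    have hsub : D₁ ⊆ U := by
      intro x hx
      rw [hD₁, Set.mem_Icc] at hx
      refine I.mem_covered.2 ⟨⟨?_, ?_⟩, j, hj.1, ?_⟩
      · omega
      · omega
      · rw [mem_block]; omega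
    have hcard : D₁.ncard = D₂.ncard := by
      rw [hD₁, hD₂, ncard_Icc, ncard_Icc]
      congr 1
      omega
    have hU : U.Finite := I.covered_finite _ _
    have hle := Set.ncard_le_ncard hsub hU
    calc _ ≤ (U \ D₁ ∪ D₂).ncard := Set.ncard_le_ncard ?_ (hU.sdiff.union (Set.finite_Icc _ _))
      _ ≤ (U \ D₁).ncard + D₂.ncard := Set.ncard_union_le _ _
      _ = U.ncard := by
        rw [Set.ncard_sdiff hsub (Set.finite_Icc _ _), ← hcard]
        omega
    intro x hx
    obtain ⟨hxP, i, hi, hxi⟩ := I.mem_covered.1 hx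
    have hlen := hj.2 i hi
    rw [Set.mem_union, Set.mem_sdiff, hD₁, hD₂, Set.mem_Icc, Set.mem_Icc]
    rw [Set.mem_Icc] at hxP
    rw [mem_block] at hxi
    split_ifs at hxi with h
    · by_cases hx' : b j + I.len j ≤ x
      · right; omega
      · left
        exact ⟨I.mem_covered.2 ⟨hxP, j, hj.1, by rw [mem_block]; omega⟩, by omega⟩
    · left
      refine ⟨I.mem_covered.2 ⟨hxP, i, hi, hxi⟩, ?_⟩
      have := hfree i hi
      by_cases hbi : b i < b j
      · have := this hbi
        omega
      · have : ¬ b i < c := fun h' => h ⟨hi, by omega, h'⟩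
        omega
  · dsimp only
    split_ifs with h
    · exact hc.symm
    · have : ¬ b j < c := fun h' => h ⟨hj.1, le_rfl, h'⟩
      omega

theorem ncard_covered_update_le {j : Fin n} {p q c : ℤ} {b : Fin n → ℤ}
    (h : I.block j c ∩ Set.Icc p q ⊆ I.covered b (Set.Icc p q)) :
    (I.covered (Function.update b j c) (Set.Icc p q)).ncard ≤
      (I.covered b (Set.Icc p q)).ncard := by
  refine Set.ncard_le_ncard ?_ (I.covered_finite _ _)
  intro x hx
  obtain ⟨hxP, i, hi, hxi⟩ := I.mem_covered.1 hx
  obtain rfl | hij := eq_or_ne i j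
  · rw [Function.update_self] at hxi
    exact h ⟨hxi, hxP⟩
  · rw [Function.update_of_ne hij] at hxi
    exact I.mem_covered.2 ⟨hxP, i, hi, hxi⟩

theorem Valid.update {b : Fin n → ℤ} (hb : I.Valid b) {j : Fin n} {c : ℤ} (h : I.lo j ≤ c)
    (h' : c ≤ I.hi j) : I.Valid (Function.update b j c) := by
  intro i
  obtain rfl | hij := eq_or_ne i j
  · rw [Function.update_self]
    exact ⟨h, h'⟩
  · rw [Function.update_of_ne hij]
    exact hb i

/-- Induction on the distance of `b j` from the earliest start. Moves to the left are free while `j`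
starts before `p` or is overlapped from the left at its first path; otherwise `exists_shift_right`
ends the process. -/
theorem exists_candidate_start {j : Fin n} {p q : ℤ} {b : Fin n → ℤ} (hb : I.Valid b)
    (hj : I.IsLongest (Set.Icc p q) j) :
    ∃ b', I.Valid b' ∧
      (I.covered b' (Set.Icc p q)).ncard ≤ (I.covered b (Set.Icc p q)).ncard ∧
      (b' j = I.lo j ∨ ∃ i ∈ I.jobsOn (Set.Icc p q), b' j = I.hi i) := by
  induction hd : (b j - I.lo j).toNat generalizing b with
  | zero =>
    have := hb j
    exact ⟨b, hb, le_rfl, Or.inl (by omega)⟩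
  | succ d ih =>
    have hbj := hb j
    by_cases hp : p ≤ b j
    · by_cases hfree : ∀ i ∈ I.jobsOn (Set.Icc p q), b i < b j → b i + I.len i - 1 < b j
      · obtain ⟨b', h1, h2, h3⟩ := I.exists_shift_right hb hj hp hfree
        exact ⟨b', h1, h2, Or.inr h3⟩
      · push Not at hfree
        obtain ⟨i, hi, hi1, hi2⟩ := hfree
        -- The only path gained by the step to the left is `b j - 1`, which already belongs to the
        -- block of `i`.
        obtain ⟨b', h1, h2, h3⟩ := ih (b := Function.update b j (b j - 1))
          (hb.update I (by omega) (by omega)) (by rw [Function.update_self]; omega)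
        refine ⟨b', h1, h2.trans (I.ncard_covered_update_le ?_), h3⟩
        rintro x ⟨hx, hxP⟩
        rw [mem_block] at hx
        by_cases hx' : b j ≤ x
        · exact I.mem_covered.2 ⟨hxP, j, hj.1, by rw [mem_block]; omega⟩
        · exact I.mem_covered.2 ⟨hxP, i, hi, by rw [mem_block]; omega⟩
    -- The block of `j` sticks out of the interval on the left, so starting it earlier can only lose
    -- paths of the interval.
    · refine ⟨Function.update b j (I.lo j), hb.update I le_rfl (I.lo_le_hi j),
        I.ncard_covered_update_le ?_, Or.inl (Function.update_self ..)⟩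
      rintro x ⟨hx, hxP⟩
      refine I.mem_covered.2 ⟨hxP, j, hj.1, ?_⟩
      rw [mem_block] at hx ⊢
      rw [Set.mem_Icc] at hxP
      omega

/-- The cost of an interval in terms of the possessions of a longest job which start at one of
finitely many places. -/
theorem exists_start_cost_eq {j : Fin n} {p q : ℤ} (hj : I.IsLongest (Set.Icc p q) j) :
    ∃ a, I.lo j ≤ a ∧ a ≤ I.hi j ∧ (a = I.lo j ∨ ∃ i ∈ I.jobsOn (Set.Icc p q), a = I.hi i) ∧
      I.cost (Set.Icc p q) = (I.block j a ∩ Set.Icc p q).ncard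
        + I.cost (Set.Icc (a + I.len j) q) + I.cost (Set.Icc p (a - 1)) := by
  obtain ⟨b, hb, he⟩ := I.exists_cost_eq (Set.Icc p q)
  obtain ⟨b', hb', hle, hcand⟩ := I.exists_candidate_start hb hj
  refine ⟨b' j, (hb' j).1, (hb' j).2, hcand, le_antisymm (I.cost_le_of_isLongest hj) ?_⟩
  rw [he]
  exact (I.le_ncard_covered hb' hj.1).trans hle

end Instance
namespace Instance

variable {n : ℕ} (I : Instance n)

/-! ### Candidate possessions and the sets which arise -/

theorem mem_iUnion_possessions {j : Fin n} {i : ℤ} : i ∈ (⋃ R ∈ I.possessions j, R) ↔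
    1 ≤ I.len j ∧ I.lo j ≤ i ∧ i ≤ I.hi j + I.len j - 1 := by
  have hj := I.lo_le_hi j
  simp only [Set.mem_iUnion, exists_prop]
  constructor
  · rintro ⟨R, hR, hi⟩
    obtain ⟨a, h1, h2, rfl⟩ := I.mem_possessions.1 hR
    rw [mem_block] at hi
    omega
  · rintro ⟨h1, h2, h3⟩
    refine ⟨_, I.block_mem_possessions (a := min i (I.hi j)) (by omega) (by omega), ?_⟩
    rw [mem_block]
    omega

/-- For a job of length zero the union of the possessions is empty and `first` has the default value
`0`, which need not be `lo`. -/
theorem first_eq {j : Fin n} (h : 1 ≤ I.len j) : I.first j = I.lo j := by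
  have hj := I.lo_le_hi j
  refine IsLeast.csInf_eq ⟨I.mem_iUnion_possessions.2 ⟨h, le_rfl, by omega⟩, fun i hi => ?_⟩
  exact (I.mem_iUnion_possessions.1 hi).2.1

theorem last_eq {j : Fin n} (h : 1 ≤ I.len j) : I.last j = I.hi j + I.len j - 1 := by
  have hj := I.lo_le_hi j
  refine IsGreatest.csSup_eq ⟨I.mem_iUnion_possessions.2 ⟨h, by omega, le_rfl⟩, fun i hi => ?_⟩
  exact (I.mem_iUnion_possessions.1 hi).2.2

/-- Candidates have a least element, so `j` has positive length. The job `j'` may have length zero,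
which is why its contribution is left in terms of `last` and not rewritten with `hi`. -/
theorem mem_candidates {j : Fin n} {X : Set ℤ} : X ∈ I.candidates j ↔
    1 ≤ I.len j ∧ ∃ a, I.lo j ≤ a ∧ a ≤ I.hi j ∧ X = I.block j a ∧
      (a = I.first j ∨ ∃ j', a = I.last j' - I.len j' + 1) := by
  constructor
  · rintro ⟨hX, a, ha, h⟩
    obtain ⟨b, h1, h2, rfl⟩ := I.mem_possessions.1 hX
    have hb := I.mem_block.1 ha.1
    have h3 : a ≤ b := ha.2 (I.mem_block.2 ⟨le_rfl, by omega⟩)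
    obtain rfl : a = b := le_antisymm h3 hb.1
    exact ⟨by omega, a, h1, h2, rfl, h⟩
  · rintro ⟨h, a, h1, h2, rfl, h3⟩
    refine ⟨I.block_mem_possessions h1 h2, a, ⟨I.mem_block.2 ⟨le_rfl, by omega⟩, ?_⟩, h3⟩
    exact fun i hi => (I.mem_block.1 hi).1

theorem encard_range_le {α β : Type*} [Fintype α] (f : α → β) :
    (Set.range f).encard ≤ (Fintype.card α : ℕ∞) := by
  rw [← Set.image_univ]
  refine (Set.encard_image_le f _).trans ?_
  rw [Set.encard_univ, ENat.card_eq_coe_fintype_card]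

theorem encard_candidates_le (j : Fin n) : (I.candidates j).encard ≤ ((n + 1 : ℕ) : ℕ∞) := by
  have h : I.candidates j ⊆ Set.range fun o : Option (Fin n) =>
      I.block j (o.elim (I.first j) fun j' => I.last j' - I.len j' + 1) := by
    intro X hX
    obtain ⟨-, a, -, -, rfl, rfl | ⟨j', rfl⟩⟩ := I.mem_candidates.1 hX
    · exact ⟨none, rfl⟩
    · exact ⟨some j', rfl⟩
  refine (Set.encard_le_encard h).trans ((encard_range_le _).trans ?_)
  simp

/-- The codes `l` and `r` are made to be counted. A branch to the left changes only the right end,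
to the place before a candidate start; a branch to the right changes only the left end, which
depends on the candidate start and on the length of the job that starts there. -/
theorem Arises.exists_eq_Icc {P : Set ℤ} (hP : I.Arises P) :
    ∃ (l : Option (Fin n × Option (Fin n))) (r : Option (Fin n ⊕ Fin n)) (p q : ℤ),
      1 ≤ p ∧ q ≤ I.m ∧ P = Set.Icc p q ∧
      p = l.elim 1 (fun x => x.2.elim (I.first x.1) (fun j' => I.last j' - I.len j' + 1)
        + I.len x.1) ∧
      q = r.elim (I.m : ℤ) (fun x => Sum.elim I.first (fun j' => I.last j' - I.len j' + 1) x - 1) := by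
  induction hP with
  | all => exact ⟨none, none, 1, I.m, le_rfl, le_rfl, rfl, rfl, rfl⟩
  | @left P X j hP hj hX ih =>
    obtain ⟨l, r, p, q, h1, h2, rfl, h3, h4⟩ := ih
    obtain ⟨hl, a, ha1, ha2, rfl, ha⟩ := I.mem_candidates.1 hX
    have hjP := I.mem_jobsOn_Icc.1 hj.1
    rw [I.leftOf_block_of_mem hj.1 ha2]
    obtain rfl | ⟨j', rfl⟩ := ha
    · exact ⟨l, some (.inl j), p, _, h1, by omega, rfl, h3, rfl⟩
    · exact ⟨l, some (.inr j'), p, _, h1, by omega, rfl, h3, rfl⟩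
  | @right P X j hP hj hX ih =>
    obtain ⟨l, r, p, q, h1, h2, rfl, h3, h4⟩ := ih
    obtain ⟨hl, a, ha1, ha2, rfl, ha⟩ := I.mem_candidates.1 hX
    have hjP := I.mem_jobsOn_Icc.1 hj.1
    rw [I.rightOf_block_of_mem hj.1 ha1]
    obtain rfl | ⟨j', rfl⟩ := ha
    · exact ⟨some (j, none), r, _, q, by omega, h2, rfl, rfl, h4⟩
    · exact ⟨some (j, some j'), r, _, q, by omega, h2, rfl, rfl, h4⟩

/-- There are `n (n + 1) + 1` codes of left ends and `2 n + 1` codes of right ends; the factor `8`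
absorbs the lower order terms. -/
theorem encard_arises_le :
    {P : Set ℤ | I.Arises P}.encard ≤ ((8 * (n ^ 3 + 1) : ℕ) : ℕ∞) := by
  have h : {P : Set ℤ | I.Arises P} ⊆ Set.range
      fun x : Option (Fin n × Option (Fin n)) × Option (Fin n ⊕ Fin n) =>
        Set.Icc (x.1.elim 1 (fun x => x.2.elim (I.first x.1)
          (fun j' => I.last j' - I.len j' + 1) + I.len x.1))
        (x.2.elim (I.m : ℤ)
          (fun x => Sum.elim I.first (fun j' => I.last j' - I.len j' + 1) x - 1)) := by
    intro P hP
    obtain ⟨l, r, p, q, -, -, rfl, rfl, rfl⟩ := Arises.exists_eq_Icc I hP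
    exact ⟨(l, r), rfl⟩
  refine (Set.encard_le_encard h).trans ((encard_range_le _).trans ?_)
  simp only [Fintype.card_prod, Fintype.card_option, Fintype.card_fin, Fintype.card_sum]
  norm_cast
  rcases Nat.eq_zero_or_pos n with rfl | hn
  · norm_num
  · have h1 : n ^ 2 ≤ n ^ 3 := Nat.pow_le_pow_right hn (by norm_num)
    have h2 : n ≤ n ^ 2 := by nlinarith
    nlinarith

/-- The minimum is attained because the start from `exists_start_cost_eq` belongs to a job of
`jobsOn P`. Such a job has positive length, so `first` and `last` have their intended meaning. -/
theorem isLeast_cost_of_isLongest {P : Set ℤ} (hP : I.Arises P) {j : Fin n}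
    (hj : I.IsLongest P j) :
    IsLeast {k : ℕ | ∃ X ∈ I.candidates j,
      k = (X ∩ P).ncard + I.cost (rightOf X P) + I.cost (leftOf X P)} (I.cost P) := by
  obtain ⟨-, -, p, q, -, -, rfl, -, -⟩ := Arises.exists_eq_Icc I hP
  have hlen := I.len_pos hj.1
  constructor
  · obtain ⟨a, h1, h2, h3, h4⟩ := I.exists_start_cost_eq hj
    refine ⟨I.block j a, I.mem_candidates.2 ⟨hlen, a, h1, h2, rfl, ?_⟩, ?_⟩
    · obtain rfl | ⟨i, hi, rfl⟩ := h3
      · exact Or.inl (I.first_eq hlen).symm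
      · refine Or.inr ⟨i, ?_⟩
        rw [I.last_eq (I.len_pos hi)]
        ring
    · rw [I.rightOf_block_of_mem hj.1 h1, I.leftOf_block_of_mem hj.1 h2, h4]
  · rintro k ⟨X, hX, rfl⟩
    obtain ⟨-, a, h1, h2, rfl, -⟩ := I.mem_candidates.1 hX
    rw [I.rightOf_block_of_mem hj.1 h1, I.leftOf_block_of_mem hj.1 h2]
    exact I.cost_le_of_isLongest hj

/-! ### Optimal solutions -/

theorem paths_finite : I.paths.Finite := Set.finite_Icc _ _

theorem cancelled_finite (s : Fin n → ℝ) : (I.cancelled s).Finite :=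
  I.paths_finite.subset fun _ hi => hi.1

/-- Whatever a job crosses contains one of its blocks, and jobs outside `jobsOn` can only cancel
further paths. -/
theorem cost_paths_le {s : Fin n → ℝ} (hs : I.Feasible s) :
    I.cost I.paths ≤ (I.cancelled s).ncard := by
  choose b h1 h2 h3 using fun j => I.exists_block_subset_crossed (hs j)
  refine (I.cost_le (b := b) (fun j => ⟨h1 j, h2 j⟩) _).trans
    (Set.ncard_le_ncard ?_ (I.cancelled_finite s))
  intro x hx
  obtain ⟨hxP, j, -, hxj⟩ := I.mem_covered.1 hx
  exact ⟨hxP, j, h3 j hxj⟩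

/-- Starts which avoid the paths of the instance whenever this is possible. -/
def Avoiding (b : Fin n → ℤ) : Prop :=
  ∀ j, j ∉ I.jobsOn I.paths → Disjoint (I.block j (b j)) I.paths

/-- `covered` ignores the jobs that are able to avoid the paths of the instance; it equals the
cancelled set when these jobs do avoid them. -/
theorem cancelled_eq_covered {b : Fin n → ℤ} {s : Fin n → ℝ} (hb : I.Avoiding b)
    (hs : ∀ j, I.crossed j (s j) = I.block j (b j)) :
    I.cancelled s = I.covered b I.paths := by
  ext x
  rw [mem_covered]
  refine and_congr_right fun hx => ?_
  simp only [hs]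
  refine exists_congr fun j => ⟨fun h => ⟨?_, h⟩, fun h => h.2⟩
  by_contra hj
  exact Set.disjoint_left.1 (hb j hj) h hx

theorem isOptimal_of_covered {b : Fin n → ℤ} {s : Fin n → ℝ} (hb : I.Avoiding b)
    (hcost : (I.covered b I.paths).ncard ≤ I.cost I.paths) (hf : I.Feasible s)
    (hs : ∀ j, I.crossed j (s j) = I.block j (b j)) :
    I.IsOptimal s ∧ (I.cancelled s).ncard = I.cost I.paths := by
  have h := I.cancelled_eq_covered hb hs
  have h1 := I.cost_paths_le hf
  rw [← h] at hcost
  exact ⟨⟨hf, fun s' hs' => hcost.trans (I.cost_paths_le hs')⟩, le_antisymm hcost h1⟩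

/-- The starts of jobs outside `jobsOn` do not affect `covered`, so an optimal choice can be made
`Avoiding` by giving those jobs blocks off the paths. -/
theorem isLeast_cost_paths :
    IsLeast {k : ℕ | ∃ s, I.Feasible s ∧ k = (I.cancelled s).ncard} (I.cost I.paths) := by
  classical
  refine ⟨?_, fun k ⟨s, hs, hk⟩ => hk ▸ I.cost_paths_le hs⟩
  obtain ⟨b, hb, he⟩ := I.exists_cost_eq I.paths
  have h : ∀ j, ∃ c, I.lo j ≤ c ∧ c ≤ I.hi j ∧ (j ∈ I.jobsOn I.paths → c = b j) ∧
      (j ∉ I.jobsOn I.paths → Disjoint (I.block j c) I.paths) := by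
    intro j
    by_cases hj : j ∈ I.jobsOn I.paths
    · exact ⟨b j, (hb j).1, (hb j).2, fun _ => rfl, fun h => absurd hj h⟩
    · have hj' := hj
      simp only [mem_jobsOn, not_forall, Set.not_nonempty_iff_eq_empty] at hj'
      obtain ⟨c, h1, h2, h3⟩ := hj'
      exact ⟨c, h1, h2, fun h => absurd h hj, fun _ => Set.disjoint_iff_inter_eq_empty.2 h3⟩
  choose c h1 h2 h3 h4 using h
  have hcov : I.covered c I.paths = I.covered b I.paths :=
    Set.iUnion₂_congr fun j hj => by rw [h3 j hj]
  have hst := fun j => I.startTime_spec (h1 j) (h2 j)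
  have := I.isOptimal_of_covered (b := c) (s := fun j => I.startTime j (c j)) h4
    (by rw [hcov, he]) (fun j => (hst j).1) (fun j => (hst j).2)
  exact ⟨_, this.1.1, this.2.symm⟩

end Instance

/-! ### Reasoning about programs -/

namespace Expr

/-- The exponent of the word size that suffices to evaluate an expression: it grows by one with
each arithmetic operation, and a literal `z` needs `|z|`. -/
def depth : Expr → ℕ
  | lit z => z.natAbs
  | reg _ => 0
  | mem a => a.depth
  | add a b => max a.depth b.depth + 1
  | sub a b => max a.depth b.depth + 1
  | mul a b => max a.depth b.depth + 1
  | div a b => max a.depth b.depth + 1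

/-- The contents of all registers and memory cells read by the expression are at most `V`. -/
def Reads (V : ℤ) (σ : State) : Expr → Prop
  | lit _ => True
  | reg k => |σ.reg k| ≤ V
  | mem a => a.Reads V σ ∧ |σ.mem (a.eval σ)| ≤ V
  | add a b => a.Reads V σ ∧ b.Reads V σ
  | sub a b => a.Reads V σ ∧ b.Reads V σ
  | mul a b => a.Reads V σ ∧ b.Reads V σ
  | div a b => a.Reads V σ ∧ b.Reads V σ

theorem le_pow_depth {V : ℤ} (hV : 2 ≤ V) (d : ℕ) : V ≤ V ^ 2 ^ d := by
  calc V = V ^ 1 := (pow_one V).symm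
    _ ≤ V ^ 2 ^ d := pow_le_pow_right₀ (by omega) Nat.one_le_two_pow

theorem pow_depth_mono {V : ℤ} (hV : 2 ≤ V) {d e : ℕ} (h : d ≤ e) : V ^ 2 ^ d ≤ V ^ 2 ^ e :=
  pow_le_pow_right₀ (by omega) (Nat.pow_le_pow_right (by norm_num) h)

theorem Fits.mono {W W' : ℤ} (h : W ≤ W') {σ : State} {e : Expr} (he : e.Fits W σ) :
    e.Fits W' σ := by
  induction e with
  | lit z => exact le_trans he h
  | reg k => exact le_trans he h
  | mem a ih => exact ⟨ih he.1, he.2.trans h⟩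
  | add a b iha ihb => exact ⟨iha he.1, ihb he.2.1, he.2.2.trans h⟩
  | sub a b iha ihb => exact ⟨iha he.1, ihb he.2.1, he.2.2.trans h⟩
  | mul a b iha ihb => exact ⟨iha he.1, ihb he.2.1, he.2.2.trans h⟩
  | div a b iha ihb => exact ⟨iha he.1, ihb he.2.1, he.2.2.trans h⟩

theorem abs_ediv_le (a b : ℤ) : |a / b| ≤ |a| := by
  rw [Int.abs_eq_natAbs, Int.abs_eq_natAbs]
  exact_mod_cast Int.natAbs_ediv_le_natAbs a b

/-- If the operands are at most `B ≥ 2` in absolute value, then sum, difference, product and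
quotient are at most `B ^ 2`. So each level of an expression at worst squares the bound, which gives
the exponent `2 ^ depth`. -/
theorem Reads.fits {V : ℤ} (hV : 2 ≤ V) {σ : State} {e : Expr} (he : e.Reads V σ) :
    |e.eval σ| ≤ V ^ 2 ^ e.depth ∧ e.Fits (V ^ 2 ^ e.depth) σ := by
  have binop : ∀ {x y z : ℤ} {d d' : ℕ}, |x| ≤ V ^ 2 ^ d → |y| ≤ V ^ 2 ^ d' →
      (|z| ≤ |x| + |y| ∨ |z| ≤ |x| * |y| ∨ |z| ≤ |x|) → |z| ≤ V ^ 2 ^ (max d d' + 1) := by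
    intro x y z d d' hx hy hz
    have hx' := hx.trans (pow_depth_mono hV (le_max_left d d'))
    have hy' := hy.trans (pow_depth_mono hV (le_max_right d d'))
    have h2 := hV.trans (le_pow_depth hV (max d d'))
    rw [pow_succ 2, pow_mul]
    generalize V ^ 2 ^ max d d' = B at *
    have := abs_nonneg x
    have := abs_nonneg y
    rcases hz with h | h | h <;> nlinarith
  have hl : ∀ d d', V ^ 2 ^ d ≤ V ^ 2 ^ (max d d' + 1) := fun d d' =>
    pow_depth_mono hV ((le_max_left d d').trans (Nat.le_succ _))
  have hr : ∀ d d', V ^ 2 ^ d' ≤ V ^ 2 ^ (max d d' + 1) := fun d d' =>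
    pow_depth_mono hV ((le_max_right d d').trans (Nat.le_succ _))
  induction e with
  | lit z =>
    have h : |z| ≤ V ^ 2 ^ z.natAbs := by
      have h1 : z.natAbs ≤ 2 ^ 2 ^ z.natAbs :=
        (Nat.lt_two_pow_self.le).trans
          (Nat.pow_le_pow_right (by norm_num) Nat.lt_two_pow_self.le)
      calc |z| = (z.natAbs : ℤ) := Int.abs_eq_natAbs z
        _ ≤ 2 ^ 2 ^ z.natAbs := by exact_mod_cast h1
        _ ≤ V ^ 2 ^ z.natAbs := pow_le_pow_left₀ (by norm_num) hV _
    exact ⟨h, h⟩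
  | reg k =>
    have : |σ.reg k| ≤ V ^ 2 ^ 0 := by simpa [Reads] using he
    exact ⟨this, this⟩
  | mem a ih =>
    have h := he.2.trans (le_pow_depth hV a.depth)
    exact ⟨h, (ih he.1).2, h⟩
  | add a b iha ihb =>
    obtain ⟨a1, a2⟩ := iha he.1
    obtain ⟨b1, b2⟩ := ihb he.2
    have h := binop a1 b1 (Or.inl (abs_add_le _ _))
    exact ⟨h, a2.mono (hl _ _), b2.mono (hr _ _), h⟩
  | sub a b iha ihb =>
    obtain ⟨a1, a2⟩ := iha he.1
    obtain ⟨b1, b2⟩ := ihb he.2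
    have h := binop a1 b1 (Or.inl (abs_sub _ _))
    exact ⟨h, a2.mono (hl _ _), b2.mono (hr _ _), h⟩
  | mul a b iha ihb =>
    obtain ⟨a1, a2⟩ := iha he.1
    obtain ⟨b1, b2⟩ := ihb he.2
    have h := binop a1 b1 (Or.inr (Or.inl (abs_mul _ _).le))
    exact ⟨h, a2.mono (hl _ _), b2.mono (hr _ _), h⟩
  | div a b iha ihb =>
    obtain ⟨a1, a2⟩ := iha he.1
    obtain ⟨b1, b2⟩ := ihb he.2
    have h := binop (z := a.eval σ / b.eval σ) a1 b1 (Or.inr (Or.inr (abs_ediv_le _ _)))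
    exact ⟨h, a2.mono (hl _ _), b2.mono (hr _ _), h⟩

end Expr

namespace State

/-- All words of the state are at most `V ≥ 2`. -/
def Bounded (V : ℤ) (σ : State) : Prop :=
  2 ≤ V ∧ (∀ k, |σ.reg k| ≤ V) ∧ ∀ a, |σ.mem a| ≤ V

/-- The state after an assignment to a register. -/
def setReg (σ : State) (k : ℕ) (x : ℤ) : State := ⟨Function.update σ.reg k x, σ.mem⟩

/-- The state after an assignment to a memory cell. -/
def setMem (σ : State) (a x : ℤ) : State := ⟨σ.reg, Function.update σ.mem a x⟩

variable {V : ℤ} {σ : State}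

@[simp] theorem setReg_mem (k : ℕ) (x : ℤ) : (σ.setReg k x).mem = σ.mem := rfl

@[simp] theorem setMem_reg (a x : ℤ) : (σ.setMem a x).reg = σ.reg := rfl

theorem setReg_reg (k l : ℕ) (x : ℤ) :
    (σ.setReg k x).reg l = if l = k then x else σ.reg l := by
  simp [setReg, Function.update_apply]

theorem setMem_mem (a b x : ℤ) : (σ.setMem a x).mem b = if b = a then x else σ.mem b := by
  simp [setMem, Function.update_apply]

theorem Bounded.setReg (h : σ.Bounded V) {k : ℕ} {x : ℤ} (hx : |x| ≤ V) :
    (σ.setReg k x).Bounded V := by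
  refine ⟨h.1, fun l => ?_, h.2.2⟩
  rw [setReg_reg]
  split_ifs
  · exact hx
  · exact h.2.1 l

theorem Bounded.setMem (h : σ.Bounded V) {a x : ℤ} (hx : |x| ≤ V) :
    (σ.setMem a x).Bounded V := by
  refine ⟨h.1, h.2.1, fun b => ?_⟩
  rw [setMem_mem]
  split_ifs
  · exact hx
  · exact h.2.2 b

theorem Bounded.reads (h : σ.Bounded V) (e : Expr) : e.Reads V σ := by
  induction e with
  | lit z => trivial
  | reg k => exact h.2.1 k
  | mem a ih => exact ⟨ih, h.2.2 _⟩
  | add a b iha ihb => exact ⟨iha, ihb⟩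
  | sub a b iha ihb => exact ⟨iha, ihb⟩
  | mul a b iha ihb => exact ⟨iha, ihb⟩
  | div a b iha ihb => exact ⟨iha, ihb⟩

theorem Bounded.fits (h : σ.Bounded V) {e : Expr} {d : ℕ} (hd : e.depth ≤ d) :
    e.Fits (V ^ 2 ^ d) σ :=
  (((h.reads e).fits h.1).2).mono (Expr.pow_depth_mono h.1 hd)

end State

/-! ### Costs and preconditions of programs without loops -/

namespace Program

/-- The exponent of the word size that suffices to run a program on bounded states. -/
def depth : Program → ℕ
  | skip => 0
  | assign _ e => e.depth
  | store a e => max a.depth e.depth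
  | seq p q => max p.depth q.depth
  | ifLe a b p q => max (max a.depth b.depth) (max p.depth q.depth)
  | whileLe a b p => max (max a.depth b.depth) p.depth

/-- The number of steps of a program without loops. -/
def cost : Program → ℕ
  | skip => 1
  | assign _ e => e.time + 1
  | store a e => a.time + e.time + 1
  | seq p q => p.cost + q.cost
  | ifLe a b p q => a.time + b.time + 1 + (p.cost + q.cost)
  | whileLe _ _ _ => 0

/-- Precondition of a program without loops for the postcondition `Q`, where all words that are
written are at most `V`. -/
def wp (V : ℤ) : Program → (State → Prop) → State → Prop
  | skip, Q, σ => Q σ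
  | assign k e, Q, σ => |e.eval σ| ≤ V ∧ Q (σ.setReg k (e.eval σ))
  | store a e, Q, σ => |e.eval σ| ≤ V ∧ Q (σ.setMem (a.eval σ) (e.eval σ))
  | seq p q, Q, σ => wp V p (wp V q Q) σ
  | ifLe a b p q, Q, σ =>
      (a.eval σ ≤ b.eval σ → wp V p Q σ) ∧ (b.eval σ < a.eval σ → wp V q Q σ)
  | whileLe _ _ _, _, _ => False

end Program

theorem Exec.mono {W W' : ℤ} (h : W ≤ W') {p : Program} {σ σ' : State} {t : ℕ}
    (he : Exec W p σ σ' t) : Exec W' p σ σ' t := by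
  induction he with
  | skip σ => exact .skip σ
  | assign σ k e h1 => exact .assign σ k e (h1.mono h)
  | store σ a e h1 h2 => exact .store σ a e (h1.mono h) (h2.mono h)
  | seq _ _ ih1 ih2 => exact .seq ih1 ih2
  | ifTrue ha hb hab _ ih => exact .ifTrue (ha.mono h) (hb.mono h) hab ih
  | ifFalse ha hb hab _ ih => exact .ifFalse (ha.mono h) (hb.mono h) hab ih
  | whileTrue ha hb hab _ _ ih1 ih2 => exact .whileTrue (ha.mono h) (hb.mono h) hab ih1 ih2
  | whileFalse ha hb hab => exact .whileFalse (ha.mono h) (hb.mono h) hab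

/-- Started in `σ`, the program `p` stops within `T` steps in a state that satisfies `Q`; if the
words of `σ` are at most `V`, then so are those of the final state. -/
def Spec (V : ℤ) (p : Program) (σ : State) (T : ℕ) (Q : State → Prop) : Prop :=
  σ.Bounded V → ∃ σ' t, Exec (V ^ 2 ^ p.depth) p σ σ' t ∧ t ≤ T ∧ σ'.Bounded V ∧ Q σ'

namespace Spec

variable {V : ℤ} {σ : State} {p q : Program} {T U : ℕ} {Q R : State → Prop}

theorem mono (h : Spec V p σ T Q) (hT : T ≤ U) (hQ : ∀ σ', Q σ' → R σ') : Spec V p σ U R := by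
  intro hσ
  obtain ⟨σ', t, h1, h2, h3, h4⟩ := h hσ
  exact ⟨σ', t, h1, h2.trans hT, h3, hQ _ h4⟩

theorem seq (hp : Spec V p σ T R) (hq : ∀ σ', R σ' → Spec V q σ' U Q) :
    Spec V (p.seq q) σ (T + U) Q := by
  intro hσ
  obtain ⟨σ₁, t, h1, h2, h3, h4⟩ := hp hσ
  obtain ⟨σ₂, u, h5, h6, h7, h8⟩ := hq σ₁ h4 h3
  exact ⟨σ₂, t + u, .seq (h1.mono (Expr.pow_depth_mono hσ.1 (le_max_left _ _)))
    (h5.mono (Expr.pow_depth_mono hσ.1 (le_max_right _ _))), by omega, h7, h8⟩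

/-- Only the words that are written have to be bounded by `V`; the intermediate results are covered
by the exponent `depth`. The time is an upper bound, since `cost` charges both branches of a
conditional. -/
theorem of_wp (h : σ.Bounded V → p.wp V Q σ) : Spec V p σ p.cost Q := by
  intro hσ
  have hw := h hσ
  clear h
  induction p generalizing σ Q with
  | skip => exact ⟨σ, 1, .skip σ, le_rfl, hσ, hw⟩
  | assign k e => exact ⟨_, _, .assign σ k e (hσ.fits le_rfl), le_rfl, hσ.setReg hw.1, hw.2⟩
  | store a e =>
    exact ⟨_, _, .store σ a e (hσ.fits (le_max_left _ _)) (hσ.fits (le_max_right _ _)), le_rfl,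
      hσ.setMem hw.1, hw.2⟩
  | seq p q ihp ihq =>
    exact seq (T := p.cost) (R := q.wp V Q) (fun hσ => ihp hσ hw) (fun σ' h hσ' => ihq hσ' h) hσ
  | ifLe a b p q ihp ihq =>
    have ha : a.depth ≤ (Program.ifLe a b p q).depth := (le_max_left _ _).trans (le_max_left _ _)
    have hb : b.depth ≤ (Program.ifLe a b p q).depth := (le_max_right _ _).trans (le_max_left _ _)
    have hp : p.depth ≤ (Program.ifLe a b p q).depth := (le_max_left _ _).trans (le_max_right _ _)
    have hq : q.depth ≤ (Program.ifLe a b p q).depth := (le_max_right _ _).trans (le_max_right _ _)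
    rcases le_or_gt (a.eval σ) (b.eval σ) with hab | hab
    · obtain ⟨σ', t, h1, h2, h3, h4⟩ := ihp hσ (hw.1 hab)
      exact ⟨σ', _, .ifTrue (hσ.fits ha) (hσ.fits hb) hab
        (h1.mono (Expr.pow_depth_mono hσ.1 hp)), by simp only [Program.cost]; omega, h3, h4⟩
    · obtain ⟨σ', t, h1, h2, h3, h4⟩ := ihq hσ (hw.2 hab)
      exact ⟨σ', _, .ifFalse (hσ.fits ha) (hσ.fits hb) hab
        (h1.mono (Expr.pow_depth_mono hσ.1 hq)), by simp only [Program.cost]; omega, h3, h4⟩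
  | whileLe a b p => exact hw.elim

theorem ifLe {a b : Expr} (hp : a.eval σ ≤ b.eval σ → Spec V p σ T Q)
    (hq : b.eval σ < a.eval σ → Spec V q σ T Q) :
    Spec V (.ifLe a b p q) σ (a.time + b.time + 1 + T) Q := by
  intro hσ
  have ha : a.depth ≤ (Program.ifLe a b p q).depth := (le_max_left _ _).trans (le_max_left _ _)
  have hb : b.depth ≤ (Program.ifLe a b p q).depth := (le_max_right _ _).trans (le_max_left _ _)
  rcases le_or_gt (a.eval σ) (b.eval σ) with hab | hab
  · obtain ⟨σ', t, h1, h2, h3, h4⟩ := hp hab hσ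
    exact ⟨σ', _, .ifTrue (hσ.fits ha) (hσ.fits hb) hab (h1.mono (Expr.pow_depth_mono hσ.1
      ((le_max_left _ _).trans (le_max_right _ _)))), by omega, h3, h4⟩
  · obtain ⟨σ', t, h1, h2, h3, h4⟩ := hq hab hσ
    exact ⟨σ', _, .ifFalse (hσ.fits ha) (hσ.fits hb) hab (h1.mono (Expr.pow_depth_mono hσ.1
      ((le_max_right _ _).trans (le_max_right _ _)))), by omega, h3, h4⟩

/-- A loop whose `i`-th turn takes `T i` steps and which makes `N` turns at most. -/
theorem whileLe_sum {a b : Expr} (Inv : ℕ → State → Prop) (T : ℕ → ℕ) (N : ℕ)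
    (hend : ∀ σ, Inv N σ → b.eval σ < a.eval σ)
    (hgo : ∀ i < N, ∀ σ, Inv i σ → a.eval σ ≤ b.eval σ ∧ Spec V p σ (T i) (Inv (i + 1)))
    (h0 : Inv 0 σ) :
    Spec V (.whileLe a b p) σ
      ((∑ i ∈ Finset.range N, T i) + (N + 1) * (a.time + b.time + 1)) (Inv N) := by
  have ha : a.depth ≤ (Program.whileLe a b p).depth := (le_max_left _ _).trans (le_max_left _ _)
  have hb : b.depth ≤ (Program.whileLe a b p).depth := (le_max_right _ _).trans (le_max_left _ _)
  have hp : p.depth ≤ (Program.whileLe a b p).depth := le_max_right _ _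
  suffices h : ∀ k i, i + k = N → ∀ σ, Inv i σ → Spec V (.whileLe a b p) σ
      ((∑ l ∈ Finset.Ico i N, T l) + (k + 1) * (a.time + b.time + 1)) (Inv N) by
    rw [Finset.range_eq_Ico]
    exact h N 0 (by omega) σ h0
  intro k
  induction k with
  | zero =>
    rintro i rfl σ hi hσ
    exact ⟨σ, _, .whileFalse (hσ.fits ha) (hσ.fits hb) (hend σ hi), by simp, hσ, hi⟩
  | succ k ih =>
    intro i hi σ hinv hσ
    obtain ⟨hab, hbody⟩ := hgo i (by omega) σ hinv
    obtain ⟨σ₁, t, h1, h2, h3, h4⟩ := hbody hσ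
    obtain ⟨σ₂, u, h5, h6, h7, h8⟩ := ih (i + 1) (by omega) σ₁ h4 h3
    refine ⟨σ₂, _, .whileTrue (hσ.fits ha) (hσ.fits hb) hab
      (h1.mono (Expr.pow_depth_mono hσ.1 hp)) h5, ?_, h7, h8⟩
    rw [Finset.sum_eq_sum_Ico_succ_bot (by omega : i < N)]
    have : (k + 1 + 1) * (a.time + b.time + 1) =
      (k + 1) * (a.time + b.time + 1) + (a.time + b.time + 1) := by ring
    omega

/-- A loop which decreases `μ`. -/
theorem whileLe_variant {a b : Expr} (Inv : State → Prop) (μ : State → ℕ)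
    (hgo : ∀ σ, Inv σ → a.eval σ ≤ b.eval σ → Spec V p σ T fun σ' => Inv σ' ∧ μ σ' < μ σ)
    (h0 : Inv σ) :
    Spec V (.whileLe a b p) σ ((μ σ + 1) * (a.time + b.time + 1 + T))
      fun σ' => Inv σ' ∧ b.eval σ' < a.eval σ' := by
  have ha : a.depth ≤ (Program.whileLe a b p).depth := (le_max_left _ _).trans (le_max_left _ _)
  have hb : b.depth ≤ (Program.whileLe a b p).depth := (le_max_right _ _).trans (le_max_left _ _)
  have hp : p.depth ≤ (Program.whileLe a b p).depth := le_max_right _ _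
  induction hm : μ σ using Nat.strong_induction_on generalizing σ with
  | _ m ih =>
    intro hσ
    rcases le_or_gt (a.eval σ) (b.eval σ) with hab | hab
    · obtain ⟨σ₁, t, h1, h2, h3, h4, h4'⟩ := hgo σ h0 hab hσ
      obtain ⟨σ₂, u, h5, h6, h7, h8⟩ := ih (μ σ₁) (by omega) h4 rfl h3
      refine ⟨σ₂, _, .whileTrue (hσ.fits ha) (hσ.fits hb) hab
        (h1.mono (Expr.pow_depth_mono hσ.1 hp)) h5, ?_, h7, h8⟩
      have h9 : (μ σ₁ + 1 + 1) * (a.time + b.time + 1 + T) ≤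
          (m + 1) * (a.time + b.time + 1 + T) := Nat.mul_le_mul_right _ (by omega)
      have h10 : (μ σ₁ + 1 + 1) * (a.time + b.time + 1 + T) =
        (μ σ₁ + 1) * (a.time + b.time + 1 + T) + (a.time + b.time + 1 + T) := by ring
      omega
    · refine ⟨σ, _, .whileFalse (hσ.fits ha) (hσ.fits hb) hab, ?_, hσ, h0, hab⟩
      have : 0 < m + 1 := by omega
      nlinarith

end Spec

namespace Program

/-- Run `p` with register `k` set to `0, 1, …, N - 1`. -/
def forLt (k : ℕ) (N : Expr) (p : Program) : Program :=
  .seq (.assign k (.lit 0))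
    (.whileLe (.add (.reg k) (.lit 1)) N (.seq p (.assign k (.add (.reg k) (.lit 1)))))

end Program

/-- The bound `T i` may vary with the turn, which the amortised count in `spec_solveStates`
requires. The summand `10` pays for initialising, incrementing and comparing the counter. By `hset`
the invariant ignores the counter, and the body has to restore the counter itself. -/
theorem Spec.forLt {V : ℤ} {σ : State} {p : Program} {k : ℕ} {E : Expr} (N : ℕ)
    (Inv : ℕ → State → Prop) (T : ℕ → ℕ) (hNV : (N : ℤ) ≤ V)
    (hset : ∀ i σ x, Inv i σ → Inv i (σ.setReg k x))
    (hE : ∀ i σ, Inv i σ → E.eval σ = N)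
    (hp : ∀ i < N, ∀ σ, Inv i σ → σ.reg k = i →
      Spec V p σ (T i) fun σ' => Inv (i + 1) σ' ∧ σ'.reg k = i)
    (h0 : Inv 0 σ) :
    Spec V (.forLt k E p) σ ((∑ i ∈ Finset.range N, T i) + (N + 1) * (E.time + 10)) (Inv N) := by
  have h := Spec.seq (T := 2) (U := (∑ i ∈ Finset.range N, (T i + 4)) + (N + 1) * (3 + E.time + 1))
    (V := V) (σ := σ) (p := .assign k (.lit 0))
    (q := .whileLe (.add (.reg k) (.lit 1)) E (.seq p (.assign k (.add (.reg k) (.lit 1)))))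
    (Q := fun σ => Inv N σ ∧ σ.reg k = N)
    (R := fun σ => Inv 0 σ ∧ σ.reg k = (0 : ℕ)) (Spec.of_wp ?_) ?_
  · refine h.mono ?_ fun σ' h => h.1
    rw [Finset.sum_add_distrib, Finset.sum_const, Finset.card_range, smul_eq_mul]
    nlinarith
  · intro hσ
    simp only [Program.wp, Expr.eval]
    exact ⟨by rw [abs_zero]; linarith [hσ.1], hset _ _ _ h0, by simp [State.setReg_reg]⟩
  · intro σ₁ h₁
    refine Spec.whileLe_sum (fun i σ => Inv i σ ∧ σ.reg k = i) _ N ?_ ?_ h₁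
    · rintro σ ⟨h2, h3⟩
      simp only [Expr.eval, hE _ _ h2, h3]
      omega
    · rintro i hi σ ⟨h2, h3⟩
      refine ⟨by simp only [Expr.eval, hE _ _ h2, h3]; omega, ?_⟩
      refine Spec.seq (U := 4) (hp i hi σ h2 h3) ?_
      rintro σ' ⟨h4, h5⟩
      refine Spec.of_wp ?_
      intro hσ
      simp only [Program.wp, Expr.eval, h5]
      refine ⟨?_, hset _ _ _ h4, ?_⟩
      · rw [abs_le]; constructor <;> omega
      · simp [State.setReg_reg]

namespace Instance

variable {n : ℕ} (I : Instance n)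

/-! ### The data of a job over a common denominator -/

/-- A common denominator for all times that belong to job `j`. -/
def scale (j : Fin n) : ℤ :=
  (I.job j).release.den * (I.job j).due.den * (I.job j).proc.den * (I.job j).startLoc.den *
    (I.job j).endLoc.den * I.Δ.den * I.δ.den * I.L.num

def scaledRelease (j : Fin n) : ℤ :=
  (I.job j).release.num * (I.job j).due.den * (I.job j).proc.den * (I.job j).startLoc.den *
    (I.job j).endLoc.den * I.Δ.den * I.δ.den * I.L.num

def scaledDue (j : Fin n) : ℤ :=
  (I.job j).release.den * (I.job j).due.num * (I.job j).proc.den * (I.job j).startLoc.den *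
    (I.job j).endLoc.den * I.Δ.den * I.δ.den * I.L.num

def scaledProc (j : Fin n) : ℤ :=
  (I.job j).release.den * (I.job j).due.den * (I.job j).proc.num * (I.job j).startLoc.den *
    (I.job j).endLoc.den * I.Δ.den * I.δ.den * I.L.num

/-- The time at which `ℓ_0` reaches the part of the corridor possessed by `j`. -/
def scaledEntry (j : Fin n) : ℤ :=
  (I.job j).release.den * (I.job j).due.den * (I.job j).proc.den * (I.job j).startLoc.num *
    (I.job j).endLoc.den * I.Δ.den * I.δ.num * I.L.den

/-- The time at which `ℓ_0` leaves the part of the corridor possessed by `j`. -/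
def scaledExit (j : Fin n) : ℤ :=
  (I.job j).release.den * (I.job j).due.den * (I.job j).proc.den * (I.job j).startLoc.den *
    (I.job j).endLoc.num * I.Δ.den * I.δ.num * I.L.den

def scaledHeadway (j : Fin n) : ℤ :=
  (I.job j).release.den * (I.job j).due.den * (I.job j).proc.den * (I.job j).startLoc.den *
    (I.job j).endLoc.den * I.Δ.num * I.δ.den * I.L.num

theorem scale_pos (j : Fin n) : 0 < I.scale j := by
  have := Rat.num_pos.2 I.L_pos
  have h := fun q : ℚ => Int.natCast_pos.2 q.den_pos
  unfold scale
  have h1 := h (I.job j).release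
  have h2 := h (I.job j).due
  have h3 := h (I.job j).proc
  have h4 := h (I.job j).startLoc
  have h5 := h (I.job j).endLoc
  have h6 := h I.Δ
  have h7 := h I.δ
  positivity

theorem cast_num (q : ℚ) : (q.num : ℚ) = q * q.den := (Rat.mul_den_eq_num q).symm

theorem cast_scaledRelease (j : Fin n) :
    (I.scaledRelease j : ℝ) = I.scale j * (I.job j).release := by
  have : (I.scaledRelease j : ℚ) = I.scale j * (I.job j).release := by
    unfold scaledRelease scale
    push_cast
    rw [cast_num (I.job j).release]
    ring
  exact_mod_cast congrArg (Rat.cast (K := ℝ)) this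

theorem cast_scaledDue (j : Fin n) : (I.scaledDue j : ℝ) = I.scale j * (I.job j).due := by
  have : (I.scaledDue j : ℚ) = I.scale j * (I.job j).due := by
    unfold scaledDue scale
    push_cast
    rw [cast_num (I.job j).due]
    ring
  exact_mod_cast congrArg (Rat.cast (K := ℝ)) this

theorem cast_scaledProc (j : Fin n) : (I.scaledProc j : ℝ) = I.scale j * (I.job j).proc := by
  have : (I.scaledProc j : ℚ) = I.scale j * (I.job j).proc := by
    unfold scaledProc scale
    push_cast
    rw [cast_num (I.job j).proc]
    ring
  exact_mod_cast congrArg (Rat.cast (K := ℝ)) this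

theorem cast_scaledHeadway (j : Fin n) : (I.scaledHeadway j : ℝ) = I.scale j * I.Δ := by
  have : (I.scaledHeadway j : ℚ) = I.scale j * I.Δ := by
    unfold scaledHeadway scale
    push_cast
    rw [cast_num I.Δ]
    ring
  exact_mod_cast congrArg (Rat.cast (K := ℝ)) this

/-- Dividing by `L` exchanges its numerator and denominator; for this reason `scale` contains
`L.num` and the entry and exit times contain `L.den`. -/
theorem cast_scaledEntry (j : Fin n) :
    (I.scaledEntry j : ℝ) = I.scale j * (I.δ * (I.job j).startLoc / I.L) := by
  have : (I.scaledEntry j : ℚ) = I.scale j * (I.δ * (I.job j).startLoc / I.L) := by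
    have hL := I.L_pos.ne'
    unfold scaledEntry scale
    push_cast
    rw [cast_num I.δ, cast_num I.L, cast_num (I.job j).startLoc]
    field_simp
  exact_mod_cast congrArg (Rat.cast (K := ℝ)) this

theorem cast_scaledExit (j : Fin n) :
    (I.scaledExit j : ℝ) = I.scale j * (I.δ * (I.job j).endLoc / I.L) := by
  have : (I.scaledExit j : ℚ) = I.scale j * (I.δ * (I.job j).endLoc / I.L) := by
    have hL := I.L_pos.ne'
    unfold scaledExit scale
    push_cast
    rw [cast_num I.δ, cast_num I.L, cast_num (I.job j).endLoc]
    field_simp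
  exact_mod_cast congrArg (Rat.cast (K := ℝ)) this

theorem scale_pos' (j : Fin n) : (0 : ℝ) < I.scale j := by exact_mod_cast I.scale_pos j

theorem scaledHeadway_pos' (j : Fin n) : (0 : ℝ) < I.scaledHeadway j := by
  rw [cast_scaledHeadway]
  exact mul_pos (I.scale_pos' j) I.Δ_pos'

theorem scaledHeadway_pos (j : Fin n) : 0 < I.scaledHeadway j := by
  exact_mod_cast I.scaledHeadway_pos' j

theorem spread_eq (j : Fin n) : I.spread j =
    ((I.scaledProc j + I.scaledExit j - I.scaledEntry j : ℤ) : ℝ) / I.scaledHeadway j := by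
  have h := I.scale_pos' j
  push_cast
  rw [cast_scaledProc, cast_scaledExit, cast_scaledEntry, cast_scaledHeadway, ← mul_add, ← mul_sub,
    mul_div_mul_left _ _ h.ne', spread]

theorem earliest_eq (j : Fin n) : I.earliest j =
    ((I.scaledRelease j - I.scaledExit j : ℤ) : ℝ) / I.scaledHeadway j := by
  have h := I.scale_pos' j
  push_cast
  rw [cast_scaledRelease, cast_scaledExit, cast_scaledHeadway, ← mul_sub,
    mul_div_mul_left _ _ h.ne', earliest, position]

theorem latest_eq (j : Fin n) : I.latest j =
    ((I.scaledDue j - I.scaledProc j - I.scaledExit j : ℤ) : ℝ) / I.scaledHeadway j := by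
  have h := I.scale_pos' j
  push_cast
  rw [cast_scaledDue, cast_scaledProc, cast_scaledExit, cast_scaledHeadway, ← mul_sub, ← mul_sub,
    mul_div_mul_left _ _ h.ne', latest, position]

theorem floor_intCast_div {x y : ℤ} (hy : 0 < y) : ⌊(x : ℝ) / y⌋ = x / y := by
  have hy' : (0 : ℝ) < y := by exact_mod_cast hy
  rw [Int.floor_eq_iff, le_div_iff₀ hy', div_lt_iff₀ hy']
  constructor
  · exact_mod_cast Int.ediv_mul_le x hy.ne'
  · exact_mod_cast Int.lt_ediv_add_one_mul_self x hy

/-- Integer division rounds down, so the ceiling is computed as the negative of a floor. -/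
theorem hi_eq (j : Fin n) : I.hi j =
    0 - (I.scaledExit j + I.scaledProc j - I.scaledDue j) / I.scaledHeadway j := by
  rw [hi, latest_eq, ← floor_intCast_div (I.scaledHeadway_pos j), zero_sub, ← Int.ceil_neg]
  congr 1
  push_cast
  ring

theorem floor_spread (j : Fin n) : ⌊I.spread j⌋ =
    (I.scaledProc j + I.scaledExit j - I.scaledEntry j) / I.scaledHeadway j := by
  rw [spread_eq, floor_intCast_div (I.scaledHeadway_pos j)]

theorem floor_earliest_add_spread (j : Fin n) : ⌊I.earliest j + I.spread j⌋ =
    (I.scaledRelease j + I.scaledProc j - I.scaledEntry j) / I.scaledHeadway j := by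
  rw [spread_eq, earliest_eq, ← add_div, ← Int.cast_add,
    floor_intCast_div (I.scaledHeadway_pos j)]
  congr 1
  ring

/-- The start time of `j` for the block at `a`, in units of `1 / (2 * scale j)`. -/
noncomputable def scaledStart (j : Fin n) (a : ℤ) : ℤ :=
  if I.scaledDue j - I.scaledEntry j + 1 ≤ (a + I.len j) * I.scaledHeadway j then
    2 * (I.scaledDue j - I.scaledProc j)
  else if (a - 1) * I.scaledHeadway j + 1 ≤ I.scaledRelease j - I.scaledExit j then
    2 * I.scaledRelease j
  else (2 * a + I.len j - 1) * I.scaledHeadway j - I.scaledProc j + I.scaledExit j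
    + I.scaledEntry j

/-- The factor `2` clears the denominator of the midpoint in `windowPoint`. The strict comparisons
there become `≤` between integers after adding `1`, the only test available to the machine. -/
theorem scaledStart_div (j : Fin n) (a : ℤ) :
    (I.scaledStart j a : ℝ) / ((2 * I.scale j : ℤ) : ℝ) = I.startTime j a := by
  have hs := I.scale_pos' j
  have hD := I.scaledHeadway_pos' j
  rw [startTime, ← len_eq_size]
  generalize hk : (I.len j : ℤ) = k
  have hΔ : (I.Δ : ℝ) = I.scaledHeadway j / I.scale j := by
    rw [cast_scaledHeadway]; field_simp
  have hB : (I.δ * (I.job j).endLoc / I.L : ℝ) = I.scaledExit j / I.scale j := by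
    rw [cast_scaledExit, mul_div_cancel_left₀ _ hs.ne']
  have c1 : I.latest j + I.spread j < a + k ↔
      I.scaledDue j - I.scaledEntry j + 1 ≤ (a + k) * I.scaledHeadway j := by
    rw [latest_eq, spread_eq, ← add_div, div_lt_iff₀ hD, Int.add_one_le_iff]
    norm_cast
    rw [show I.scaledDue j - I.scaledProc j - I.scaledExit j +
      (I.scaledProc j + I.scaledExit j - I.scaledEntry j) =
        I.scaledDue j - I.scaledEntry j by ring]
  have c2 : (a : ℝ) - 1 < I.earliest j ↔
      (a - 1) * I.scaledHeadway j + 1 ≤ I.scaledRelease j - I.scaledExit j := by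
    rw [earliest_eq, lt_div_iff₀ hD, Int.add_one_le_iff]
    norm_cast
  rw [scaledStart, hk, windowPoint, hΔ, hB]
  simp only [c1, c2]
  split_ifs
  · rw [latest_eq]; push_cast; field_simp; ring
  · rw [earliest_eq]; push_cast; field_simp; ring
  · rw [spread_eq]; push_cast; field_simp; ring

/-! ### The states of the dynamic program -/

/-- The number of right ends. -/
def numEnds (n : ℕ) : ℕ := 2 * n + 1

/-- The number of states. -/
def numStates (n : ℕ) : ℕ := (n * numEnds n + 1) * numEnds n

/-- The right ends: the places before the greatest and least starts of the jobs, and `m`. -/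
noncomputable def rightEnd (w : ℕ) : ℤ :=
  if h : w < n then I.hi ⟨w, h⟩ - 1
  else if h : w - n < n then I.lo ⟨w - n, h⟩ - 1
  else I.m

/-- The left ends: the places after the possessions which start after a right end, and `1`. -/
noncomputable def leftEnd (l : ℕ) : ℤ :=
  if h : l / numEnds n < n then I.rightEnd (l % numEnds n) + 1 + I.len ⟨l / numEnds n, h⟩ else 1

/-- The interval of paths with number `s`. -/
def region (s : ℕ) : Set ℤ := Set.Icc (I.leftEnd (s / numEnds n)) (I.rightEnd (s % numEnds n))

/-- The state on the right of the possession of `j` which starts after the right end `u`. -/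
def rightState (j : Fin n) (u s : ℕ) : ℕ := (j * numEnds n + u) * numEnds n + s % numEnds n

/-- The state on the left of a possession which starts after the right end `u`. -/
def leftState (n u s : ℕ) : ℕ := s / numEnds n * numEnds n + u

/-- The state which consists of all paths. -/
def root (n : ℕ) : ℕ := n * numEnds n * numEnds n + 2 * n

theorem numEnds_pos (n : ℕ) : 0 < numEnds n := by unfold numEnds; omega

theorem mul_add_div_mod {N l w : ℕ} (hw : w < N) : (l * N + w) / N = l ∧ (l * N + w) % N = w := by
  constructor
  · rw [mul_comm, Nat.mul_add_div (by omega), Nat.div_eq_of_lt hw, add_zero]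
  · rw [mul_comm, Nat.mul_add_mod, Nat.mod_eq_of_lt hw]

/-- Numbers are in base `numEnds n`: a left end is a job followed by a right end, and a state is a
left end followed by a right end, so one division recovers the ends. All combinations are tabulated,
whether they arise or not. -/
theorem region_mul_add {l w : ℕ} (hw : w < numEnds n) :
    I.region (l * numEnds n + w) = Set.Icc (I.leftEnd l) (I.rightEnd w) := by
  rw [region, (mul_add_div_mod hw).1, (mul_add_div_mod hw).2]

theorem leftEnd_mul_add (j : Fin n) {u : ℕ} (hu : u < numEnds n) :
    I.leftEnd (j * numEnds n + u) = I.rightEnd u + 1 + I.len j := by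
  have h := mul_add_div_mod (l := j) hu
  have hj : (j * numEnds n + u) / numEnds n < n := by rw [h.1]; exact j.2
  have e : (⟨_, hj⟩ : Fin n) = j := Fin.ext h.1
  rw [leftEnd, dif_pos hj, e, h.2]

theorem leftEnd_last : I.leftEnd (n * numEnds n) = 1 := by
  have h := (mul_add_div_mod (l := n) (numEnds_pos n)).1
  rw [add_zero] at h
  rw [leftEnd, dif_neg (by rw [h]; omega)]

theorem rightEnd_hi (j : Fin n) : I.rightEnd j = I.hi j - 1 := dif_pos j.2

theorem rightEnd_lo (j : Fin n) : I.rightEnd (n + j) = I.lo j - 1 := by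
  rw [rightEnd, dif_neg (by omega), dif_pos (by omega)]
  congr 2
  exact Fin.ext (by simp)

theorem rightEnd_last : I.rightEnd (2 * n) = I.m := by
  rw [rightEnd, dif_neg (by omega), dif_neg (by omega)]

theorem region_root : I.region (root n) = I.paths := by
  rw [root, region_mul_add I (by unfold numEnds; omega), leftEnd_last, rightEnd_last, paths]

theorem region_rightState (j : Fin n) {u : ℕ} (hu : u < numEnds n) (s : ℕ) :
    I.region (rightState j u s) =
      Set.Icc (I.rightEnd u + 1 + I.len j) (I.rightEnd (s % numEnds n)) := by
  rw [rightState, region_mul_add I (Nat.mod_lt _ (numEnds_pos n)), leftEnd_mul_add I j hu]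

theorem region_leftState {u : ℕ} (hu : u < numEnds n) (s : ℕ) :
    I.region (leftState n u s) = Set.Icc (I.leftEnd (s / numEnds n)) (I.rightEnd u) := by
  rw [leftState, region_mul_add I hu]

theorem div_lt_of_lt_numStates {s : ℕ} (hs : s < numStates n) :
    s / numEnds n < n * numEnds n + 1 := by
  rw [Nat.div_lt_iff_lt_mul (numEnds_pos n)]
  exact hs

theorem mul_add_lt_numStates {l w : ℕ} (hl : l < n * numEnds n + 1) (hw : w < numEnds n) :
    l * numEnds n + w < numStates n := by
  unfold numStates
  have : (l + 1) * numEnds n ≤ (n * numEnds n + 1) * numEnds n := Nat.mul_le_mul_right _ hl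
  rw [add_mul] at this
  omega

theorem mul_add_lt_mul (j : Fin n) {u N : ℕ} (hu : u < N) : j * N + u < n * N := by
  have : ((j : ℕ) + 1) * N ≤ n * N := Nat.mul_le_mul_right _ j.2
  rw [add_mul] at this
  omega

theorem rightState_lt (j : Fin n) {u : ℕ} (hu : u < numEnds n) (s : ℕ) :
    rightState j u s < numStates n :=
  mul_add_lt_numStates ((mul_add_lt_mul j hu).trans (Nat.lt_succ_self _))
    (Nat.mod_lt _ (numEnds_pos n))

theorem leftState_lt {s u : ℕ} (hs : s < numStates n) (hu : u < numEnds n) :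
    leftState n u s < numStates n :=
  mul_add_lt_numStates (div_lt_of_lt_numStates hs) hu

theorem root_lt (n : ℕ) : root n < numStates n :=
  mul_add_lt_numStates (Nat.lt_succ_self _) (by unfold numEnds; omega)

/-- The number of jobs to be scheduled in a state. -/
noncomputable def numJobs (s : ℕ) : ℕ := (I.jobsOn (I.region s)).ncard

theorem numJobs_le (s : ℕ) : I.numJobs s ≤ n := by
  have := Set.ncard_le_card (I.jobsOn (I.region s))
  simpa [numJobs] using this

theorem numJobs_pos_iff {s : ℕ} : 0 < I.numJobs s ↔ (I.jobsOn (I.region s)).Nonempty :=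
  Set.ncard_pos

/-- The cost of state `s` when `j` gets the possession which starts after the right end `u`. -/
noncomputable def branchCost (s : ℕ) (j : Fin n) (u : ℕ) : ℕ :=
  (I.block j (I.rightEnd u + 1) ∩ I.region s).ncard + I.cost (I.region (rightState j u s))
    + I.cost (I.region (leftState n u s))

/-- In state `s`, the job `j` is a longest one and may start after the right end `u`. -/
structure IsBranch (s : ℕ) (j : Fin n) (u : ℕ) : Prop where
  longest : I.IsLongest (I.region s) j
  lt : u < numEnds n
  lo_le : I.lo j ≤ I.rightEnd u + 1
  le_hi : I.rightEnd u + 1 ≤ I.hi j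

/-- It is optimal in state `s` to let the longest job `j` start after the right end `u`. -/
structure IsChoice (s : ℕ) (j : Fin n) (u : ℕ) : Prop extends I.IsBranch s j u where
  cost_eq : I.cost (I.region s) = I.branchCost s j u

variable {I}

/-- A branch may start after any right end that is admissible for `j`, even if the block is no
candidate. The extra branches are harmless, as every start gives an upper bound. -/
theorem IsBranch.cost_le {s u : ℕ} {j : Fin n} (h : I.IsBranch s j u) :
    I.cost (I.region s) ≤ I.branchCost s j u := by
  rw [branchCost, region_rightState I j h.lt, region_leftState I h.lt]
  have := I.cost_le_of_isLongest (a := I.rightEnd u + 1) h.longest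
  rw [add_sub_cancel_right] at this
  exact this

theorem exists_isChoice {s : ℕ} {j : Fin n} (h : I.IsLongest (I.region s) j) :
    ∃ u, I.IsChoice s j u := by
  obtain ⟨a, h1, h2, h3, h4⟩ := I.exists_start_cost_eq h
  obtain ⟨u, hu, rfl⟩ : ∃ u < numEnds n, a = I.rightEnd u + 1 := by
    obtain rfl | ⟨i, -, rfl⟩ := h3
    · exact ⟨n + j, by unfold numEnds; omega, by rw [rightEnd_lo]; ring⟩
    · exact ⟨i, by unfold numEnds; omega, by rw [rightEnd_hi]; ring⟩
  refine ⟨u, ⟨h, hu, h1, h2⟩, ?_⟩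
  rw [branchCost, region_rightState I j hu, region_leftState I hu]
  rw [add_sub_cancel_right] at h4
  exact h4

/-- The job `j` itself drops out, because its earliest block ends before the right side begins. The
number of jobs thus orders the dynamic program. -/
theorem IsBranch.numJobs_rightState {s u : ℕ} {j : Fin n} (h : I.IsBranch s j u) :
    I.numJobs (rightState j u s) < I.numJobs s := by
  have hj := I.mem_jobsOn_Icc.1 h.longest.1
  refine Set.ncard_lt_ncard ((Set.ssubset_iff_of_subset (I.jobsOn_mono ?_)).2
    ⟨j, h.longest.1, fun h' => ?_⟩) (Set.toFinite _)
  · rw [region_rightState I j h.lt]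
    exact Set.Icc_subset_Icc (by have := h.lo_le; omega) le_rfl
  · rw [region_rightState I j h.lt, mem_jobsOn_Icc] at h'
    have := h.lo_le
    omega

theorem IsBranch.numJobs_leftState {s u : ℕ} {j : Fin n} (h : I.IsBranch s j u) :
    I.numJobs (leftState n u s) < I.numJobs s := by
  have hj := I.mem_jobsOn_Icc.1 h.longest.1
  refine Set.ncard_lt_ncard ((Set.ssubset_iff_of_subset (I.jobsOn_mono ?_)).2
    ⟨j, h.longest.1, fun h' => ?_⟩) (Set.toFinite _)
  · rw [region_leftState I h.lt]
    exact Set.Icc_subset_Icc le_rfl (by have := h.le_hi; omega)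
  · rw [region_leftState I h.lt, mem_jobsOn_Icc] at h'
    have := h.le_hi
    omega

/-- The block meets the region, since `j` belongs to `jobsOn` and its start is admissible; so the
difference of the ends is not truncated at zero. -/
theorem IsBranch.ncard_eq {s u : ℕ} {j : Fin n} (h : I.IsBranch s j u) :
    ((I.block j (I.rightEnd u + 1) ∩ I.region s).ncard : ℤ) =
      min (I.rightEnd u + I.len j) (I.rightEnd (s % numEnds n))
        - max (I.rightEnd u + 1) (I.leftEnd (s / numEnds n)) + 1 := by
  have hj := I.mem_jobsOn_Icc.1 h.longest.1
  have h1 := h.lo_le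
  have h2 := h.le_hi
  rw [block, region, Set.Icc_inter_Icc, ncard_Icc]
  omega

variable (I)

/-! ### Reading off a solution -/

/-- `I.Descent top ch i s c`: going down from state `s` along the choices recorded in `top` and
`ch`, to the side on which job `i` must be scheduled, one finds the start `c` for `i`. -/
inductive Descent (top ch : ℕ → ℤ) (i : Fin n) : ℕ → ℤ → Prop
  | right {s u : ℕ} {j : Fin n} {c : ℤ} : top s = (j : ℕ) → ch s = u → I.IsChoice s j u →
      i ∈ I.jobsOn (I.region (rightState j u s)) → Descent top ch i (rightState j u s) c →
      Descent top ch i s c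
  | left {s u : ℕ} {j : Fin n} {c : ℤ} : top s = (j : ℕ) → ch s = u → I.IsChoice s j u →
      i ∉ I.jobsOn (I.region (rightState j u s)) → i ∈ I.jobsOn (I.region (leftState n u s)) →
      Descent top ch i (leftState n u s) c → Descent top ch i s c
  | done {s u : ℕ} {j : Fin n} : top s = (j : ℕ) → ch s = u → I.IsChoice s j u →
      i ∉ I.jobsOn (I.region (rightState j u s)) → i ∉ I.jobsOn (I.region (leftState n u s)) →
      Descent top ch i s (max (I.lo i) (min (I.hi i) (I.rightEnd u + 1)))

/-- An optimal solution arises by applying `combine` at every state, and the three cases of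
`combine` are the constructors of `Descent`. So the start of a single job can be found along one
path, without constructing the solutions of both sides. -/
theorem exists_descent {top ch : ℕ → ℤ}
    (h : ∀ s < numStates n, (I.jobsOn (I.region s)).Nonempty →
      ∃ (j : Fin n) (u : ℕ), top s = (j : ℕ) ∧ ch s = u ∧ I.IsChoice s j u)
    {s : ℕ} (hs : s < numStates n) :
    ∃ b, I.Valid b ∧ (I.covered b (I.region s)).ncard ≤ I.cost (I.region s) ∧
      ∀ i ∈ I.jobsOn (I.region s), I.Descent top ch i s (b i) := by
  induction hk : I.numJobs s using Nat.strong_induction_on generalizing s with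
  | _ k ih =>
    rcases Set.eq_empty_or_nonempty (I.jobsOn (I.region s)) with h0 | h0
    · refine ⟨I.lo, I.valid_lo, ?_, by simp [h0]⟩
      have : I.covered I.lo (I.region s) = ∅ := by
        ext x
        simp [mem_covered, h0]
      rw [this, Set.ncard_empty]
      exact Nat.zero_le _
    · obtain ⟨j, u, h1, h2, h3⟩ := h s hs h0
      obtain ⟨bR, r1, r2, r3⟩ := ih _ (hk ▸ h3.numJobs_rightState) (rightState_lt j h3.lt s) rfl
      obtain ⟨bL, l1, l2, l3⟩ := ih _ (hk ▸ h3.numJobs_leftState) (leftState_lt hs h3.lt) rfl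
      have hR := region_rightState I j h3.lt s
      have hL := region_leftState I h3.lt s
      refine ⟨I.combine j (I.leftEnd (s / numEnds n)) (I.rightEnd (s % numEnds n))
        (I.rightEnd u + 1) bR bL, r1.combine I l1 _ _ _ _, ?_, ?_⟩
      · have := I.ncard_covered_combine_le (a := I.rightEnd u + 1) h3.longest r1 l1
        rw [add_sub_cancel_right, ← hR, ← hL] at this
        rw [h3.cost_eq, branchCost]
        exact this.trans (add_le_add (add_le_add le_rfl r2) l2)
      · intro i _
        unfold combine
        rw [add_sub_cancel_right, ← hR, ← hL]
        split_ifs with c1 c2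
        · exact .right h1 h2 h3 c1 (r3 i c1)
        · exact .left h1 h2 h3 c1 c2 (l3 i c2)
        · exact .done h1 h2 h3 c1 c2

end Instance

/-! ### Arrays -/

/-- The arrays used by the program. -/
inductive Arr where
  | lo | hi | len | rightEnd | leftEnd | count | top | cost | choice

namespace Arr

/-- The position of an array among the arrays, which are interleaved. -/
def code : Arr → ℤ
  | lo => 1
  | hi => 2
  | len => 3
  | rightEnd => 4
  | leftEnd => 5
  | count => 6
  | top => 7
  | cost => 8
  | choice => 9

/-- The address of an array element. -/
def addr (c : Arr) (i : ℤ) : ℤ := 0 - c.code - 16 * i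

theorem code_mem (c : Arr) : 1 ≤ c.code ∧ c.code ≤ 9 := by
  cases c <;> simp [code]

theorem code_injective : Function.Injective code := by
  intro c d h
  cases c <;> cases d <;> first | rfl | (simp [code] at h)

/-- The codes lie between `1` and `9`, below the stride `16`, so an address determines both the
array and the index. -/
theorem addr_inj {c d : Arr} {i k : ℤ} : c.addr i = d.addr k ↔ c = d ∧ i = k := by
  constructor
  · intro h
    have h1 := c.code_mem
    have h2 := d.code_mem
    unfold addr at h
    exact ⟨code_injective (by omega), by omega⟩
  · rintro ⟨rfl, rfl⟩
    rfl

theorem addr_neg (c : Arr) {i : ℤ} (hi : 0 ≤ i) : c.addr i < 0 := by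
  have := c.code_mem
  unfold addr
  omega

end Arr

/-- The `i`-th element of an array. -/
def State.arr (σ : State) (c : Arr) (i : ℤ) : ℤ := σ.mem (c.addr i)

/-- The state after an assignment to an array element. -/
def State.setArr (σ : State) (c : Arr) (i x : ℤ) : State := σ.setMem (c.addr i) x

def Expr.arr (c : Arr) (e : Expr) : Expr :=
  .mem (.sub (.sub (.lit 0) (.lit c.code)) (.mul (.lit 16) e))

def Program.setArr (c : Arr) (i e : Expr) : Program :=
  .store (.sub (.sub (.lit 0) (.lit c.code)) (.mul (.lit 16) i)) e

section arr

variable {σ : State} {c d : Arr} {i k x : ℤ}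

@[simp] theorem Expr.eval_arr (e : Expr) : (Expr.arr c e).eval σ = σ.arr c (e.eval σ) := rfl

@[simp] theorem State.arr_setReg (l : ℕ) : (σ.setReg l x).arr c i = σ.arr c i := rfl

@[simp] theorem State.setArr_reg : (σ.setArr c i x).reg = σ.reg := rfl

theorem State.arr_setArr_same :
    (σ.setArr c i x).arr c k = if k = i then x else σ.arr c k := by
  unfold State.arr State.setArr
  rw [State.setMem_mem]
  simp only [Arr.addr_inj, true_and]

@[simp] theorem State.arr_setArr_self : (σ.setArr c i x).arr c i = x := by
  rw [State.arr_setArr_same, if_pos rfl]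

theorem State.arr_setArr_of_ne (h : d ≠ c) : (σ.setArr c i x).arr d k = σ.arr d k := by
  unfold State.arr State.setArr
  rw [State.setMem_mem, if_neg fun h' => h (Arr.addr_inj.1 h').1]

theorem State.setArr_mem {z : ℤ} (hi : 0 ≤ i) (hz : 0 ≤ z) :
    (σ.setArr c i x).mem z = σ.mem z := by
  have := c.addr_neg hi
  unfold State.setArr
  rw [State.setMem_mem, if_neg (by omega)]

end arr

/-! ### The program -/

namespace Algorithm

open MaintenanceScheduling.Expr MaintenanceScheduling.Program

def numJobs : Expr := mem (lit 0)

def numPaths : Expr := mem (lit 1)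

def numEnds : Expr := add (mul (lit 2) numJobs) (lit 1)

def numStates : Expr := mul (add (mul numJobs numEnds) (lit 1)) numEnds

/-- A word of the description of the job in register `1`. -/
def word (z : ℤ) : Expr := mem (add (lit z) (mul (lit 10) (reg 1)))

/-- Compute the data of the job in register `1`. -/
def loadJob : Program :=
  seq (assign 10 (mul (mul (mul (mul (mul (mul (mul
    (word 9) (word 11)) (word 13)) (word 15)) (word 17)) (mem (lit 5))) (mem (lit 7)))
    (mem (lit 2)))) <|
  seq (assign 11 (mul (mul (mul (mul (mul (mul (mul
    (word 8) (word 11)) (word 13)) (word 15)) (word 17)) (mem (lit 5))) (mem (lit 7)))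
    (mem (lit 2)))) <|
  seq (assign 12 (mul (mul (mul (mul (mul (mul (mul
    (word 9) (word 10)) (word 13)) (word 15)) (word 17)) (mem (lit 5))) (mem (lit 7)))
    (mem (lit 2)))) <|
  seq (assign 13 (mul (mul (mul (mul (mul (mul (mul
    (word 9) (word 11)) (word 12)) (word 15)) (word 17)) (mem (lit 5))) (mem (lit 7)))
    (mem (lit 2)))) <|
  seq (assign 14 (mul (mul (mul (mul (mul (mul (mul
    (word 9) (word 11)) (word 13)) (word 14)) (word 17)) (mem (lit 5))) (mem (lit 6)))
    (mem (lit 3)))) <|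
  seq (assign 15 (mul (mul (mul (mul (mul (mul (mul
    (word 9) (word 11)) (word 13)) (word 15)) (word 16)) (mem (lit 5))) (mem (lit 6)))
    (mem (lit 3)))) <|
  seq (assign 16 (mul (mul (mul (mul (mul (mul (mul
    (word 9) (word 11)) (word 13)) (word 15)) (word 17)) (mem (lit 4))) (mem (lit 7)))
    (mem (lit 2)))) <|
  seq (assign 2 (sub (div (sub (add (reg 11) (reg 13)) (reg 14)) (reg 16))
    (div (sub (add (reg 13) (reg 15)) (reg 14)) (reg 16)))) <|
  seq (assign 3 (sub (lit 0) (div (sub (add (reg 15) (reg 13)) (reg 12)) (reg 16)))) <|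
  seq (assign 4 (div (sub (add (reg 13) (reg 15)) (reg 14)) (reg 16))) <|
  ifLe (add (reg 2) (lit 1)) (reg 3)
    (seq (assign 5 (add (reg 2) (lit 1))) (assign 6 (reg 4)))
    (seq (assign 5 (reg 3)) (assign 6 (add (reg 4) (lit 1))))

/-- Store the range of starts, the length and the right ends of the job in register `1`. -/
def storeJob : Program :=
  seq (setArr .lo (reg 1) (reg 5)) <|
  seq (setArr .hi (reg 1) (reg 3)) <|
  seq (setArr .len (reg 1) (reg 6)) <|
  seq (setArr .rightEnd (reg 1) (sub (reg 3) (lit 1))) <|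
  setArr .rightEnd (add numJobs (reg 1)) (sub (reg 5) (lit 1))

def loadJobs : Program :=
  seq (forLt 1 numJobs (seq loadJob storeJob))
    (setArr .rightEnd (mul (lit 2) numJobs) numPaths)

def storeLeftEnds : Program :=
  seq (forLt 1 numJobs (forLt 2 numEnds
      (setArr .leftEnd (add (mul (reg 1) numEnds) (reg 2))
        (add (add (arr .rightEnd (reg 2)) (lit 1)) (arr .len (reg 1))))))
    (setArr .leftEnd (mul numJobs numEnds) (lit 1))

/-- Set register `20` to `1` or `0` according as the job `j` must be scheduled on the interval from
`p` to `q`. -/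
def testJob (j p q : Expr) : Program :=
  seq (assign 20 (lit 0)) <|
  ifLe (lit 1) (arr .len j)
    (ifLe p q
      (ifLe (arr .hi j) q
        (ifLe p (sub (add (arr .lo j) (arr .len j)) (lit 1)) (assign 20 (lit 1)) skip) skip)
      skip)
    skip

/-- Compute the two ends of the state in register `1`. -/
def locate : Program :=
  seq (assign 2 (div (reg 1) numEnds)) <|
  seq (assign 3 (sub (reg 1) (mul (reg 2) numEnds))) <|
  seq (assign 4 (arr .leftEnd (reg 2))) <|
  assign 5 (arr .rightEnd (reg 3))

def countJob : Program :=
  seq (testJob (reg 9) (reg 4) (reg 5)) <|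
  ifLe (lit 1) (reg 20)
    (seq (assign 7 (add (reg 7) (lit 1)))
      (ifLe (reg 6) (arr .len (reg 9))
        (seq (assign 6 (arr .len (reg 9))) (assign 8 (reg 9))) skip))
    skip

/-- Find the number of jobs and a longest job of every state. -/
def countJobs : Program :=
  forLt 1 numStates <|
  seq (seq locate (seq (assign 6 (lit 0)) (seq (assign 7 (lit 0)) (assign 8 (lit 0))))) <|
  seq (forLt 9 numJobs countJob)
    (seq (setArr .count (reg 1) (reg 7)) (setArr .top (reg 1) (reg 8)))

/-- Compare the cost of letting the longest job start after the right end in register `9`. -/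
def tryBranch : Program :=
  seq (assign 11 (add (arr .rightEnd (reg 9)) (lit 1))) <|
  ifLe (arr .lo (reg 8)) (reg 11)
    (ifLe (reg 11) (arr .hi (reg 8))
      (seq (assign 12 (sub (add (reg 11) (arr .len (reg 8))) (lit 1))) <|
        seq (ifLe (reg 5) (reg 12) (assign 12 (reg 5)) skip) <|
        seq (ifLe (reg 11) (reg 4) (assign 11 (reg 4)) skip) <|
        seq (assign 13 (add (add (add (sub (reg 12) (reg 11)) (lit 1))
          (arr .cost (add (mul (add (mul (reg 8) numEnds) (reg 9)) numEnds) (reg 3))))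
          (arr .cost (add (mul (reg 2) numEnds) (reg 9))))) <|
        ifLe (reg 13) (reg 6) (seq (assign 6 (reg 13)) (assign 7 (reg 9))) skip)
      skip)
    skip

def solveState : Program :=
  seq (seq locate (seq (assign 8 (arr .top (reg 1)))
    (seq (assign 6 (add (sub (reg 5) (reg 4)) (lit 2))) (assign 7 (lit 0))))) <|
  seq (forLt 9 numEnds tryBranch)
    (seq (setArr .cost (reg 1) (reg 6)) (setArr .choice (reg 1) (reg 7)))

/-- Solve the states, those with few jobs first. -/
def solveStates : Program :=
  forLt 10 numJobs <| forLt 1 numStates <|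
    ifLe (arr .count (reg 1)) (add (reg 10) (lit 1))
      (ifLe (add (reg 10) (lit 1)) (arr .count (reg 1)) solveState skip) skip

/-- Go from the state in register `17` to the side on which the job in register `1` must be
scheduled, or set register `18` to `0` if there is none. -/
def descendStep : Program :=
  seq (assign 2 (div (reg 17) numEnds)) <|
  seq (assign 3 (sub (reg 17) (mul (reg 2) numEnds))) <|
  seq (assign 7 (arr .choice (reg 17))) <|
  seq (assign 22 (add (mul (arr .top (reg 17)) numEnds) (reg 7))) <|
  seq (testJob (reg 1) (arr .leftEnd (reg 22)) (arr .rightEnd (reg 3))) <|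
  ifLe (lit 1) (reg 20)
    (assign 17 (add (mul (reg 22) numEnds) (reg 3)))
    (seq (testJob (reg 1) (arr .leftEnd (reg 2)) (arr .rightEnd (reg 7))) <|
      ifLe (lit 1) (reg 20)
        (assign 17 (add (mul (reg 2) numEnds) (reg 7)))
        (assign 18 (lit 0)))

def rootState : Expr := add (mul (mul numJobs numEnds) numEnds) (mul (lit 2) numJobs)

/-- Put the first path of the possession of the job in register `1` into register `21`. -/
def placeJob : Program :=
  seq (testJob (reg 1) (lit 1) numPaths) <|
  ifLe (reg 20) (lit 0)
    (ifLe (add numPaths (lit 1)) (arr .hi (reg 1))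
      (assign 21 (arr .hi (reg 1))) (assign 21 (arr .lo (reg 1))))
    (seq (seq (assign 17 rootState) (assign 18 (lit 1))) <|
      seq (whileLe (lit 1) (reg 18) descendStep) <|
      seq (assign 21 (add (arr .rightEnd (reg 7)) (lit 1))) <|
      seq (ifLe (arr .hi (reg 1)) (reg 21) (assign 21 (arr .hi (reg 1))) skip) <|
      ifLe (reg 21) (arr .lo (reg 1)) (assign 21 (arr .lo (reg 1))) skip)

/-- Write the start time of the job in register `1`. -/
def writeStart : Program :=
  seq loadJob <|
  seq (ifLe (add (sub (reg 12) (reg 14)) (lit 1)) (mul (add (reg 21) (reg 6)) (reg 16))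
    (assign 7 (mul (lit 2) (sub (reg 12) (reg 13))))
    (ifLe (add (mul (sub (reg 21) (lit 1)) (reg 16)) (lit 1)) (sub (reg 11) (reg 15))
      (assign 7 (mul (lit 2) (reg 11)))
      (assign 7 (add (add (sub (mul (sub (add (mul (lit 2) (reg 21)) (reg 6)) (lit 1)) (reg 16))
        (reg 13)) (reg 15)) (reg 14))))) <|
  seq (store (add (lit 8) (mul (lit 10) (reg 1))) (reg 7))
    (store (add (lit 9) (mul (lit 10) (reg 1))) (mul (lit 2) (reg 10)))

def writeStarts : Program := forLt 1 numJobs (seq placeJob writeStart)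

/-- The dynamic program. -/
def main : Program :=
  seq loadJobs <| seq storeLeftEnds <| seq countJobs <| seq solveStates <| seq writeStarts <|
    assign 0 (arr .cost rootState)

end Algorithm

/-! ### The input in memory -/

theorem getElem?_flatten_ofFn {α : Type*} {k n : ℕ} {f : Fin n → List α}
    (hf : ∀ j, (f j).length = k) (j : Fin n) {x : ℕ} (hx : x < k) :
    (List.ofFn f).flatten[k * j + x]? = (f j)[x]? := by
  induction n with
  | zero => exact j.elim0
  | succ n ih =>
    rw [List.ofFn_succ, List.flatten_cons]
    induction j using Fin.cases with
    | zero => rw [List.getElem?_append_left (by simp [hf, hx])]; simp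
    | succ j =>
      rw [List.getElem?_append_right (by rw [hf, Fin.val_succ]; nlinarith), hf]
      rw [← ih (f := fun i => f i.succ) (fun i => hf _) j]
      congr 1
      rw [Fin.val_succ]
      have : k * (j + 1) = k * j + k := by ring
      omega

namespace Instance

variable {n : ℕ} (I : Instance n)

theorem initial_mem_natCast (x : ℕ) : I.initial.mem x = I.words.getD x 0 := by
  simp [initial]

theorem initial_mem_job (j : Fin n) {x : ℕ} (hx : x < 10) :
    I.initial.mem (8 + x + 10 * (j : ℕ)) = (I.jobWords j).getD x 0 := by
  have : (8 + x + 10 * (j : ℕ) : ℤ) = ((8 + (10 * j + x) : ℕ) : ℤ) := by push_cast; ring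
  rw [this, initial_mem_natCast, words, List.getD_append_right _ _ _ _ (by simp),
    List.getD_eq_getElem?_getD, List.getD_eq_getElem?_getD]
  congr 1
  rw [← getElem?_flatten_ofFn (k := 10) (f := I.jobWords) (fun _ => rfl) j hx]
  congr 1
  simp

/-- The memory from address `0` on contains the input. -/
def HasInput (σ : State) : Prop := ∀ z, 0 ≤ z → σ.mem z = I.initial.mem z

/-- The input that is needed to process job `j`. -/
structure HasJob (σ : State) (j : Fin n) : Prop where
  mem_two : σ.mem 2 = I.L.num
  mem_three : σ.mem 3 = I.L.den
  mem_four : σ.mem 4 = I.Δ.num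
  mem_five : σ.mem 5 = I.Δ.den
  mem_six : σ.mem 6 = I.δ.num
  mem_seven : σ.mem 7 = I.δ.den
  mem_release_num : σ.mem (8 + 10 * (j : ℕ)) = (I.job j).release.num
  mem_release_den : σ.mem (9 + 10 * (j : ℕ)) = (I.job j).release.den
  mem_due_num : σ.mem (10 + 10 * (j : ℕ)) = (I.job j).due.num
  mem_due_den : σ.mem (11 + 10 * (j : ℕ)) = (I.job j).due.den
  mem_proc_num : σ.mem (12 + 10 * (j : ℕ)) = (I.job j).proc.num
  mem_proc_den : σ.mem (13 + 10 * (j : ℕ)) = (I.job j).proc.den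
  mem_startLoc_num : σ.mem (14 + 10 * (j : ℕ)) = (I.job j).startLoc.num
  mem_startLoc_den : σ.mem (15 + 10 * (j : ℕ)) = (I.job j).startLoc.den
  mem_endLoc_num : σ.mem (16 + 10 * (j : ℕ)) = (I.job j).endLoc.num
  mem_endLoc_den : σ.mem (17 + 10 * (j : ℕ)) = (I.job j).endLoc.den

theorem hasInput_initial : I.HasInput I.initial := fun _ _ => rfl

theorem initial_mem_zero : I.initial.mem 0 = n := I.initial_mem_natCast 0

theorem initial_mem_one : I.initial.mem 1 = I.m := I.initial_mem_natCast 1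

theorem hasJob_initial (j : Fin n) : I.HasJob I.initial j where
  mem_two := I.initial_mem_natCast 2
  mem_three := I.initial_mem_natCast 3
  mem_four := I.initial_mem_natCast 4
  mem_five := I.initial_mem_natCast 5
  mem_six := I.initial_mem_natCast 6
  mem_seven := I.initial_mem_natCast 7
  mem_release_num := I.initial_mem_job j (x := 0) (by norm_num)
  mem_release_den := I.initial_mem_job j (x := 1) (by norm_num)
  mem_due_num := I.initial_mem_job j (x := 2) (by norm_num)
  mem_due_den := I.initial_mem_job j (x := 3) (by norm_num)
  mem_proc_num := I.initial_mem_job j (x := 4) (by norm_num)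
  mem_proc_den := I.initial_mem_job j (x := 5) (by norm_num)
  mem_startLoc_num := I.initial_mem_job j (x := 6) (by norm_num)
  mem_startLoc_den := I.initial_mem_job j (x := 7) (by norm_num)
  mem_endLoc_num := I.initial_mem_job j (x := 8) (by norm_num)
  mem_endLoc_den := I.initial_mem_job j (x := 9) (by norm_num)

/-- Job `j` depends on the header and on the memory from its own words onwards, so overwriting the
words of earlier jobs with their results does no harm. -/
theorem HasJob.congr {σ τ : State} {j : Fin n} (h : I.HasJob σ j)
    (h0 : ∀ z, 0 ≤ z → z < 8 → τ.mem z = σ.mem z)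
    (h1 : ∀ z, 8 + 10 * ((j : ℕ) : ℤ) ≤ z → τ.mem z = σ.mem z) : I.HasJob τ j where
  mem_two := (h0 _ (by omega) (by omega)).trans h.mem_two
  mem_three := (h0 _ (by omega) (by omega)).trans h.mem_three
  mem_four := (h0 _ (by omega) (by omega)).trans h.mem_four
  mem_five := (h0 _ (by omega) (by omega)).trans h.mem_five
  mem_six := (h0 _ (by omega) (by omega)).trans h.mem_six
  mem_seven := (h0 _ (by omega) (by omega)).trans h.mem_seven
  mem_release_num := (h1 _ (by omega)).trans h.mem_release_num
  mem_release_den := (h1 _ (by omega)).trans h.mem_release_den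
  mem_due_num := (h1 _ (by omega)).trans h.mem_due_num
  mem_due_den := (h1 _ (by omega)).trans h.mem_due_den
  mem_proc_num := (h1 _ (by omega)).trans h.mem_proc_num
  mem_proc_den := (h1 _ (by omega)).trans h.mem_proc_den
  mem_startLoc_num := (h1 _ (by omega)).trans h.mem_startLoc_num
  mem_startLoc_den := (h1 _ (by omega)).trans h.mem_startLoc_den
  mem_endLoc_num := (h1 _ (by omega)).trans h.mem_endLoc_num
  mem_endLoc_den := (h1 _ (by omega)).trans h.mem_endLoc_den

theorem HasInput.hasJob {σ : State} (h : I.HasInput σ) (j : Fin n) : I.HasJob σ j :=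
  HasJob.congr I (I.hasJob_initial j) (fun z hz _ => h z hz) fun z hz => h z (by omega)

/-! ### Word sizes -/

/-- The quantities that determine the words of the computation are at most `B`, and `V` is
sufficiently large in comparison. -/
structure WordBound (V B : ℤ) : Prop where
  one_le : 1 ≤ B
  sq_le : 100 * (B * B) ≤ V
  numStates_le : (numStates n : ℤ) ≤ V
  n_le : (n : ℤ) ≤ B
  m_le : (I.m : ℤ) ≤ B
  scale_le : ∀ j, |I.scale j| ≤ B
  release_le : ∀ j, |I.scaledRelease j| ≤ B
  due_le : ∀ j, |I.scaledDue j| ≤ B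
  proc_le : ∀ j, |I.scaledProc j| ≤ B
  entry_le : ∀ j, |I.scaledEntry j| ≤ B
  exit_le : ∀ j, |I.scaledExit j| ≤ B
  headway_le : ∀ j, |I.scaledHeadway j| ≤ B

namespace WordBound

variable {I} {V B : ℤ}

theorem le (h : I.WordBound V B) : 100 * B ≤ V := by
  have := h.one_le
  have := h.sq_le
  nlinarith

/-- The numerator is a sum of three scaled quantities, whence the factor `3`. The multiples of `B`
in the bounds that follow add up such contributions and stay well below `100 * B`. -/
theorem floor_spread_le (h : I.WordBound V B) (j : Fin n) : |⌊I.spread j⌋| ≤ 3 * B := by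
  rw [floor_spread]
  refine (Expr.abs_ediv_le _ _).trans ?_
  have h1 := abs_le.1 (h.proc_le j)
  have h2 := abs_le.1 (h.entry_le j)
  have h3 := abs_le.1 (h.exit_le j)
  rw [abs_le]
  constructor <;> linarith

theorem floor_earliest_le (h : I.WordBound V B) (j : Fin n) : |⌊I.earliest j + I.spread j⌋| ≤ 3 * B := by
  rw [floor_earliest_add_spread]
  refine (Expr.abs_ediv_le _ _).trans ?_
  have h1 := abs_le.1 (h.proc_le j)
  have h2 := abs_le.1 (h.entry_le j)
  have h3 := abs_le.1 (h.release_le j)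
  rw [abs_le]
  constructor <;> linarith

theorem hi_le (h : I.WordBound V B) (j : Fin n) : |I.hi j| ≤ 3 * B := by
  rw [hi_eq, zero_sub, abs_neg]
  refine (Expr.abs_ediv_le _ _).trans ?_
  have h1 := abs_le.1 (h.proc_le j)
  have h2 := abs_le.1 (h.exit_le j)
  have h3 := abs_le.1 (h.due_le j)
  rw [abs_le]
  constructor <;> linarith

theorem lo_le (h : I.WordBound V B) (j : Fin n) : |I.lo j| ≤ 7 * B := by
  have h1 := abs_le.1 (h.floor_spread_le j)
  have h2 := abs_le.1 (h.floor_earliest_le j)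
  have h3 := abs_le.1 (h.hi_le j)
  have h4 := h.one_le
  rw [hi] at h3
  rw [lo, windowStart, abs_le]
  split_ifs <;> constructor <;> linarith

theorem len_le (h : I.WordBound V B) (j : Fin n) : (I.len j : ℤ) ≤ 4 * B := by
  have h1 := abs_le.1 (h.floor_spread_le j)
  have h4 := h.one_le
  rw [len_eq_size, size, windowSize]
  split_ifs <;> linarith

theorem rightEnd_le (h : I.WordBound V B) (w : ℕ) : |I.rightEnd w| ≤ 8 * B := by
  have h4 := h.one_le
  unfold rightEnd
  split_ifs with h1 h2
  · have := abs_le.1 (h.hi_le ⟨w, h1⟩)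
    rw [abs_le]; constructor <;> linarith
  · have := abs_le.1 (h.lo_le ⟨w - n, h2⟩)
    rw [abs_le]; constructor <;> linarith
  · have := h.m_le
    rw [abs_le]; constructor <;> omega

theorem leftEnd_le (h : I.WordBound V B) (l : ℕ) : |I.leftEnd l| ≤ 13 * B := by
  have h4 := h.one_le
  unfold leftEnd
  split_ifs with h1
  · have h2 := h.len_le ⟨_, h1⟩
    have h3 := abs_le.1 (h.rightEnd_le (l % MaintenanceScheduling.Instance.numEnds n))
    rw [abs_le]; constructor <;> linarith
  · rw [abs_one]; linarith

end WordBound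

theorem abs_mul_le_pow_succ {V x y : ℤ} {k : ℕ} (hx : |x| ≤ V ^ k) (hy : |y| ≤ V) :
    |x * y| ≤ V ^ (k + 1) := by
  rw [abs_mul, pow_succ]
  exact mul_le_mul hx hy (abs_nonneg y) ((abs_nonneg x).trans hx)

/-- Each scaled quantity is a product of eight input words, hence the exponent `8`. As `100 ≤ 2 ^
14`, the exponent `30 = 14 + 16` leaves room for one hundred products of two of them. -/
theorem wordBound {M : ℕ} (hM : ∀ z ∈ I.words, |z| ≤ (M : ℤ)) :
    I.WordBound (((M : ℤ) + 2) ^ 30) (((M : ℤ) + 2) ^ 8) := by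
  have hw : ∀ z ∈ I.words, |z| ≤ (M : ℤ) + 2 := fun z hz => (hM z hz).trans (by omega)
  have hn : (n : ℤ) ≤ M + 2 := by simpa using hw n (by simp [words])
  have hm : (I.m : ℤ) ≤ M + 2 := by simpa using hw I.m (by simp [words])
  have hL := hw I.L.num (by simp [words])
  have hL' := hw I.L.den (by simp [words])
  have hΔ := hw I.Δ.num (by simp [words])
  have hΔ' := hw I.Δ.den (by simp [words])
  have hδ := hw I.δ.num (by simp [words])
  have hδ' := hw I.δ.den (by simp [words])
  have hj : ∀ j, ∀ z ∈ I.jobWords j, |z| ≤ (M : ℤ) + 2 := by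
    intro j z hz
    refine hw z (List.mem_append_right _ ?_)
    exact List.mem_flatten.2 ⟨_, (List.mem_ofFn' _ _).2 ⟨j, rfl⟩, hz⟩
  have hr := fun j => hj j (I.job j).release.num (by simp [jobWords])
  have hr' := fun j => hj j (I.job j).release.den (by simp [jobWords])
  have hd := fun j => hj j (I.job j).due.num (by simp [jobWords])
  have hd' := fun j => hj j (I.job j).due.den (by simp [jobWords])
  have hp := fun j => hj j (I.job j).proc.num (by simp [jobWords])
  have hp' := fun j => hj j (I.job j).proc.den (by simp [jobWords])
  have hs := fun j => hj j (I.job j).startLoc.num (by simp [jobWords])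
  have hs' := fun j => hj j (I.job j).startLoc.den (by simp [jobWords])
  have he := fun j => hj j (I.job j).endLoc.num (by simp [jobWords])
  have he' := fun j => hj j (I.job j).endLoc.den (by simp [jobWords])
  clear hw hj hM
  have hV : (2 : ℤ) ≤ (M : ℤ) + 2 := by omega
  generalize (M : ℤ) + 2 = V at *
  have prod : ∀ {a b c d e f g i : ℤ}, |a| ≤ V → |b| ≤ V → |c| ≤ V → |d| ≤ V → |e| ≤ V →
      |f| ≤ V → |g| ≤ V → |i| ≤ V → |a * b * c * d * e * f * g * i| ≤ V ^ 8 := by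
    intro a b c d e f g i h1 h2 h3 h4 h5 h6 h7 h8
    have h1' : |a| ≤ V ^ 1 := by rwa [pow_one]
    exact abs_mul_le_pow_succ (abs_mul_le_pow_succ (abs_mul_le_pow_succ (abs_mul_le_pow_succ
      (abs_mul_le_pow_succ (abs_mul_le_pow_succ (abs_mul_le_pow_succ h1' h2) h3) h4) h5) h6) h7) h8
  have hV1 : V ≤ V ^ 8 := le_self_pow₀ (by omega) (by norm_num)
  have hVpow : ∀ k : ℕ, (2 : ℤ) ^ k ≤ V ^ k := fun k => pow_le_pow_left₀ (by norm_num) hV k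
  refine ⟨by have := hVpow 8; omega, ?_, ?_, hn.trans hV1, hm.trans hV1, ?_, ?_, ?_, ?_, ?_, ?_, ?_⟩
  · have h1 : V ^ 30 = V ^ 14 * (V ^ 8 * V ^ 8) := by ring
    have h2 := hVpow 14
    have h3 : (0 : ℤ) ≤ V ^ 8 * V ^ 8 := mul_self_nonneg _
    rw [h1]
    nlinarith
  · have h0 : (0 : ℤ) ≤ n := by positivity
    have h1 : (numEnds n : ℤ) ≤ V ^ 3 := by
      have h2 := hVpow 2
      have h3 : 2 * V + V ≤ V ^ 3 := by
        have : V ^ 3 = V ^ 2 * V := by ring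
        nlinarith
      unfold numEnds
      push_cast
      linarith
    have h2 : (n : ℤ) * numEnds n ≤ V ^ 4 := by
      calc (n : ℤ) * numEnds n ≤ V * V ^ 3 :=
            mul_le_mul hn h1 (by positivity) (by omega)
        _ = V ^ 4 := by ring
    have h3 : (n : ℤ) * numEnds n + 1 ≤ V ^ 5 := by
      have h4 := hVpow 4
      have : V ^ 5 = V ^ 4 * V := by ring
      nlinarith
    unfold numStates
    push_cast
    calc ((n : ℤ) * numEnds n + 1) * numEnds n ≤ V ^ 5 * V ^ 3 :=
          mul_le_mul h3 h1 (by positivity) (by positivity)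
      _ = V ^ 8 := by ring
      _ ≤ V ^ 30 := pow_le_pow_right₀ (by omega) (by norm_num)
  · exact fun j => prod (hr' j) (hd' j) (hp' j) (hs' j) (he' j) hΔ' hδ' hL
  · exact fun j => prod (hr j) (hd' j) (hp' j) (hs' j) (he' j) hΔ' hδ' hL
  · exact fun j => prod (hr' j) (hd j) (hp' j) (hs' j) (he' j) hΔ' hδ' hL
  · exact fun j => prod (hr' j) (hd' j) (hp j) (hs' j) (he' j) hΔ' hδ' hL
  · exact fun j => prod (hr' j) (hd' j) (hp' j) (hs j) (he' j) hΔ' hδ hL'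
  · exact fun j => prod (hr' j) (hd' j) (hp' j) (hs' j) (he j) hΔ' hδ hL'
  · exact fun j => prod (hr' j) (hd' j) (hp' j) (hs' j) (he' j) hΔ hδ' hL

end Instance

/-! ### Rules for straight-line code -/

namespace Program

variable {V : ℤ} {σ : State} {p q : Program} {Q R : State → Prop}

theorem wp_assign {k : ℕ} {e : Expr} {x : ℤ} (he : e.eval σ = x) (hx : |x| ≤ V)
    (h : Q (σ.setReg k x)) : (assign k e).wp V Q σ := by
  subst he
  exact ⟨hx, h⟩

theorem wp_seq_assign {k : ℕ} {e : Expr} {x : ℤ} (he : e.eval σ = x) (hx : |x| ≤ V)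
    (h : p.wp V Q (σ.setReg k x)) : (seq (assign k e) p).wp V Q σ := wp_assign he hx h

theorem wp_seq_setArr {c : Arr} {i e : Expr} {k x : ℤ} (hi : i.eval σ = k) (he : e.eval σ = x)
    (hx : |x| ≤ V) (h : p.wp V Q (σ.setArr c k x)) : (seq (setArr c i e) p).wp V Q σ := by
  subst hi he
  exact ⟨hx, h⟩

theorem wp_setArr_of {c : Arr} {i e : Expr} {k x : ℤ} (hi : i.eval σ = k) (he : e.eval σ = x)
    (hx : |x| ≤ V) (h : Q (σ.setArr c k x)) : (setArr c i e).wp V Q σ := by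
  subst hi he
  exact ⟨hx, h⟩

theorem wp_mono (h : ∀ σ, Q σ → R σ) (hp : p.wp V Q σ) : p.wp V R σ := by
  induction p generalizing σ Q R with
  | skip => exact h _ hp
  | assign k e => exact ⟨hp.1, h _ hp.2⟩
  | store a e => exact ⟨hp.1, h _ hp.2⟩
  | seq p q ihp ihq => exact ihp (fun σ => ihq h) hp
  | ifLe a b p q ihp ihq => exact ⟨fun hab => ihp h (hp.1 hab), fun hab => ihq h (hp.2 hab)⟩
  | whileLe a b p => exact hp.elim

theorem wp_seq (hp : p.wp V R σ) (hq : ∀ σ, R σ → q.wp V Q σ) : (seq p q).wp V Q σ :=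
  wp_mono (Q := R) (R := q.wp V Q) hq hp

end Program

theorem Spec.forLt_const {V : ℤ} {σ : State} {p : Program} {k : ℕ} {E : Expr} (N : ℕ)
    (Inv : ℕ → State → Prop) (T : ℕ) (hNV : (N : ℤ) ≤ V)
    (hset : ∀ i σ x, Inv i σ → Inv i (σ.setReg k x))
    (hE : ∀ i σ, Inv i σ → E.eval σ = N)
    (hp : ∀ i < N, ∀ σ, Inv i σ → σ.reg k = i →
      Spec V p σ T fun σ' => Inv (i + 1) σ' ∧ σ'.reg k = i)
    (h0 : Inv 0 σ) :
    Spec V (.forLt k E p) σ ((N + 1) * (T + E.time + 10)) (Inv N) := by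
  refine (Spec.forLt N Inv (fun _ => T) hNV hset hE hp h0).mono ?_ fun _ h => h
  rw [Finset.sum_const, Finset.card_range, smul_eq_mul]
  nlinarith

namespace Instance

open Algorithm Program

variable {n : ℕ} {I : Instance n} {V B : ℤ}

/-! ### Reading the input -/

/-- Registers from `17` on are preserved because `writeStart` loads the job again while register
`21` already holds the chosen start. -/
theorem spec_loadJob (hB : I.WordBound V B) {σ : State} {j : Fin n} (hj : I.HasJob σ j)
    (h1 : σ.reg 1 = (j : ℕ)) :
    loadJob.wp V (fun σ' => σ'.mem = σ.mem ∧ σ'.reg 1 = (j : ℕ) ∧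
      (∀ k, 17 ≤ k → σ'.reg k = σ.reg k) ∧ σ'.reg 3 = I.hi j ∧ σ'.reg 5 = I.lo j ∧
      σ'.reg 6 = I.len j ∧ σ'.reg 10 = I.scale j ∧ σ'.reg 11 = I.scaledRelease j ∧
      σ'.reg 12 = I.scaledDue j ∧ σ'.reg 13 = I.scaledProc j ∧ σ'.reg 14 = I.scaledEntry j ∧
      σ'.reg 15 = I.scaledExit j ∧ σ'.reg 16 = I.scaledHeadway j) σ := by
  obtain ⟨e2, e3, e4, e5, e6, e7, e8, e9, e10, e11, e12, e13, e14, e15, e16, e17⟩ := hj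
  have hBV := hB.le
  have hB1 := hB.one_le
  have hsp := abs_le.1 (hB.floor_spread_le j)
  have hea := abs_le.1 (hB.floor_earliest_le j)
  have hhi := abs_le.1 (hB.hi_le j)
  refine wp_seq_assign (x := I.scale j) ?_ ((hB.scale_le j).trans (by linarith)) ?_
  · simp [Expr.eval, word, *, scale]
  refine wp_seq_assign (x := I.scaledRelease j) ?_ ((hB.release_le j).trans (by linarith)) ?_
  · simp [Expr.eval, word, State.setReg_reg, *, scaledRelease]
  refine wp_seq_assign (x := I.scaledDue j) ?_ ((hB.due_le j).trans (by linarith)) ?_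
  · simp [Expr.eval, word, State.setReg_reg, *, scaledDue]
  refine wp_seq_assign (x := I.scaledProc j) ?_ ((hB.proc_le j).trans (by linarith)) ?_
  · simp [Expr.eval, word, State.setReg_reg, *, scaledProc]
  refine wp_seq_assign (x := I.scaledEntry j) ?_ ((hB.entry_le j).trans (by linarith)) ?_
  · simp [Expr.eval, word, State.setReg_reg, *, scaledEntry]
  refine wp_seq_assign (x := I.scaledExit j) ?_ ((hB.exit_le j).trans (by linarith)) ?_
  · simp [Expr.eval, word, State.setReg_reg, *, scaledExit]
  refine wp_seq_assign (x := I.scaledHeadway j) ?_ ((hB.headway_le j).trans (by linarith)) ?_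
  · simp [Expr.eval, word, State.setReg_reg, *, scaledHeadway]
  refine wp_seq_assign (x := ⌊I.earliest j + I.spread j⌋ - ⌊I.spread j⌋) ?_ ?_ ?_
  · rw [floor_spread, floor_earliest_add_spread]
    simp [Expr.eval, State.setReg_reg]
  · rw [abs_le]; constructor <;> linarith
  refine wp_seq_assign (x := I.hi j) ?_ ((hB.hi_le j).trans (by linarith)) ?_
  · rw [hi_eq]
    simp [Expr.eval, State.setReg_reg]
  refine wp_seq_assign (x := ⌊I.spread j⌋) ?_ ((hB.floor_spread_le j).trans (by linarith)) ?_
  · rw [floor_spread]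
    simp [Expr.eval, State.setReg_reg]
  have hlen := I.len_eq_size j
  have h7 : ∀ k l : ℕ, 17 ≤ k → l < 17 → k ≠ l := fun k l _ _ => by omega
  constructor
  · intro hc
    have hc' : ⌊I.earliest j + I.spread j⌋ - ⌊I.spread j⌋ < I.hi j := by
      simpa [Expr.eval, State.setReg_reg, Int.add_one_le_iff] using hc
    rw [size, windowSize, ← hi, if_pos hc'] at hlen
    have hlo : I.lo j = ⌊I.earliest j + I.spread j⌋ - ⌊I.spread j⌋ + 1 := if_pos hc'
    refine wp_seq_assign (x := I.lo j) ?_ ((hB.lo_le j).trans (by linarith)) ?_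
    · simp [Expr.eval, State.setReg_reg, hlo]
    refine wp_assign (x := I.len j) ?_ ?_ ?_
    · simp [Expr.eval, State.setReg_reg, hlen]
    · rw [Nat.abs_cast]; exact (hB.len_le j).trans (by linarith)
    · simp +contextual [State.setReg_reg, h1, h7]
  · intro hc
    have hc' : ¬ ⌊I.earliest j + I.spread j⌋ - ⌊I.spread j⌋ < I.hi j := by
      simpa [Expr.eval, State.setReg_reg, Int.lt_add_one_iff] using hc
    rw [size, windowSize, ← hi, if_neg hc'] at hlen
    have hlo : I.lo j = I.hi j := if_neg hc'
    refine wp_seq_assign (x := I.lo j) ?_ ((hB.lo_le j).trans (by linarith)) ?_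
    · simp [Expr.eval, State.setReg_reg, hlo]
    refine wp_assign (x := I.len j) ?_ ?_ ?_
    · simp [Expr.eval, State.setReg_reg, hlen]
    · rw [Nat.abs_cast]; exact (hB.len_le j).trans (by linarith)
    · simp +contextual [State.setReg_reg, h1, h7]

variable (I) in
/-- The arrays with the data of the first `i` jobs. -/
def HasJobs (i : ℕ) (σ : State) : Prop := ∀ j : Fin n, (j : ℕ) < i →
  σ.arr .lo (j : ℕ) = I.lo j ∧ σ.arr .hi (j : ℕ) = I.hi j ∧ σ.arr .len (j : ℕ) = I.len j

variable (I) in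
def HasRightEnds (σ : State) : Prop :=
  ∀ w < Instance.numEnds n, σ.arr .rightEnd (w : ℕ) = I.rightEnd w

theorem eval_numJobs {σ : State} (h : I.HasInput σ) : Algorithm.numJobs.eval σ = n :=
  (h 0 le_rfl).trans I.initial_mem_zero

theorem eval_numPaths {σ : State} (h : I.HasInput σ) : Algorithm.numPaths.eval σ = I.m :=
  (h 1 zero_le_one).trans I.initial_mem_one

theorem HasInput.setReg {σ : State} (h : I.HasInput σ) (k : ℕ) (x : ℤ) :
    I.HasInput (σ.setReg k x) := h

theorem HasInput.setArr {σ : State} (h : I.HasInput σ) (c : Arr) {i : ℤ} (hi : 0 ≤ i) (x : ℤ) :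
    I.HasInput (σ.setArr c i x) := fun z hz => (State.setArr_mem hi hz).trans (h z hz)

theorem HasInput.congr {σ τ : State} (h : I.HasInput σ) (hm : τ.mem = σ.mem) : I.HasInput τ := by
  intro z hz
  rw [hm]
  exact h z hz

theorem arr_congr {σ τ : State} (hm : τ.mem = σ.mem) (c : Arr) (i : ℤ) : τ.arr c i = σ.arr c i :=
  congrFun hm _

/-- That the array `cost` is still zero is carried along up to `solveStates`, where it provides the
correct value for the states without jobs. -/
theorem spec_loadJobs (hB : I.WordBound V B) {σ : State} (hσ : I.HasInput σ)
    (h0 : ∀ s : ℕ, σ.arr .cost s = 0) :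
    Spec V loadJobs σ ((loadJob.cost + storeJob.cost + 40) * (n + 1)) fun σ' =>
      I.HasInput σ' ∧ I.HasJobs n σ' ∧ I.HasRightEnds σ' ∧ ∀ s : ℕ, σ'.arr .cost s = 0 := by
  have hBV := hB.le
  have hB1 := hB.one_le
  let Inv : ℕ → State → Prop := fun i σ => I.HasInput σ ∧ I.HasJobs i σ ∧
    (∀ j : Fin n, (j : ℕ) < i → σ.arr .rightEnd (j : ℕ) = I.rightEnd j ∧
      σ.arr .rightEnd (n + j : ℕ) = I.rightEnd (n + j)) ∧ ∀ s : ℕ, σ.arr .cost s = 0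
  have key : Spec V loadJobs σ ((n + 1) * ((loadJob.cost + storeJob.cost) + 2 + 10) +
      (setArr .rightEnd (.mul (.lit 2) Algorithm.numJobs) numPaths).cost) fun σ' =>
      I.HasInput σ' ∧ I.HasJobs n σ' ∧ I.HasRightEnds σ' ∧ ∀ s : ℕ, σ'.arr .cost s = 0 := by
    refine Spec.seq (R := Inv n) (Spec.forLt_const n Inv _ ?_ ?_ ?_ ?_ ?_) ?_
    · have := hB.n_le
      linarith
    · exact fun i σ x h => h
    · exact fun i σ h => eval_numJobs h.1
    · rintro i hi σ ⟨h2, h3, h4, h5⟩ h1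
      refine Spec.of_wp fun _ => ?_
      refine wp_seq (spec_loadJob hB (j := ⟨i, hi⟩) (h2.hasJob I _) h1) ?_
      rintro τ ⟨e1, e2, -, e3, e4, e5, -⟩
      have h2' : I.HasInput τ := h2.congr e1
      have hlo := abs_le.1 (hB.lo_le ⟨i, hi⟩)
      have hhi := abs_le.1 (hB.hi_le ⟨i, hi⟩)
      refine wp_seq_setArr (k := i) (x := I.lo ⟨i, hi⟩) e2 e4
        ((hB.lo_le _).trans (by linarith)) ?_
      refine wp_seq_setArr (k := i) (x := I.hi ⟨i, hi⟩) e2 e3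
        ((hB.hi_le _).trans (by linarith)) ?_
      refine wp_seq_setArr (k := i) (x := I.len ⟨i, hi⟩) e2 e5 ?_ ?_
      · rw [Nat.abs_cast]; exact (hB.len_le _).trans (by linarith)
      refine wp_seq_setArr (k := i) (x := I.hi ⟨i, hi⟩ - 1) e2 ?_ ?_ ?_
      · simp [Expr.eval, e3]
      · rw [abs_le]; constructor <;> linarith
      have hi0 : (0 : ℤ) ≤ i := by positivity
      have h6 := (((h2'.setArr .lo hi0 (I.lo ⟨i, hi⟩)).setArr .hi hi0 (I.hi ⟨i, hi⟩)).setArr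
        .len hi0 (I.len ⟨i, hi⟩)).setArr .rightEnd hi0 (I.hi ⟨i, hi⟩ - 1)
      refine wp_setArr_of (k := ((n + i : ℕ) : ℤ)) (x := I.lo ⟨i, hi⟩ - 1) ?_ ?_ ?_ ?_
      · simp only [Expr.eval, eval_numJobs h6]
        simp [e2]
      · simp [Expr.eval, e4]
      · rw [abs_le]; constructor <;> linarith
      have hni : (0 : ℤ) ≤ ((n + i : ℕ) : ℤ) := by positivity
      refine ⟨⟨h6.setArr _ hni _, ?_, ?_, ?_⟩, by simp [e2]⟩
      · intro j hj
        have h3j := h3 j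
        simp only [← arr_congr e1] at h3j
        by_cases hji : (j : ℕ) = i
        · obtain rfl : j = ⟨i, hi⟩ := Fin.ext hji
          simp [State.arr_setArr_of_ne]
        · have := h3j (by omega)
          simpa [State.arr_setArr_of_ne, State.arr_setArr_same, hji] using this
      · intro j hj
        have h4j := h4 j
        simp only [← arr_congr e1] at h4j
        have hjn := j.2
        by_cases hji : (j : ℕ) = i
        · obtain rfl : j = ⟨i, hi⟩ := Fin.ext hji
          have e7 := I.rightEnd_hi ⟨i, hi⟩
          have e8 := I.rightEnd_lo ⟨i, hi⟩
          have e6 : (i : ℤ) ≠ ((n + i : ℕ) : ℤ) := by simp only [] at hjn; omega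
          rw [e7, e8]
          simp only [State.arr_setArr_self, State.arr_setArr_same, if_neg e6, and_self]
        · have h7 := h4j (by omega)
          have e6 : ((j : ℕ) : ℤ) ≠ ((n + i : ℕ) : ℤ) := by omega
          have e7 : ((j : ℕ) : ℤ) ≠ i := by omega
          have e8 : ((n + j : ℕ) : ℤ) ≠ ((n + i : ℕ) : ℤ) := by omega
          have e9 : ((n + j : ℕ) : ℤ) ≠ i := by omega
          rw [State.arr_setArr_same, State.arr_setArr_same, State.arr_setArr_same,
            State.arr_setArr_same, if_neg e6, if_neg e7, if_neg e8, if_neg e9]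
          simpa [State.arr_setArr_of_ne] using h7
      · intro s
        have := h5 s
        rw [← arr_congr e1] at this
        simpa [State.arr_setArr_of_ne] using this
    · exact ⟨hσ, fun j hj => absurd hj (by omega), fun j hj => absurd hj (by omega), h0⟩
    · rintro τ ⟨h2, h3, h4, h5⟩
      refine Spec.of_wp fun _ => ?_
      have hn : (0 : ℤ) ≤ ((2 * n : ℕ) : ℤ) := by positivity
      refine wp_setArr_of (k := ((2 * n : ℕ) : ℤ)) (x := I.m) ?_ (eval_numPaths h2) ?_ ?_
      · simp only [Expr.eval, eval_numJobs h2]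
        push_cast
        ring
      · rw [Nat.abs_cast]; exact hB.m_le.trans (by linarith)
      refine ⟨h2.setArr _ hn _, ?_, ?_, ?_⟩
      · intro j hj
        simpa [State.arr_setArr_of_ne] using h3 j hj
      · intro w hw
        rw [State.arr_setArr_same]
        split_ifs with hw'
        · rw [show w = 2 * n by omega, rightEnd_last]
        · unfold Instance.numEnds at hw
          rcases lt_or_ge w n with hwn | hwn
          · exact (h4 ⟨w, hwn⟩ hwn).1
          · have := (h4 ⟨w - n, by omega⟩ (show w - n < n by omega)).2
            simpa [show n + (w - n) = w by omega] using this
      · intro s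
        rw [State.arr_setArr_of_ne (by simp)]
        exact h5 s
  refine key.mono ?_ fun _ h => h
  have : (setArr .rightEnd (.mul (.lit 2) Algorithm.numJobs) numPaths).cost ≤ 20 := by decide
  nlinarith

end Instance

theorem State.setReg_setReg (σ : State) (k : ℕ) (x y : ℤ) :
    (σ.setReg k x).setReg k y = σ.setReg k y := by
  simp [State.setReg]

namespace Instance

open Algorithm Program

variable {n : ℕ} {I : Instance n} {V B : ℤ}

/-! ### The ends of the states -/

variable (I) in
/-- The memory contains the input and the data of all jobs. -/
structure Prepared (σ : State) : Prop where
  input : I.HasInput σ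
  jobs : I.HasJobs n σ
  rightEnds : I.HasRightEnds σ

variable (I) in
def HasLeftEnds (i : ℕ) (σ : State) : Prop := ∀ l < i, σ.arr .leftEnd (l : ℕ) = I.leftEnd l

theorem Prepared.congr {σ τ : State} (h : I.Prepared σ) (hm : τ.mem = σ.mem) : I.Prepared τ where
  input := h.input.congr hm
  jobs j hj := by simpa only [arr_congr hm] using h.jobs j hj
  rightEnds w hw := by simpa only [arr_congr hm] using h.rightEnds w hw

theorem HasLeftEnds.congr {i : ℕ} {σ τ : State} (h : I.HasLeftEnds i σ) (hm : τ.mem = σ.mem) :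
    I.HasLeftEnds i τ := by
  intro l hl
  rw [arr_congr hm]
  exact h l hl

/-- The arrays which describe the instance. -/
def isData : Arr → Prop
  | .lo | .hi | .len | .rightEnd => True
  | _ => False

theorem Prepared.setArr {σ : State} (h : I.Prepared σ) {c : Arr} (hc : ¬ isData c) {i : ℤ}
    (hi : 0 ≤ i) (x : ℤ) : I.Prepared (σ.setArr c i x) where
  input := h.input.setArr c hi x
  jobs j hj := by
    rw [State.arr_setArr_of_ne (by rintro rfl; exact hc trivial),
      State.arr_setArr_of_ne (by rintro rfl; exact hc trivial),
      State.arr_setArr_of_ne (by rintro rfl; exact hc trivial)]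
    exact h.jobs j hj
  rightEnds w hw := by
    rw [State.arr_setArr_of_ne (by rintro rfl; exact hc trivial)]
    exact h.rightEnds w hw

theorem HasLeftEnds.setArr {k : ℕ} {σ : State} (h : I.HasLeftEnds k σ) {c : Arr}
    (hc : c ≠ .leftEnd) (i x : ℤ) : I.HasLeftEnds k (σ.setArr c i x) := by
  intro l hl
  rw [State.arr_setArr_of_ne hc.symm]
  exact h l hl

theorem eval_numEnds_of_mem {σ : State} (h : σ.mem 0 = n) :
    Algorithm.numEnds.eval σ = (Instance.numEnds n : ℕ) := by
  simp only [Algorithm.numEnds, Algorithm.numJobs, Expr.eval, h, Instance.numEnds]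
  push_cast
  ring

theorem eval_numEnds {σ : State} (h : I.HasInput σ) :
    Algorithm.numEnds.eval σ = (Instance.numEnds n : ℕ) :=
  eval_numEnds_of_mem (eval_numJobs h)

theorem eval_numStates {σ : State} (h : I.HasInput σ) :
    Algorithm.numStates.eval σ = (Instance.numStates n : ℕ) := by
  simp only [Algorithm.numStates, Expr.eval, eval_numJobs h, eval_numEnds h, Instance.numStates]
  push_cast
  ring

theorem numEnds_le_numStates (n : ℕ) : Instance.numEnds n ≤ Instance.numStates n :=
  Nat.le_mul_of_pos_left _ (Nat.succ_pos _)

/-- The constant is chosen before the instance. The outer invariant counts complete rows of `numEnds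
n` left ends, one row for each job, and the inner loop fills a row. -/
theorem spec_storeLeftEnds : ∃ K, ∀ {n : ℕ} {I : Instance n} {V B : ℤ}, I.WordBound V B →
    ∀ {σ : State}, I.Prepared σ → (∀ s : ℕ, σ.arr .cost s = 0) →
    Spec V storeLeftEnds σ (K * (n + 1) ^ 4) fun σ' =>
      I.Prepared σ' ∧ I.HasLeftEnds (n * Instance.numEnds n + 1) σ' ∧
        ∀ s : ℕ, σ'.arr .cost s = 0 := by
  refine ⟨2 * ((setArr .leftEnd (.add (.mul (.reg 1) Algorithm.numEnds) (.reg 2))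
    (.add (.add (.arr .rightEnd (.reg 2)) (.lit 1)) (.arr .len (.reg 1)))).cost +
      Algorithm.numEnds.time + 10) + Algorithm.numJobs.time + 10 +
      (setArr .leftEnd (.mul Algorithm.numJobs Algorithm.numEnds) (.lit 1)).cost, ?_⟩
  intro n I V B hB σ hσ h0
  have hBV := hB.le
  have hB1 := hB.one_le
  have hN : (Instance.numEnds n : ℤ) ≤ V :=
    le_trans (by exact_mod_cast numEnds_le_numStates n) hB.numStates_le
  let Inv : ℕ → State → Prop := fun i σ => I.Prepared σ ∧ I.HasLeftEnds i σ ∧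
    ∀ s : ℕ, σ.arr .cost s = 0
  have key := Spec.seq (V := V) (U := (setArr .leftEnd
      (.mul Algorithm.numJobs Algorithm.numEnds) (.lit 1)).cost)
    (q := setArr .leftEnd (.mul Algorithm.numJobs Algorithm.numEnds) (.lit 1))
    (Q := Inv (n * Instance.numEnds n + 1))
    (Spec.forLt_const (σ := σ) (V := V) (E := Algorithm.numJobs) (k := 1) n
      (fun i => Inv (i * Instance.numEnds n))
    ((Instance.numEnds n + 1) * ((setArr .leftEnd (.add (.mul (.reg 1) Algorithm.numEnds) (.reg 2))
      (.add (.add (.arr .rightEnd (.reg 2)) (.lit 1)) (.arr .len (.reg 1)))).cost +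
      Algorithm.numEnds.time + 10)) (p := forLt 2 Algorithm.numEnds
      (setArr .leftEnd (.add (.mul (.reg 1) Algorithm.numEnds) (.reg 2))
        (.add (.add (.arr .rightEnd (.reg 2)) (.lit 1)) (.arr .len (.reg 1))))) ?_ ?_ ?_ ?_ ?_) ?_
  · refine key.mono ?_ fun _ h => h
    generalize (setArr .leftEnd (.add (.mul (.reg 1) Algorithm.numEnds) (.reg 2))
      (.add (.add (.arr .rightEnd (.reg 2)) (.lit 1)) (.arr .len (.reg 1)))).cost +
      Algorithm.numEnds.time + 10 = c₁
    generalize (setArr .leftEnd (.mul Algorithm.numJobs Algorithm.numEnds) (.lit 1)).cost = c₂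
    generalize Algorithm.numJobs.time = c₃
    have e : Instance.numEnds n + 1 = 2 * (n + 1) := by unfold Instance.numEnds; ring
    rw [e]
    generalize n + 1 = N at *
    rcases Nat.eq_zero_or_pos N with rfl | hN
    · omega
    have h1 : N ≤ N ^ 4 := Nat.le_self_pow (by norm_num) N
    have h2 : N * N ≤ N ^ 4 := by
      calc N * N = N ^ 2 := by ring
        _ ≤ N ^ 4 := Nat.pow_le_pow_right hN (by norm_num)
    have h3 : 1 ≤ N ^ 4 := Nat.one_le_pow _ _ hN
    calc N * (2 * N * c₁ + c₃ + 10) + c₂ = 2 * c₁ * (N * N) + (c₃ + 10) * N + c₂ * 1 := by ring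
      _ ≤ 2 * c₁ * N ^ 4 + (c₃ + 10) * N ^ 4 + c₂ * N ^ 4 := by gcongr
      _ = _ := by ring
  · have := hB.n_le
    linarith
  · exact fun i σ x h => ⟨h.1.congr rfl, h.2.1, h.2.2⟩
  · exact fun i σ h => eval_numJobs h.1.input
  · rintro i hi σ h h1
    refine (Spec.forLt_const (Instance.numEnds n)
      (fun u σ => Inv (i * Instance.numEnds n + u) σ ∧ σ.reg 1 = i) _ hN ?_ ?_ ?_ ⟨h, h1⟩).mono le_rfl
      fun τ hτ => ⟨by rw [add_mul, one_mul]; exact hτ.1, hτ.2⟩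
    · rintro u σ x ⟨h, h1⟩
      exact ⟨⟨h.1.congr rfl, h.2.1, h.2.2⟩, by simp [State.setReg_reg, h1]⟩
    · exact fun u σ h => eval_numEnds h.1.1.input
    · rintro u hu τ ⟨h, h1⟩ h2
      refine Spec.of_wp fun _ => ?_
      have hl := (h.1.jobs ⟨i, hi⟩ hi).2.2
      have hle := I.leftEnd_mul_add ⟨i, hi⟩ hu
      refine wp_setArr_of (k := ((i * Instance.numEnds n + u : ℕ) : ℤ))
        (x := I.leftEnd (i * Instance.numEnds n + u)) ?_ ?_
        ((hB.leftEnd_le _).trans (by linarith)) ?_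
      · simp only [Expr.eval, eval_numEnds h.1.input, h1, h2]
        push_cast
        ring
      · simp only [Expr.eval, Expr.eval_arr, h1, h2, h.1.rightEnds u hu, hle]
        rw [← hl]
      · refine ⟨⟨⟨h.1.setArr id (by positivity) _, ?_, ?_⟩, h1⟩, h2⟩
        · intro l hl
          rw [State.arr_setArr_same]
          split_ifs with hlu
          · congr 1
            exact_mod_cast hlu.symm
          · exact h.2.1 l (by omega)
        · intro s
          rw [State.arr_setArr_of_ne (by simp)]
          exact h.2.2 s
  · exact ⟨hσ, fun l hl => absurd hl (by omega), h0⟩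
  · intro τ h
    refine Spec.of_wp fun _ => ?_
    refine wp_setArr_of (k := ((n * Instance.numEnds n : ℕ) : ℤ)) (x := 1) ?_ rfl
      (by rw [abs_one]; linarith) ?_
    · simp only [Expr.eval, eval_numEnds h.1.input, eval_numJobs h.1.input]
      push_cast
      ring
    · refine ⟨h.1.setArr id (by positivity) _, ?_, ?_⟩
      · intro l hl
        rw [State.arr_setArr_same]
        split_ifs with hlu
        · rw [show l = n * Instance.numEnds n by exact_mod_cast hlu, leftEnd_last]
        · exact h.2.1 l (by omega)
      · intro s
        rw [State.arr_setArr_of_ne (by simp)]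
        exact h.2.2 s

/-! ### Counting the jobs of the states -/

/-- The nested tests are the four conditions of `mem_jobsOn_Icc`; if one fails, the `0` assigned at
the beginning remains. The expressions must not depend on register `20`, which is overwritten before
they are evaluated. -/
theorem wp_testJob (hV : 1 ≤ V) {σ : State} (hσ : I.HasJobs n σ) {j p q : Expr} {i : Fin n}
    {p₀ q₀ : ℤ} (hj : ∀ x, j.eval (σ.setReg 20 x) = (i : ℕ))
    (hp : ∀ x, p.eval (σ.setReg 20 x) = p₀) (hq : ∀ x, q.eval (σ.setReg 20 x) = q₀)
    {Q : State → Prop} (h1 : i ∈ I.jobsOn (Set.Icc p₀ q₀) → Q (σ.setReg 20 1))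
    (h0 : i ∉ I.jobsOn (Set.Icc p₀ q₀) → Q (σ.setReg 20 0)) : (testJob j p q).wp V Q σ := by
  obtain ⟨e1, e2, e3⟩ := hσ i i.2
  refine wp_seq_assign rfl (by simp [Expr.eval]; linarith) ?_
  rw [mem_jobsOn_Icc] at h1 h0
  simp only [Program.wp, Expr.eval, Expr.eval_arr, State.arr_setReg, hj, hp, hq, e1, e2, e3,
    State.setReg_setReg, abs_one]
  refine ⟨fun c1 => ⟨fun c2 => ⟨fun c3 => ⟨fun c4 => ⟨hV, h1 ?_⟩, fun c4 => h0 ?_⟩,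
    fun c3 => h0 ?_⟩, fun c2 => h0 ?_⟩, fun c1 => h0 ?_⟩ <;> omega

theorem wp_locate (hB : I.WordBound V B) {σ : State} (hσ : I.Prepared σ)
    (hl : I.HasLeftEnds (n * Instance.numEnds n + 1) σ) {s : ℕ} (hs : s < Instance.numStates n)
    (h1 : σ.reg 1 = s) :
    locate.wp V (fun τ => τ.mem = σ.mem ∧ τ.reg 1 = s ∧
      τ.reg 2 = (s / Instance.numEnds n : ℕ) ∧ τ.reg 3 = (s % Instance.numEnds n : ℕ) ∧
      τ.reg 4 = I.leftEnd (s / Instance.numEnds n) ∧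
      τ.reg 5 = I.rightEnd (s % Instance.numEnds n) ∧ ∀ k, 6 ≤ k → τ.reg k = σ.reg k) σ := by
  have hBV := hB.le
  have hB1 := hB.one_le
  have hsV : (s : ℤ) ≤ V := le_trans (by exact_mod_cast hs.le) hB.numStates_le
  have hN := eval_numEnds hσ.input
  have hd : ((s / Instance.numEnds n : ℕ) : ℤ) ≤ s := by exact_mod_cast Nat.div_le_self _ _
  have hm : ((s % Instance.numEnds n : ℕ) : ℤ) ≤ s := by exact_mod_cast Nat.mod_le _ _
  refine wp_seq_assign (x := (s / Instance.numEnds n : ℕ)) ?_ ?_ ?_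
  · simp [Expr.eval, hN, h1]
  · rw [Nat.abs_cast]; exact hd.trans hsV
  have hN' := eval_numEnds (hσ.input.setReg 2 (s / Instance.numEnds n : ℕ))
  refine wp_seq_assign (x := (s % Instance.numEnds n : ℕ)) ?_ ?_ ?_
  · simp only [Expr.eval, hN', State.setReg_reg, h1, if_true]
    have := Nat.div_add_mod s (Instance.numEnds n)
    have h2 : (Instance.numEnds n : ℤ) * (s / Instance.numEnds n : ℕ) +
      (s % Instance.numEnds n : ℕ) = s := by exact_mod_cast this
    simp only [OfNat.one_ne_ofNat, if_false]
    linarith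
  · rw [Nat.abs_cast]; exact hm.trans hsV
  refine wp_seq_assign (x := I.leftEnd (s / Instance.numEnds n)) ?_
    ((hB.leftEnd_le _).trans (by linarith)) ?_
  · rw [← hl _ (div_lt_of_lt_numStates hs)]
    simp [Expr.eval, State.setReg_reg]
  refine wp_assign (x := I.rightEnd (s % Instance.numEnds n)) ?_
    ((hB.rightEnd_le _).trans (by linarith)) ?_
  · rw [← hσ.rightEnds _ (Nat.mod_lt _ (numEnds_pos n))]
    simp [Expr.eval, State.setReg_reg]
  have h7 : ∀ k l : ℕ, 6 ≤ k → l < 6 → k ≠ l := fun k l _ _ => by omega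
  simp +contextual [State.setReg_reg, h1, h7]

variable (I) in
/-- The arrays with the number of jobs and a longest job of the first `i` states. -/
def HasCounts (i : ℕ) (σ : State) : Prop := ∀ s < i, σ.arr .count (s : ℕ) = I.numJobs s ∧
  (0 < I.numJobs s → ∃ j : Fin n, I.IsLongest (I.region s) j ∧ σ.arr .top (s : ℕ) = (j : ℕ))

theorem HasCounts.congr {i : ℕ} {σ τ : State} (h : I.HasCounts i σ) (hm : τ.mem = σ.mem) :
    I.HasCounts i τ := by
  intro s hs
  simpa only [arr_congr hm] using h s hs

variable (I) in
/-- The registers while the jobs of state `s` are counted. -/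
def Counting (μ : ℤ → ℤ) (s i : ℕ) (σ : State) : Prop :=
  σ.mem = μ ∧ σ.reg 1 = s ∧ σ.reg 4 = I.leftEnd (s / Instance.numEnds n) ∧
    σ.reg 5 = I.rightEnd (s % Instance.numEnds n) ∧
    σ.reg 7 = {j ∈ I.jobsOn (I.region s) | (j : ℕ) < i}.ncard ∧
    (∀ j ∈ I.jobsOn (I.region s), (j : ℕ) < i → (I.len j : ℤ) ≤ σ.reg 6) ∧
    (σ.reg 6 = 0 ∨ ∃ j ∈ I.jobsOn (I.region s), σ.reg 8 = (j : ℕ) ∧ σ.reg 6 = I.len j)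

/-- Register `6` keeps a running maximum that begins at `0`. Jobs on a region have positive length,
so if there are any, the final maximum is attained by the job in register `8`. -/
theorem wp_countJob (hB : I.WordBound V B) {μ : ℤ → ℤ} {σ : State} {s i : ℕ} (hi : i < n)
    (hσ : I.Prepared σ) (h : I.Counting μ s i σ) (h9 : σ.reg 9 = i) :
    countJob.wp V (fun τ => I.Counting μ s (i + 1) τ ∧ τ.reg 9 = i) σ := by
  have hBV := hB.le
  have hB1 := hB.one_le
  obtain ⟨h0, h1, h4, h5, h7, h6, h8⟩ := h
  have hlen := (hσ.jobs ⟨i, hi⟩ hi).2.2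
  simp only [] at hlen
  have hle : ((I.len ⟨i, hi⟩ : ℕ) : ℤ) ≤ V := (hB.len_le _).trans (by linarith)
  refine wp_seq (R := fun τ => (⟨i, hi⟩ ∈ I.jobsOn (I.region s) → τ = σ.setReg 20 1) ∧
    (⟨i, hi⟩ ∉ I.jobsOn (I.region s) → τ = σ.setReg 20 0)) ?_ ?_
  · refine wp_testJob (by linarith) hσ.jobs (i := ⟨i, hi⟩)
      (p₀ := I.leftEnd (s / Instance.numEnds n)) (q₀ := I.rightEnd (s % Instance.numEnds n))
      ?_ ?_ ?_ ?_ ?_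
    · simp [Expr.eval, State.setReg_reg, h9]
    · simp [Expr.eval, State.setReg_reg, h4]
    · simp [Expr.eval, State.setReg_reg, h5]
    · exact fun h => ⟨fun _ => rfl, fun h' => absurd h h'⟩
    · exact fun h => ⟨fun h' => absurd h' h, fun _ => rfl⟩
  rintro τ ⟨t1, t0⟩
  by_cases hiJ : ⟨i, hi⟩ ∈ I.jobsOn (I.region s)
  · obtain rfl := t1 hiJ
    have hcard : {j ∈ I.jobsOn (I.region s) | (j : ℕ) < i + 1}.ncard =
        {j ∈ I.jobsOn (I.region s) | (j : ℕ) < i}.ncard + 1 := by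
      rw [← Set.ncard_insert_of_notMem (a := ⟨i, hi⟩) (by simp) (Set.toFinite _)]
      congr 1
      ext j
      simp only [Set.mem_ofPred_eq, Set.mem_insert_iff, Fin.ext_iff]
      constructor
      · rintro ⟨a, b⟩
        rcases Nat.lt_succ_iff_lt_or_eq.1 b with c | c
        · exact Or.inr ⟨a, c⟩
        · exact Or.inl c
      · rintro (c | ⟨a, b⟩)
        · have : j = ⟨i, hi⟩ := Fin.ext c
          subst this
          exact ⟨hiJ, Nat.lt_succ_self _⟩
        · exact ⟨a, by omega⟩
    have hc1 : (({j ∈ I.jobsOn (I.region s) | (j : ℕ) < i}.ncard : ℕ) : ℤ) + 1 ≤ V := by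
      have : {j ∈ I.jobsOn (I.region s) | (j : ℕ) < i}.ncard ≤ n := by
        simpa using Set.ncard_le_card {j ∈ I.jobsOn (I.region s) | (j : ℕ) < i}
      have := hB.n_le
      omega
    simp only [Program.wp, Expr.eval, Expr.eval_arr, State.setReg_reg, if_true, h7, h9, hlen,
      State.arr_setReg, if_false, Nat.reduceEqDiff, h1, h4, h5, Counting,
      hcard, State.setReg_mem, h0]
    refine ⟨fun _ => ⟨?_, fun c => ⟨?_, ?_, ⟨?_, ?_, ?_, ?_⟩, ?_⟩, fun c => ⟨?_, ?_⟩⟩,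
      fun h => absurd h (by norm_num)⟩
    · rw [abs_le]; constructor <;> omega
    · rw [Nat.abs_cast]; exact hle
    · rw [Nat.abs_cast]
      have := hB.n_le
      omega
    · simp
    · simp
    · simp
    · refine ⟨by simp, by simp, fun j hj hji => ?_, Or.inr ⟨_, hiJ, by simp⟩⟩
      rcases Nat.lt_succ_iff_lt_or_eq.1 hji with c' | c'
      · exact (h6 j hj c').trans c
      · obtain rfl : j = ⟨i, hi⟩ := Fin.ext c'
        exact le_rfl
    · simp
    · refine ⟨by simp, by simp, by simp, by simp, by simp, fun j hj hji => ?_, h8⟩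
      rcases Nat.lt_succ_iff_lt_or_eq.1 hji with c' | c'
      · exact h6 j hj c'
      · obtain rfl : j = ⟨i, hi⟩ := Fin.ext c'
        exact c.le
    · simp
  · obtain rfl := t0 hiJ
    have hne : ∀ j ∈ I.jobsOn (I.region s), (j : ℕ) ≠ i := by
      rintro j hj rfl
      exact hiJ hj
    have hcard : {j ∈ I.jobsOn (I.region s) | (j : ℕ) < i + 1} =
        {j ∈ I.jobsOn (I.region s) | (j : ℕ) < i} := by
      ext j
      simp only [Set.mem_ofPred_eq]
      refine and_congr_right fun hj => ?_
      have := hne j hj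
      omega
    refine ⟨fun h => absurd h (by simp [Expr.eval, State.setReg_reg]), fun _ => ?_⟩
    simp only [Program.wp, Counting, hcard]
    refine ⟨⟨h0, by simp [State.setReg_reg, h1], by simp [State.setReg_reg, h4],
      by simp [State.setReg_reg, h5], by simp [State.setReg_reg, h7], ?_, ?_⟩,
      by simp [State.setReg_reg, h9]⟩
    · intro j hj hji
      have := h6 j hj (by have := hne j hj; omega)
      simpa [State.setReg_reg] using this
    · simpa [State.setReg_reg] using h8

end Instance
namespace Instance

open Algorithm Program

variable {n : ℕ} {I : Instance n} {V B : ℤ}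

theorem numStates_add_one_le (n : ℕ) : Instance.numStates n + 1 ≤ 4 * (n + 1) ^ 3 := by
  unfold Instance.numStates Instance.numEnds
  ring_nf
  omega

theorem numStates_mul_le (n c : ℕ) :
    (Instance.numStates n + 1) * ((n + 1) * c) ≤ 4 * c * (n + 1) ^ 4 := by
  calc (Instance.numStates n + 1) * ((n + 1) * c)
      ≤ (4 * (n + 1) ^ 3) * ((n + 1) * c) := Nat.mul_le_mul_right _ (numStates_add_one_le n)
    _ = _ := by ring

theorem HasCounts.setArr {k : ℕ} {σ : State} (h : I.HasCounts k σ) {c : Arr}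
    (hc : c ≠ .count) (hc' : c ≠ .top) (i x : ℤ) : I.HasCounts k (σ.setArr c i x) := by
  intro s hs
  rw [State.arr_setArr_of_ne hc.symm, State.arr_setArr_of_ne hc'.symm]
  exact h s hs

theorem spec_countJobs : ∃ K, ∀ {n : ℕ} {I : Instance n} {V B : ℤ}, I.WordBound V B →
    ∀ {σ : State}, I.Prepared σ → I.HasLeftEnds (n * Instance.numEnds n + 1) σ →
    (∀ s : ℕ, σ.arr .cost s = 0) →
    Spec V countJobs σ (K * (n + 1) ^ 4) fun σ' =>
      I.Prepared σ' ∧ I.HasLeftEnds (n * Instance.numEnds n + 1) σ' ∧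
        I.HasCounts (Instance.numStates n) σ' ∧ ∀ s : ℕ, σ'.arr .cost s = 0 := by
  obtain ⟨a, ha⟩ : ∃ a, a = (seq locate (seq (assign 6 (.lit 0)) (seq (assign 7 (.lit 0))
    (assign 8 (.lit 0))))).cost := ⟨_, rfl⟩
  obtain ⟨b, hb⟩ : ∃ b, b = (seq (setArr .count (.reg 1) (.reg 7))
    (setArr .top (.reg 1) (.reg 8))).cost := ⟨_, rfl⟩
  refine ⟨4 * (a + (countJob.cost + Algorithm.numJobs.time + 10) + b
    + Algorithm.numStates.time + 10), ?_⟩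
  intro n I V B hB σ hσ hl h0
  have hBV := hB.le
  have hB1 := hB.one_le
  let Inv : ℕ → State → Prop := fun i σ => I.Prepared σ ∧
    I.HasLeftEnds (n * Instance.numEnds n + 1) σ ∧ I.HasCounts i σ ∧ ∀ s : ℕ, σ.arr .cost s = 0
  refine (Spec.forLt_const (Instance.numStates n) Inv
    (a + ((n + 1) * (countJob.cost + Algorithm.numJobs.time + 10) + b)) hB.numStates_le
    ?_ ?_ ?_ ?_).mono ?_ fun _ h => h
  · exact fun i σ x h => ⟨h.1.congr rfl, h.2⟩
  · exact fun i σ h => eval_numStates h.1.input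
  · rintro s hs σ ⟨h2, h3, h4, h5⟩ h1
    have hsV : (s : ℤ) ≤ V := le_trans (by exact_mod_cast hs.le) hB.numStates_le
    refine Spec.seq (R := I.Counting σ.mem s 0) ?_ fun τ hτ => ?_
    · rw [ha]
      refine Spec.of_wp fun _ => wp_seq (wp_locate hB h2 h3 hs h1) ?_
      rintro τ ⟨e0, e1, -, -, e4, e5, -⟩
      refine wp_seq_assign (x := 0) rfl (by rw [abs_zero]; linarith) ?_
      refine wp_seq_assign (x := 0) rfl (by rw [abs_zero]; linarith) ?_
      refine wp_assign (x := 0) rfl (by rw [abs_zero]; linarith) ?_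
      simp [Counting, State.setReg_reg, e0, e1, e4, e5]
    · refine Spec.seq (R := I.Counting σ.mem s n) ?_ fun τ' hτ' => ?_
      · refine Spec.forLt_const n (I.Counting σ.mem s) _ (hB.n_le.trans (by linarith)) ?_ ?_ ?_ hτ
        · intro i τ x h
          simpa [Counting, State.setReg_reg] using h
        · exact fun i τ h => eval_numJobs (h2.input.congr h.1)
        · exact fun i hi τ h h9 => Spec.of_wp fun _ => wp_countJob hB hi (h2.congr h.1) h h9
      · obtain ⟨e0, e1, -, -, e7, e6, e8⟩ := hτ'
        rw [hb]
        refine Spec.of_wp fun hbd => ?_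
        have hcard : {j ∈ I.jobsOn (I.region s) | (j : ℕ) < n} = I.jobsOn (I.region s) := by
          ext j
          simp
        rw [hcard] at e7
        refine wp_seq_setArr e1 rfl (hbd.2.1 7) ?_
        refine wp_setArr_of e1 rfl (hbd.2.1 8) ?_
        have hs0 : (0 : ℤ) ≤ s := by positivity
        refine ⟨⟨((h2.congr e0).setArr id hs0 _).setArr id hs0 _,
          ((h3.congr e0).setArr (by simp) _ _).setArr (by simp) _ _, ?_, ?_⟩, e1⟩
        · intro s' hs'
          rw [State.arr_setArr_same, State.arr_setArr_of_ne (by simp), State.arr_setArr_same,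
            State.arr_setArr_of_ne (by simp)]
          by_cases hss : s' = s
          · subst hss
            refine ⟨by rw [if_pos rfl]; exact e7, fun hpos => ?_⟩
            rw [if_pos rfl]
            obtain ⟨i, hi⟩ := I.numJobs_pos_iff.1 hpos
            have hi1 := I.len_pos hi
            have hi2 := e6 i hi i.2
            rcases e8 with e8 | ⟨j, hj, e8, e9⟩
            · omega
            · refine ⟨j, ⟨hj, fun j' hj' => ?_⟩, e8⟩
              have := e6 j' hj' j'.2
              omega
          · have hss' : (s' : ℤ) ≠ s := by exact_mod_cast hss
            rw [if_neg hss', if_neg hss', arr_congr e0, arr_congr e0]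
            exact h4 s' (by omega)
        · intro s'
          rw [State.arr_setArr_of_ne (by simp), State.arr_setArr_of_ne (by simp), arr_congr e0]
          exact h5 s'
  · exact ⟨hσ, hl, fun s hs => absurd hs (by omega), h0⟩
  · refine le_trans (Nat.mul_le_mul_left _ ?_) (numStates_mul_le n _)
    nlinarith

/-! ### Solving the states -/

theorem cost_region_le (hB : I.WordBound V B) (s : ℕ) :
    (I.cost (I.region s) : ℤ) ≤ 22 * B := by
  have h1 := I.cost_le_ncard (P := I.region s) (Set.finite_Icc _ _)
  have h2 := abs_le.1 (hB.leftEnd_le (s / Instance.numEnds n))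
  have h3 := abs_le.1 (hB.rightEnd_le (s % Instance.numEnds n))
  have h4 := hB.one_le
  have h5 : ((I.region s).ncard : ℤ) ≤ 22 * B := by
    rw [region, ncard_Icc]
    omega
  exact le_trans (by exact_mod_cast h1) h5

theorem branchCost_le (hB : I.WordBound V B) (s : ℕ) (j : Fin n) (u : ℕ) :
    (I.branchCost s j u : ℤ) ≤ 48 * B := by
  have h1 : (I.block j (I.rightEnd u + 1) ∩ I.region s).ncard ≤ I.len j := by
    rw [← I.ncard_block j (I.rightEnd u + 1)]
    exact Set.ncard_le_ncard Set.inter_subset_left (I.block_finite _ _)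
  have h2 := cost_region_le hB (rightState j u s)
  have h3 := cost_region_le hB (leftState n u s)
  have h4 := hB.len_le j
  rw [branchCost]
  push_cast
  have : ((I.block j (I.rightEnd u + 1) ∩ I.region s).ncard : ℤ) ≤ I.len j := by exact_mod_cast h1
  linarith

variable (I) in
/-- The registers while the branches of state `s` are compared. -/
structure Trying (μ : ℤ → ℤ) (s t : ℕ) (j : Fin n) (i : ℕ) (σ : State) : Prop where
  mem : σ.mem = μ
  reg_one : σ.reg 1 = s
  reg_two : σ.reg 2 = (s / Instance.numEnds n : ℕ)
  reg_three : σ.reg 3 = (s % Instance.numEnds n : ℕ)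
  reg_four : σ.reg 4 = I.leftEnd (s / Instance.numEnds n)
  reg_five : σ.reg 5 = I.rightEnd (s % Instance.numEnds n)
  reg_eight : σ.reg 8 = (j : ℕ)
  reg_ten : σ.reg 10 = t
  le_branchCost : ∀ u < i, I.IsBranch s j u → σ.reg 6 ≤ I.branchCost s j u
  best : σ.reg 6 = I.rightEnd (s % Instance.numEnds n) - I.leftEnd (s / Instance.numEnds n) + 2 ∨
    ∃ u : ℕ, σ.reg 7 = u ∧ I.IsBranch s j u ∧ σ.reg 6 = I.branchCost s j u

/-- Both substates of a branch have fewer jobs, so by `hsub` their costs are already in the table.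
-/
theorem wp_tryBranch (hB : I.WordBound V B) {μ : ℤ → ℤ} {σ : State} {s t i : ℕ} {j : Fin n}
    (hs : s < Instance.numStates n) (hi : i < Instance.numEnds n) (hσ : I.Prepared σ)
    (hj : I.IsLongest (I.region s) j)
    (hsub : ∀ s' < Instance.numStates n, I.numJobs s' < I.numJobs s →
      σ.arr .cost (s' : ℕ) = I.cost (I.region s'))
    (h : I.Trying μ s t j i σ) (h9 : σ.reg 9 = i) :
    tryBranch.wp V (fun τ => I.Trying μ s t j (i + 1) τ ∧ τ.reg 9 = i) σ := by
  have hBV := hB.le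
  have hB1 := hB.one_le
  have hre := abs_le.1 (hB.rightEnd_le i)
  have hq := abs_le.1 (hB.rightEnd_le (s % Instance.numEnds n))
  have hp := abs_le.1 (hB.leftEnd_le (s / Instance.numEnds n))
  have hl := hB.len_le j
  obtain ⟨e1, e2, e3⟩ := hσ.jobs j j.2
  -- A start that is not admissible changes nothing except the scratch register `11`.
  have keep : (¬ I.IsBranch s j i) →
      I.Trying μ s t j (i + 1) (σ.setReg 11 (I.rightEnd i + 1)) ∧
        (σ.setReg 11 (I.rightEnd i + 1)).reg 9 = i := by
    intro hb
    refine ⟨⟨h.mem, ?_, ?_, ?_, ?_, ?_, ?_, ?_, fun u hu hbu => ?_, ?_⟩, ?_⟩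
    · simp [State.setReg_reg, h.reg_one]
    · simp [State.setReg_reg, h.reg_two]
    · simp [State.setReg_reg, h.reg_three]
    · simp [State.setReg_reg, h.reg_four]
    · simp [State.setReg_reg, h.reg_five]
    · simp [State.setReg_reg, h.reg_eight]
    · simp [State.setReg_reg, h.reg_ten]
    · rcases Nat.lt_succ_iff_lt_or_eq.1 hu with hu | rfl
      · simpa [State.setReg_reg] using h.le_branchCost u hu hbu
      · exact absurd hbu hb
    · simpa [State.setReg_reg] using h.best
    · simp [State.setReg_reg, h9]
  refine wp_seq_assign (x := I.rightEnd i + 1) ?_ (by rw [abs_le]; constructor <;> linarith) ?_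
  · simp [Expr.eval, h9, hσ.rightEnds i hi]
  constructor
  swap
  · intro hc
    refine keep fun hb => ?_
    have : I.rightEnd i + 1 < I.lo j := by
      simpa [Expr.eval, State.setReg_reg, h.reg_eight, e1] using hc
    have := hb.lo_le
    omega
  intro hc1
  constructor
  swap
  · intro hc
    refine keep fun hb => ?_
    have : I.hi j < I.rightEnd i + 1 := by
      simpa [Expr.eval, State.setReg_reg, h.reg_eight, e2] using hc
    have := hb.le_hi
    omega
  intro hc2
  have hb : I.IsBranch s j i := by
    refine ⟨hj, hi, ?_, ?_⟩
    · simpa [Expr.eval, State.setReg_reg, h.reg_eight, e1] using hc1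
    · simpa [Expr.eval, State.setReg_reg, h.reg_eight, e2] using hc2
  clear hc1 hc2 keep
  refine wp_seq_assign (x := I.rightEnd i + I.len j) ?_
    (by rw [abs_le]; constructor <;> linarith) ?_
  · simp [Expr.eval, State.setReg_reg, h.reg_eight, e3]
    ring
  refine wp_seq (R := fun τ => τ = (σ.setReg 11 (I.rightEnd i + 1)).setReg 12
    (min (I.rightEnd i + I.len j) (I.rightEnd (s % Instance.numEnds n)))) ?_ ?_
  · constructor
    · intro hc
      have hc' : I.rightEnd (s % Instance.numEnds n) ≤ I.rightEnd i + I.len j := by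
        simpa [Expr.eval, State.setReg_reg, h.reg_five] using hc
      refine wp_assign (x := I.rightEnd (s % Instance.numEnds n)) ?_
        (by rw [abs_le]; constructor <;> linarith) ?_
      · simp [Expr.eval, State.setReg_reg, h.reg_five]
      · rw [State.setReg_setReg, min_eq_right hc']
    · intro hc
      have hc' : I.rightEnd i + I.len j < I.rightEnd (s % Instance.numEnds n) := by
        simpa [Expr.eval, State.setReg_reg, h.reg_five] using hc
      show _ = _
      rw [min_eq_left hc'.le]
  rintro _ rfl
  refine wp_seq (R := fun τ => τ = ((σ.setReg 11 (I.rightEnd i + 1)).setReg 12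
    (min (I.rightEnd i + I.len j) (I.rightEnd (s % Instance.numEnds n)))).setReg 11
    (max (I.rightEnd i + 1) (I.leftEnd (s / Instance.numEnds n)))) ?_ ?_
  · constructor
    · intro hc
      have hc' : I.rightEnd i + 1 ≤ I.leftEnd (s / Instance.numEnds n) := by
        simpa [Expr.eval, State.setReg_reg, h.reg_four] using hc
      refine wp_assign (x := I.leftEnd (s / Instance.numEnds n)) ?_
        (by rw [abs_le]; constructor <;> linarith) ?_
      · simp [Expr.eval, State.setReg_reg, h.reg_four]
      · rw [max_eq_right hc']
    · intro hc
      have hc' : I.leftEnd (s / Instance.numEnds n) < I.rightEnd i + 1 := by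
        simpa [Expr.eval, State.setReg_reg, h.reg_four] using hc
      show _ = _
      rw [max_eq_left hc'.le]
      unfold State.setReg
      congr 1
      ext k
      simp only [Function.update_apply]
      split_ifs with h1 h2 <;> simp_all
  rintro _ rfl
  have hbc := branchCost_le hB s j i
  have hcR := hsub _ (rightState_lt j hi s) hb.numJobs_rightState
  have hcL := hsub _ (leftState_lt hs hi) hb.numJobs_leftState
  refine wp_seq_assign (x := I.branchCost s j i) ?_ ?_ ?_
  · rw [branchCost]
    push_cast
    rw [hb.ncard_eq, ← hcR, ← hcL, rightState, leftState]
    have hN := eval_numEnds ((((hσ.input.setReg 11 (I.rightEnd i + 1)).setReg 12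
      (min (I.rightEnd i + I.len j) (I.rightEnd (s % Instance.numEnds n))))).setReg 11
      (max (I.rightEnd i + 1) (I.leftEnd (s / Instance.numEnds n))))
    simp only [Expr.eval, Expr.eval_arr, hN, State.setReg_reg, State.arr_setReg, if_true, if_false,
      Nat.reduceEqDiff, h.reg_eight, h9, h.reg_three, h.reg_two]
    push_cast
    ring
  · rw [Nat.abs_cast]
    linarith
  constructor
  · intro hc
    have hc' : (I.branchCost s j i : ℤ) ≤ σ.reg 6 := by
      simpa [Expr.eval, State.setReg_reg] using hc
    refine wp_seq_assign (x := I.branchCost s j i) ?_ (by rw [Nat.abs_cast]; linarith) ?_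
    · simp [Expr.eval, State.setReg_reg]
    refine wp_assign (x := i) ?_ ?_ ?_
    · simp [Expr.eval, State.setReg_reg, h9]
    · rw [Nat.abs_cast]
      exact le_trans (by exact_mod_cast hi.le.trans (numEnds_le_numStates n)) hB.numStates_le
    refine ⟨⟨h.mem, ?_, ?_, ?_, ?_, ?_, ?_, ?_, fun u hu hbu => ?_, Or.inr ⟨i, ?_, hb, ?_⟩⟩, ?_⟩
    · simp [State.setReg_reg, h.reg_one]
    · simp [State.setReg_reg, h.reg_two]
    · simp [State.setReg_reg, h.reg_three]
    · simp [State.setReg_reg, h.reg_four]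
    · simp [State.setReg_reg, h.reg_five]
    · simp [State.setReg_reg, h.reg_eight]
    · simp [State.setReg_reg, h.reg_ten]
    · rcases Nat.lt_succ_iff_lt_or_eq.1 hu with hu | rfl
      · have := hc'.trans (h.le_branchCost u hu hbu)
        simpa [State.setReg_reg] using this
      · simp [State.setReg_reg]
    · simp [State.setReg_reg]
    · simp [State.setReg_reg]
    · simp [State.setReg_reg, h9]
  · intro hc
    have hc' : σ.reg 6 < (I.branchCost s j i : ℤ) := by
      simpa [Expr.eval, State.setReg_reg] using hc
    refine ⟨⟨h.mem, ?_, ?_, ?_, ?_, ?_, ?_, ?_, fun u hu hbu => ?_, ?_⟩, ?_⟩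
    · simp [State.setReg_reg, h.reg_one]
    · simp [State.setReg_reg, h.reg_two]
    · simp [State.setReg_reg, h.reg_three]
    · simp [State.setReg_reg, h.reg_four]
    · simp [State.setReg_reg, h.reg_five]
    · simp [State.setReg_reg, h.reg_eight]
    · simp [State.setReg_reg, h.reg_ten]
    · rcases Nat.lt_succ_iff_lt_or_eq.1 hu with hu | rfl
      · simpa [State.setReg_reg] using h.le_branchCost u hu hbu
      · simpa [State.setReg_reg] using hc'.le
    · simpa [State.setReg_reg] using h.best
    · simp [State.setReg_reg, h9]

variable (I) in
/-- The cost of state `s` and an optimal choice have been stored. -/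
def Solved (σ : State) (s : ℕ) : Prop := σ.arr .cost (s : ℕ) = I.cost (I.region s) ∧
  (0 < I.numJobs s → ∃ (j : Fin n) (u : ℕ), σ.arr .top (s : ℕ) = (j : ℕ) ∧
    σ.arr .choice (s : ℕ) = u ∧ I.IsChoice s j u)

theorem Solved.congr {σ τ : State} {s : ℕ} (h : I.Solved σ s) (hm : τ.mem = σ.mem) :
    I.Solved τ s := by
  simpa only [Solved, arr_congr hm] using h

variable (I) in
/-- The arrays after the states with at most `t` jobs, and those with `t + 1` jobs and number below
`i`, have been solved. -/
structure Solving (t i : ℕ) (σ : State) : Prop where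
  prepared : I.Prepared σ
  leftEnds : I.HasLeftEnds (n * Instance.numEnds n + 1) σ
  counts : I.HasCounts (Instance.numStates n) σ
  solved : ∀ s < Instance.numStates n,
    I.numJobs s ≤ t ∨ (I.numJobs s = t + 1 ∧ s < i) → I.Solved σ s

theorem Solving.congr {σ τ : State} {t i : ℕ} (h : I.Solving t i σ) (hm : τ.mem = σ.mem) :
    I.Solving t i τ :=
  ⟨h.prepared.congr hm, h.leftEnds.congr hm, h.counts.congr hm,
    fun s hs hs' => (h.solved s hs hs').congr hm⟩

/-- A constant for the running time of `solveState`. -/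
def solveStateTime : ℕ := (seq locate (seq (assign 8 (.arr .top (.reg 1)))
  (seq (assign 6 (.add (.sub (.reg 5) (.reg 4)) (.lit 2))) (assign 7 (.lit 0))))).cost +
  2 * (tryBranch.cost + Algorithm.numEnds.time + 10) +
  (seq (setArr .cost (.reg 1) (.reg 6)) (setArr .choice (.reg 1) (.reg 7))).cost

theorem le_solveStateTime (n : ℕ) :
    (seq locate (seq (assign 8 (.arr .top (.reg 1)))
      (seq (assign 6 (.add (.sub (.reg 5) (.reg 4)) (.lit 2))) (assign 7 (.lit 0))))).cost +
      ((Instance.numEnds n + 1) * (tryBranch.cost + Algorithm.numEnds.time + 10) +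
      (seq (setArr .cost (.reg 1) (.reg 6)) (setArr .choice (.reg 1) (.reg 7))).cost) ≤
      solveStateTime * (n + 1) := by
  have aux : ∀ a b d : ℕ, a + ((Instance.numEnds n + 1) * b + d) ≤ (a + 2 * b + d) * (n + 1) := by
    intro a b d
    have e : Instance.numEnds n + 1 = 2 * (n + 1) := by unfold Instance.numEnds; ring
    rw [e]
    nlinarith [Nat.zero_le (a * n), Nat.zero_le (d * n)]
  unfold solveStateTime
  exact aux _ _ _

set_option maxHeartbeats 1000000 in
-- The initial value, two more than the difference of the ends, exceeds the number of paths of the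
-- region and plays the role of infinity. An optimal branch exists by `exists_isChoice`, so the
-- value is replaced, and the recorded branch is then optimal because no branch lies below the cost.
theorem spec_solveState (hB : I.WordBound V B) {σ : State} {s t : ℕ}
    (hs : s < Instance.numStates n) (hst : I.numJobs s = t + 1) (h : I.Solving t s σ)
    (h1 : σ.reg 1 = s) (h10 : σ.reg 10 = t) :
    Spec V solveState σ (solveStateTime * (n + 1)) fun τ =>
      (I.Solving t (s + 1) τ ∧ τ.reg 10 = t) ∧ τ.reg 1 = s := by
  have hBV := hB.le
  have hB1 := hB.one_le
  have hsV : (s : ℤ) ≤ V := le_trans (by exact_mod_cast hs.le) hB.numStates_le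
  have hN : (Instance.numEnds n : ℤ) ≤ V :=
    le_trans (by exact_mod_cast numEnds_le_numStates n) hB.numStates_le
  have hq := abs_le.1 (hB.rightEnd_le (s % Instance.numEnds n))
  have hp := abs_le.1 (hB.leftEnd_le (s / Instance.numEnds n))
  obtain ⟨j, hj, htop⟩ := (h.counts s hs).2 (by omega)
  have hjV : ((j : ℕ) : ℤ) ≤ V := by
    have := hB.n_le
    have := j.2
    omega
  refine Spec.mono ?_ (le_solveStateTime n) fun _ h => h
  refine Spec.seq (R := I.Trying σ.mem s t j 0) ?_ fun τ hτ => ?_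
  · refine Spec.of_wp fun _ => wp_seq (wp_locate hB h.prepared h.leftEnds hs h1) ?_
    rintro τ ⟨e0, e1, e2, e3, e4, e5, e6⟩
    have e10 := e6 10 (by norm_num)
    refine wp_seq_assign (x := (j : ℕ)) ?_ (by rw [Nat.abs_cast]; exact hjV) ?_
    · simp [Expr.eval, e1, arr_congr e0, htop]
    refine wp_seq_assign (x := I.rightEnd (s % Instance.numEnds n) -
      I.leftEnd (s / Instance.numEnds n) + 2) ?_ ?_ ?_
    · simp [Expr.eval, State.setReg_reg, e4, e5]
    · rw [abs_le]; constructor <;> linarith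
    refine wp_assign (x := 0) rfl (by rw [abs_zero]; linarith) ?_
    refine ⟨e0, ?_, ?_, ?_, ?_, ?_, ?_, ?_, fun u hu => absurd hu (by omega), Or.inl ?_⟩ <;>
      simp [State.setReg_reg, e1, e2, e3, e4, e5, e10, h10]
  refine Spec.seq (R := I.Trying σ.mem s t j (Instance.numEnds n)) ?_ fun τ' hτ' => ?_
  · refine Spec.forLt_const (Instance.numEnds n) (I.Trying σ.mem s t j) _ hN ?_ ?_ ?_ hτ
    · intro i τ x hτ
      refine ⟨hτ.mem, ?_, ?_, ?_, ?_, ?_, ?_, ?_, ?_, ?_⟩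
      · simpa [State.setReg_reg] using hτ.reg_one
      · simpa [State.setReg_reg] using hτ.reg_two
      · simpa [State.setReg_reg] using hτ.reg_three
      · simpa [State.setReg_reg] using hτ.reg_four
      · simpa [State.setReg_reg] using hτ.reg_five
      · simpa [State.setReg_reg] using hτ.reg_eight
      · simpa [State.setReg_reg] using hτ.reg_ten
      · simpa [State.setReg_reg] using hτ.le_branchCost
      · simpa [State.setReg_reg] using hτ.best
    · exact fun i τ hτ => eval_numEnds (h.prepared.input.congr hτ.mem)
    · intro i hi τ hτ h9
      refine Spec.of_wp fun _ =>
        wp_tryBranch hB hs hi (h.prepared.congr hτ.mem) hj (fun s' hs' hlt => ?_) hτ h9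
      rw [arr_congr hτ.mem]
      exact (h.solved s' hs' (Or.inl (by omega))).1
  · refine Spec.of_wp fun hbd => ?_
    have hs0 : (0 : ℤ) ≤ s := by positivity
    obtain ⟨u₀, hu₀⟩ := exists_isChoice hj
    have hle := hτ'.le_branchCost u₀ hu₀.lt hu₀.toIsBranch
    rw [← hu₀.cost_eq] at hle
    have hne : I.leftEnd (s / Instance.numEnds n) ≤ I.rightEnd (s % Instance.numEnds n) :=
      (I.mem_jobsOn_Icc.1 hj.1).2.1
    have hub : (I.cost (I.region s) : ℤ) ≤ I.rightEnd (s % Instance.numEnds n) -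
        I.leftEnd (s / Instance.numEnds n) + 1 := by
      have h1 := I.cost_le_ncard (P := I.region s) (Set.finite_Icc _ _)
      have h2 : ((I.region s).ncard : ℤ) = I.rightEnd (s % Instance.numEnds n) -
        I.leftEnd (s / Instance.numEnds n) + 1 := by
        rw [region, ncard_Icc]
        omega
      rw [← h2]
      exact_mod_cast h1
    obtain ⟨u, hu7, hu, hu6⟩ : ∃ u : ℕ, τ'.reg 7 = u ∧ I.IsBranch s j u ∧
        τ'.reg 6 = I.branchCost s j u := by
      rcases hτ'.best with hb | hb
      · omega
      · exact hb
    have hcost : I.cost (I.region s) = I.branchCost s j u := by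
      have := hu.cost_le
      omega
    refine wp_seq_setArr hτ'.reg_one rfl (hbd.2.1 6) ?_
    refine wp_setArr_of hτ'.reg_one rfl (hbd.2.1 7) ?_
    have h' := h.congr hτ'.mem
    refine ⟨⟨⟨(h'.prepared.setArr id hs0 _).setArr id hs0 _,
      (h'.leftEnds.setArr (by simp) _ _).setArr (by simp) _ _,
      (h'.counts.setArr (by simp) (by simp) _ _).setArr (by simp) (by simp) _ _, ?_⟩,
      hτ'.reg_ten⟩, hτ'.reg_one⟩
    intro s' hs' hlt
    rw [Solved, State.arr_setArr_of_ne (by simp), State.arr_setArr_same,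
      State.arr_setArr_of_ne (by simp), State.arr_setArr_of_ne (by simp), State.arr_setArr_same,
      State.arr_setArr_of_ne (by simp)]
    by_cases hss : s' = s
    · subst hss
      rw [if_pos rfl, if_pos rfl]
      refine ⟨?_, fun _ => ⟨j, u, ?_, hu7, hu, hcost⟩⟩
      · rw [hcost]
        exact hu6
      · rw [arr_congr hτ'.mem]
        exact htop
    · have hss' : (s' : ℤ) ≠ s := by exact_mod_cast hss
      rw [if_neg hss', if_neg hss']
      exact h'.solved s' hs' (by omega)

/-- A state is solved on at most one level, so the expensive work is charged to it once. -/
theorem sum_ite_eq_succ_le (N a c : ℕ) :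
    ∑ t ∈ Finset.range N, (if a = t + 1 then c else 0) ≤ c := by
  rcases a with _ | a
  · simp
  · simp only [Nat.add_right_cancel_iff, Finset.sum_ite_eq]
    split_ifs <;> simp

theorem spec_solveStates : ∃ K, ∀ {n : ℕ} {I : Instance n} {V B : ℤ}, I.WordBound V B →
    ∀ {σ : State}, I.Prepared σ → I.HasLeftEnds (n * Instance.numEnds n + 1) σ →
    I.HasCounts (Instance.numStates n) σ → (∀ s : ℕ, σ.arr .cost s = 0) →
    Spec V solveStates σ (K * (n + 1) ^ 4) fun σ' => I.Prepared σ' ∧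
      I.HasLeftEnds (n * Instance.numEnds n + 1) σ' ∧
      ∀ s < Instance.numStates n, I.Solved σ' s := by
  obtain ⟨a, ha⟩ : ∃ a, a = (Expr.arr .count (.reg 1)).time + (Expr.add (.reg 10) (.lit 1)).time +
    1 + ((Expr.add (.reg 10) (.lit 1)).time + (Expr.arr .count (.reg 1)).time + 1) + 1 := ⟨_, rfl⟩
  refine ⟨4 * (a + Algorithm.numStates.time + 10 + solveStateTime) + Algorithm.numJobs.time + 10,
    ?_⟩
  intro n I V B hB σ hσ hl hcnt h0
  have hBV := hB.le
  have hB1 := hB.one_le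
  refine (Spec.forLt n (fun t => I.Solving t 0) (fun t =>
    (∑ s ∈ Finset.range (Instance.numStates n), (a + if I.numJobs s = t + 1 then
      solveStateTime * (n + 1) else 0)) + (Instance.numStates n + 1) *
        (Algorithm.numStates.time + 10)) (hB.n_le.trans (by linarith)) ?_ ?_ ?_ ?_).mono ?_ ?_
  · exact fun i σ x h => h.congr rfl
  · exact fun i σ h => eval_numJobs h.prepared.input
  · intro t ht σ h h10
    refine (Spec.forLt (Instance.numStates n) (fun s σ => I.Solving t s σ ∧ σ.reg 10 = t) _
      hB.numStates_le ?_ ?_ ?_ ⟨h, h10⟩).mono le_rfl ?_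
    · rintro s σ x ⟨h, h'⟩
      exact ⟨h.congr rfl, by simp [State.setReg_reg, h']⟩
    · exact fun s σ h => eval_numStates h.1.prepared.input
    · rintro s hs τ ⟨h, h10⟩ h1
      have hc := (h.counts s hs).1
      by_cases hst : I.numJobs s = t + 1
      · rw [if_pos hst]
        refine (Spec.ifLe (fun _ => Spec.ifLe (fun _ => spec_solveState hB hs hst h h1 h10)
          fun hlt => ?_) fun hlt => ?_).mono ?_ fun _ h => h
        · simp [Expr.eval, h1, h10, hc, hst] at hlt
        · simp [Expr.eval, h1, h10, hc, hst] at hlt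
        · omega
      · rw [if_neg hst, add_zero]
        have hskip : Spec V .skip τ 1 fun τ => (I.Solving t (s + 1) τ ∧ τ.reg 10 = t) ∧
            τ.reg 1 = s := by
          refine Spec.of_wp fun _ => ⟨⟨⟨h.prepared, h.leftEnds, h.counts, fun s' hs' hlt => ?_⟩,
            h10⟩, h1⟩
          refine h.solved s' hs' ?_
          rcases hlt with hlt | ⟨hlt, hlt'⟩
          · exact Or.inl hlt
          · rcases Nat.lt_succ_iff_lt_or_eq.1 hlt' with h3 | rfl
            · exact Or.inr ⟨hlt, h3⟩
            · exact absurd hlt hst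
        refine (Spec.ifLe (fun hle => Spec.ifLe (fun hle' => ?_) fun _ => hskip)
          fun _ => hskip.mono ?_ fun _ h => h).mono ?_ fun _ h => h
        · simp only [Expr.eval, Expr.eval_arr, h1, h10, hc] at hle hle'
          omega
        · omega
        · omega
    · rintro τ ⟨h, h'⟩
      refine ⟨⟨h.prepared, h.leftEnds, h.counts, fun s hs hlt => h.solved s hs ?_⟩, h'⟩
      omega
  -- Before the outer loop exactly the states without jobs count as solved, and their cost `0`
  -- stands in memory from the beginning.
  · refine ⟨hσ, hl, hcnt, fun s hs hlt => ?_⟩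
    have hz : I.numJobs s = 0 := by omega
    refine ⟨?_, fun hpos => by omega⟩
    rw [h0, I.cost_eq_zero, Nat.cast_zero]
    exact Set.not_nonempty_iff_eq_empty.1 fun hne => by
      have := I.numJobs_pos_iff.2 hne
      omega
  · have hsum : ∑ t ∈ Finset.range n, ∑ s ∈ Finset.range (Instance.numStates n),
        (if I.numJobs s = t + 1 then solveStateTime * (n + 1) else 0) ≤
        Instance.numStates n * (solveStateTime * (n + 1)) := by
      -- Summed over the levels for a fixed state, the time of `solveState` appears at most once;
      -- this keeps the total at `O(n³)` states times `O(n)` steps.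
      rw [Finset.sum_comm]
      refine (Finset.sum_le_card_nsmul _ _ _ fun s _ => sum_ite_eq_succ_le _ _ _).trans ?_
      simp
    simp only [Finset.sum_add_distrib, Finset.sum_const, Finset.card_range, smul_eq_mul]
    have hS := numStates_add_one_le n
    generalize Instance.numStates n = S at *
    generalize ∑ t ∈ Finset.range n, ∑ s ∈ Finset.range S,
        (if I.numJobs s = t + 1 then solveStateTime * (n + 1) else 0) = X at *
    generalize solveStateTime = c at *
    generalize Algorithm.numStates.time = e at *
    generalize Algorithm.numJobs.time = f at *
    have h1 : n * (S * a) ≤ (n + 1) * (4 * (n + 1) ^ 3 * a) := by gcongr <;> omega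
    have h2 : S * (c * (n + 1)) ≤ 4 * (n + 1) ^ 3 * (c * (n + 1)) := by gcongr; omega
    have h3 : n * ((S + 1) * (e + 10)) ≤ (n + 1) * (4 * (n + 1) ^ 3 * (e + 10)) := by
      gcongr; omega
    have h4 : (n + 1) * (f + 10) ≤ (n + 1) ^ 4 * (f + 10) := by
      gcongr
      exact Nat.le_self_pow (by norm_num) _
    calc _ ≤ (n + 1) * (4 * (n + 1) ^ 3 * a) + 4 * (n + 1) ^ 3 * (c * (n + 1)) +
          (n + 1) * (4 * (n + 1) ^ 3 * (e + 10)) + (n + 1) ^ 4 * (f + 10) := by omega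
      _ = _ := by ring
  · exact fun τ h => ⟨h.prepared, h.leftEnds, fun s hs => h.solved s hs (Or.inl (I.numJobs_le s))⟩

end Instance
namespace Instance

open Algorithm Program

variable {n : ℕ} {I : Instance n} {V B : ℤ}

/-! ### Writing the start times -/

variable (I) in
/-- The results of the dynamic program, which are needed to read off an optimal solution. -/
structure Tables (top ch : ℕ → ℤ) (σ : State) : Prop where
  mem_zero : σ.mem 0 = n
  mem_one : σ.mem 1 = I.m
  jobs : I.HasJobs n σ
  rightEnds : I.HasRightEnds σ
  leftEnds : I.HasLeftEnds (n * Instance.numEnds n + 1) σ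
  top_eq : ∀ s : ℕ, σ.arr .top s = top s
  choice_eq : ∀ s : ℕ, σ.arr .choice s = ch s
  cost_eq : σ.arr .cost (root n : ℕ) = I.cost I.paths

/-- The tables use negative addresses for the arrays and the addresses `0` and `1` for `n` and `m`,
while results are written from address `8` on. -/
theorem Tables.congr {top ch : ℕ → ℤ} {σ τ : State} (h : I.Tables top ch σ)
    (hm : ∀ z < 2, τ.mem z = σ.mem z) : I.Tables top ch τ := by
  have ha : ∀ (c : Arr) (i : ℕ), τ.arr c i = σ.arr c i := fun c i =>
    hm _ (lt_trans (c.addr_neg (by positivity)) (by norm_num))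
  refine ⟨(hm 0 (by norm_num)).trans h.mem_zero, (hm 1 (by norm_num)).trans h.mem_one,
    fun j hj => ?_, fun w hw => ?_, fun l hl => ?_, fun s => ?_, fun s => ?_, ?_⟩
  · simpa only [ha] using h.jobs j hj
  · simpa only [ha] using h.rightEnds w hw
  · simpa only [ha] using h.leftEnds l hl
  · simpa only [ha] using h.top_eq s
  · simpa only [ha] using h.choice_eq s
  · simpa only [ha] using h.cost_eq

theorem natCast_div_sub_mul {s N : ℕ} :
    (s : ℤ) - (s / N : ℕ) * (N : ℤ) = (s % N : ℕ) := by
  have h : (N : ℤ) * (s / N : ℕ) + (s % N : ℕ) = s := by exact_mod_cast Nat.div_add_mod s N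
  linarith

/-- The three continuations `hR`, `hL` and `hS` correspond to the constructors of `Descent`; the
right side is tested before the left, as in `combine`. -/
theorem wp_descendStep (hB : I.WordBound V B) {top ch : ℕ → ℤ} {σ : State}
    (hT : I.Tables top ch σ) {i j : Fin n} {s u : ℕ} (hs : s < Instance.numStates n)
    (h1 : σ.reg 1 = (i : ℕ)) (h17 : σ.reg 17 = s) (htop : top s = (j : ℕ)) (hch : ch s = u)
    (hc : I.IsChoice s j u) {Q : State → Prop}
    (hR : i ∈ I.jobsOn (I.region (rightState j u s)) → ∀ τ : State, τ.mem = σ.mem →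
      τ.reg 1 = (i : ℕ) → τ.reg 18 = σ.reg 18 → τ.reg 17 = (rightState j u s : ℕ) → Q τ)
    (hL : i ∉ I.jobsOn (I.region (rightState j u s)) → i ∈ I.jobsOn (I.region (leftState n u s)) →
      ∀ τ : State, τ.mem = σ.mem → τ.reg 1 = (i : ℕ) → τ.reg 18 = σ.reg 18 →
      τ.reg 17 = (leftState n u s : ℕ) → Q τ)
    (hS : i ∉ I.jobsOn (I.region (rightState j u s)) → i ∉ I.jobsOn (I.region (leftState n u s)) →
      ∀ τ : State, τ.mem = σ.mem → τ.reg 1 = (i : ℕ) → τ.reg 18 = 0 → τ.reg 7 = u → Q τ) :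
    descendStep.wp V Q σ := by
  have hBV := hB.le
  have hB1 := hB.one_le
  have hNV := hB.numStates_le
  have hle : ∀ {x : ℕ}, x ≤ Instance.numStates n → |(x : ℤ)| ≤ V := by
    intro x hx
    rw [Nat.abs_cast]
    exact le_trans (by exact_mod_cast hx) hNV
  have hlt : u < Instance.numEnds n := hc.lt
  have hdiv := div_lt_of_lt_numStates hs
  have hmod := Nat.mod_lt s (numEnds_pos n)
  have hl := (mul_add_lt_mul j hlt).trans (Nat.lt_succ_self _)
  have hE : ∀ {τ : State}, τ.mem = σ.mem → Algorithm.numEnds.eval τ = (Instance.numEnds n : ℕ) :=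
    fun h => eval_numEnds_of_mem (by rw [h]; exact hT.mem_zero)
  refine wp_seq_assign (x := (s / Instance.numEnds n : ℕ)) ?_
    (hle ((Nat.div_le_self _ _).trans hs.le)) ?_
  · simp [Expr.eval, hE rfl, h17]
  refine wp_seq_assign (x := (s % Instance.numEnds n : ℕ)) ?_
    (hle ((Nat.mod_le _ _).trans hs.le)) ?_
  · simp only [Expr.eval, hE (State.setReg_mem _ _)]
    simpa [State.setReg_reg, h17] using natCast_div_sub_mul (s := s) (N := Instance.numEnds n)
  refine wp_seq_assign (x := u) ?_ (hle (hlt.le.trans (numEnds_le_numStates n))) ?_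
  · simp [Expr.eval, State.setReg_reg, h17, hT.choice_eq, hch]
  refine wp_seq_assign (x := (j * Instance.numEnds n + u : ℕ)) ?_ (hle ?_) ?_
  · simp only [Expr.eval]
    rw [hE (by rfl)]
    simp [Expr.eval, State.setReg_reg, h17, hT.top_eq, htop]
  · exact hl.le.trans (Nat.le_mul_of_pos_right _ (numEnds_pos n))
  generalize hτ : (((σ.setReg 2 (s / Instance.numEnds n : ℕ)).setReg 3
    (s % Instance.numEnds n : ℕ)).setReg 7 u).setReg 22 (j * Instance.numEnds n + u : ℕ) = τ
  have em : τ.mem = σ.mem := by rw [← hτ]; rfl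
  have e1 : τ.reg 1 = (i : ℕ) := by rw [← hτ]; simp [State.setReg_reg, h1]
  have e2 : τ.reg 2 = (s / Instance.numEnds n : ℕ) := by rw [← hτ]; simp [State.setReg_reg]
  have e3 : τ.reg 3 = (s % Instance.numEnds n : ℕ) := by rw [← hτ]; simp [State.setReg_reg]
  have e7 : τ.reg 7 = u := by rw [← hτ]; simp [State.setReg_reg]
  have e18 : τ.reg 18 = σ.reg 18 := by rw [← hτ]; simp [State.setReg_reg]
  have e22 : τ.reg 22 = (j * Instance.numEnds n + u : ℕ) := by rw [← hτ]; simp [State.setReg_reg]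
  clear hτ
  have hTτ : I.Tables top ch τ := hT.congr fun z _ => by rw [em]
  have hreg : I.region (rightState j u s) = Set.Icc (I.leftEnd (j * Instance.numEnds n + u))
      (I.rightEnd (s % Instance.numEnds n)) := region_mul_add I hmod
  have hreg' := region_leftState I hlt s
  refine wp_seq (R := fun τ' => (i ∈ I.jobsOn (I.region (rightState j u s)) ∧ τ' = τ.setReg 20 1) ∨
    (i ∉ I.jobsOn (I.region (rightState j u s)) ∧ τ' = τ.setReg 20 0)) ?_ ?_
  · refine wp_testJob (by linarith) hTτ.jobs (i := i)
      (p₀ := I.leftEnd (j * Instance.numEnds n + u))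
      (q₀ := I.rightEnd (s % Instance.numEnds n)) ?_ ?_ ?_ ?_ ?_
    · simp [Expr.eval, State.setReg_reg, e1]
    · intro x
      rw [← hTτ.leftEnds _ hl, ← e22]
      simp [Expr.eval, State.setReg_reg]
    · intro x
      rw [← hTτ.rightEnds _ hmod, ← e3]
      simp [Expr.eval, State.setReg_reg]
    · exact fun h => Or.inl ⟨hreg ▸ h, rfl⟩
    · exact fun h => Or.inr ⟨hreg ▸ h, rfl⟩
  rintro τ' (⟨hi, rfl⟩ | ⟨hi, rfl⟩)
  · refine ⟨fun _ => ?_, fun h => absurd h (by simp [Expr.eval, State.setReg_reg])⟩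
    refine wp_assign (x := (rightState j u s : ℕ)) ?_ (hle (rightState_lt j hlt s).le) ?_
    · simp only [Expr.eval]
      rw [hE (by exact em)]
      simp [State.setReg_reg, e22, e3, rightState]
    · exact hR hi _ em (by simp [State.setReg_reg, e1]) (by simp [State.setReg_reg, e18])
        (by simp [State.setReg_reg])
  refine ⟨fun h => absurd h (by simp [Expr.eval, State.setReg_reg]), fun _ => ?_⟩
  have hTτ' : I.Tables top ch (τ.setReg 20 0) := hTτ.congr fun z _ => rfl
  refine wp_seq (R := fun τ' => (i ∈ I.jobsOn (I.region (leftState n u s)) ∧ τ' = τ.setReg 20 1) ∨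
    (i ∉ I.jobsOn (I.region (leftState n u s)) ∧ τ' = τ.setReg 20 0)) ?_ ?_
  · refine wp_testJob (by linarith) hTτ'.jobs (i := i)
      (p₀ := I.leftEnd (s / Instance.numEnds n)) (q₀ := I.rightEnd u) ?_ ?_ ?_ ?_ ?_
    · simp [Expr.eval, State.setReg_reg, e1]
    · intro x
      rw [← hTτ.leftEnds _ hdiv, ← e2]
      simp [Expr.eval, State.setReg_reg]
    · intro x
      rw [← hTτ.rightEnds _ hlt, ← e7]
      simp [Expr.eval, State.setReg_reg]
    · rw [State.setReg_setReg]
      exact fun h => Or.inl ⟨hreg' ▸ h, rfl⟩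
    · rw [State.setReg_setReg]
      exact fun h => Or.inr ⟨hreg' ▸ h, rfl⟩
  rintro τ' (⟨hi', rfl⟩ | ⟨hi', rfl⟩)
  · refine ⟨fun _ => ?_, fun h => absurd h (by simp [Expr.eval, State.setReg_reg])⟩
    refine wp_assign (x := (leftState n u s : ℕ)) ?_ (hle (leftState_lt hs hlt).le) ?_
    · simp only [Expr.eval]
      rw [hE (by exact em)]
      simp [State.setReg_reg, e2, e7, leftState]
    · exact hL hi hi' _ em (by simp [State.setReg_reg, e1]) (by simp [State.setReg_reg, e18])
        (by simp [State.setReg_reg])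
  · refine ⟨fun h => absurd h (by simp [Expr.eval, State.setReg_reg]), fun _ => ?_⟩
    refine wp_assign (x := 0) rfl (by rw [abs_zero]; linarith) ?_
    exact hS hi hi' _ em (by simp [State.setReg_reg, e1]) (by simp [State.setReg_reg])
      (by simp [State.setReg_reg, e7])

variable (I) in
/-- The registers while the start `c` of job `i` is searched. -/
def Descending (top ch : ℕ → ℤ) (μ : ℤ → ℤ) (i : Fin n) (c : ℤ) (σ : State) : Prop :=
  σ.mem = μ ∧ σ.reg 1 = (i : ℕ) ∧
    ((σ.reg 18 = 1 ∧ ∃ s < Instance.numStates n, σ.reg 17 = (s : ℕ) ∧ I.Descent top ch i s c) ∨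
      (σ.reg 18 = 0 ∧ ∃ u < Instance.numEnds n, σ.reg 7 = (u : ℕ) ∧
        c = max (I.lo i) (min (I.hi i) (I.rightEnd u + 1))))

variable (I) in
/-- A bound for the number of steps left in the search. -/
noncomputable def descentVariant (σ : State) : ℕ :=
  if σ.reg 18 = 1 then I.numJobs (σ.reg 17).toNat + 1 else 0

theorem descentVariant_le (σ : State) : I.descentVariant σ ≤ n + 1 := by
  unfold descentVariant
  have := I.numJobs_le (σ.reg 17).toNat
  split_ifs <;> omega

/-- Each step leads to a state with fewer jobs or clears the flag in register `18`, so the loop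
makes at most `n + 1` turns. -/
theorem spec_descend (hB : I.WordBound V B) {top ch : ℕ → ℤ} {σ : State}
    (hT : I.Tables top ch σ) {i : Fin n} {c : ℤ} (h : I.Descending top ch σ.mem i c σ) :
    Spec V (.whileLe (.lit 1) (.reg 18) descendStep) σ ((n + 2) * (3 + descendStep.cost)) fun τ =>
      τ.mem = σ.mem ∧ τ.reg 1 = (i : ℕ) ∧ ∃ u < Instance.numEnds n, τ.reg 7 = (u : ℕ) ∧
        c = max (I.lo i) (min (I.hi i) (I.rightEnd u + 1)) := by
  refine (Spec.whileLe_variant (T := descendStep.cost) (I.Descending top ch σ.mem i c)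
    I.descentVariant ?_ h).mono ?_ ?_
  · rintro τ ⟨em, e1, h | ⟨h18, -⟩⟩ hle
    swap
    · simp [Expr.eval, h18] at hle
    obtain ⟨h18, s, hs, h17, hd⟩ := h
    have hTτ : I.Tables top ch τ := hT.congr fun z _ => by rw [em]
    have hv : I.descentVariant τ = I.numJobs s + 1 := by simp [descentVariant, h18, h17]
    have next : ∀ {τ' : State} {s' : ℕ}, I.numJobs s' < I.numJobs s → s' < Instance.numStates n →
        I.Descent top ch i s' c → τ'.mem = τ.mem → τ'.reg 1 = (i : ℕ) → τ'.reg 18 = τ.reg 18 →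
        τ'.reg 17 = s' →
        I.Descending top ch σ.mem i c τ' ∧ I.descentVariant τ' < I.descentVariant τ := by
      intro τ' s' h1 h2 h3 h4 h5 h6 h7
      refine ⟨⟨h4.trans em, h5, Or.inl ⟨h6.trans h18, s', h2, h7, h3⟩⟩, ?_⟩
      rw [hv]
      simp [descentVariant, h6, h18, h7, h1]
    refine Spec.of_wp fun _ => ?_
    cases hd with
    | right h1 h2 h3 h4 h5 =>
      refine wp_descendStep hB hTτ hs e1 h17 h1 h2 h3 ?_ (fun h => absurd h4 h)
        (fun h => absurd h4 h)
      intro _ τ' a1 a2 a3 a4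
      exact next h3.numJobs_rightState (rightState_lt _ h3.lt s) h5 a1 a2 a3 a4
    | left h1 h2 h3 h4 h5 h6 =>
      refine wp_descendStep hB hTτ hs e1 h17 h1 h2 h3 (fun h => absurd h h4) ?_
        (fun _ h => absurd h5 h)
      intro _ _ τ' a1 a2 a3 a4
      exact next h3.numJobs_leftState (leftState_lt hs h3.lt) h6 a1 a2 a3 a4
    | @done _ u _ h1 h2 h3 h4 h5 =>
      refine wp_descendStep hB hTτ hs e1 h17 h1 h2 h3 (fun h => absurd h h4)
        (fun _ h => absurd h h5) ?_
      intro _ _ τ' a1 a2 a3 a4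
      refine ⟨⟨a1.trans em, a2, Or.inr ⟨a3, u, h3.lt, a4, rfl⟩⟩, ?_⟩
      rw [hv]
      simp [descentVariant, a3]
  · have := I.descentVariant_le σ
    exact Nat.mul_le_mul (by omega) le_rfl
  · rintro τ ⟨⟨em, e1, h | ⟨-, h⟩⟩, hlt⟩
    · simp [Expr.eval, h.1] at hlt
    · exact ⟨em, e1, h⟩

variable (I) in
/-- `c` is the start of job `i` in the solution that belongs to the recorded choices. -/
def IsPlaced (top ch : ℕ → ℤ) (i : Fin n) (c : ℤ) : Prop :=
  (i ∈ I.jobsOn I.paths → I.Descent top ch i (root n) c) ∧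
    (i ∉ I.jobsOn I.paths → c = if (I.m : ℤ) + 1 ≤ I.hi i then I.hi i else I.lo i)

/-- A constant for the running time of `placeJob`. -/
def placeJobTime : ℕ := (testJob (.reg 1) (.lit 1) numPaths).cost + 50 +
  (ifLe (Expr.add numPaths (.lit 1)) (.arr .hi (.reg 1))
      (assign 21 (.arr .hi (.reg 1))) (assign 21 (.arr .lo (.reg 1)))).cost +
  (seq (assign 17 rootState) (assign 18 (.lit 1))).cost + 2 * (3 + descendStep.cost) +
  (seq (assign 21 (.add (.arr .rightEnd (.reg 7)) (.lit 1))) <|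
      seq (ifLe (.arr .hi (.reg 1)) (.reg 21) (assign 21 (.arr .hi (.reg 1))) skip) <|
      ifLe (.reg 21) (.arr .lo (.reg 1)) (assign 21 (.arr .lo (.reg 1))) skip).cost

theorem spec_placeJob (hB : I.WordBound V B) {top ch : ℕ → ℤ} {σ : State}
    (hT : I.Tables top ch σ) {i : Fin n} {c : ℤ} (hc : I.IsPlaced top ch i c)
    (h1 : σ.reg 1 = (i : ℕ)) :
    Spec V placeJob σ (placeJobTime * (n + 1)) fun τ =>
      τ.mem = σ.mem ∧ τ.reg 1 = (i : ℕ) ∧ τ.reg 21 = c := by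
  have hBV := hB.le
  have hB1 := hB.one_le
  have hlo := abs_le.1 (hB.lo_le i)
  have hhi := abs_le.1 (hB.hi_le i)
  have hloV : |I.lo i| ≤ V := (hB.lo_le i).trans (by linarith)
  have hhiV : |I.hi i| ≤ V := (hB.hi_le i).trans (by linarith)
  have hTime : ∀ a b d e f : ℕ, a + (1 + 1 + 1 + (b + (d + ((n + 2) * e + f)))) ≤
      (a + 50 + b + d + 2 * e + f) * (n + 1) := by
    intro a b d e f
    nlinarith [Nat.zero_le (a * n), Nat.zero_le (b * n), Nat.zero_le (d * n), Nat.zero_le (e * n),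
      Nat.zero_le (f * n)]
  refine Spec.mono ?_ (hTime _ _ _ _ _) fun _ h => h
  refine Spec.seq (R := fun τ => (i ∈ I.jobsOn I.paths ∧ τ = σ.setReg 20 1) ∨
    (i ∉ I.jobsOn I.paths ∧ τ = σ.setReg 20 0)) (Spec.of_wp fun _ => ?_) ?_
  · refine wp_testJob (by linarith) hT.jobs (i := i) (p₀ := 1) (q₀ := I.m) ?_ ?_ ?_ ?_ ?_
    · simp [Expr.eval, State.setReg_reg, h1]
    · simp [Expr.eval]
    · intro x
      exact hT.mem_one
    · exact fun h => Or.inl ⟨h, rfl⟩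
    · exact fun h => Or.inr ⟨h, rfl⟩
  rintro τ h
  have em : τ.mem = σ.mem := by rcases h with ⟨-, rfl⟩ | ⟨-, rfl⟩ <;> rfl
  have e1 : τ.reg 1 = (i : ℕ) := by
    rcases h with ⟨-, rfl⟩ | ⟨-, rfl⟩ <;> simp [State.setReg_reg, h1]
  have hTτ : I.Tables top ch τ := hT.congr fun z _ => by rw [em]
  obtain ⟨alo, ahi, -⟩ := hTτ.jobs i i.2
  refine Spec.ifLe (a := .reg 20) (b := .lit 0) (fun hle => ?_) (fun hlt => ?_)
  · have hi : i ∉ I.jobsOn I.paths := by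
      rcases h with ⟨-, rfl⟩ | ⟨h, -⟩
      · simp [Expr.eval, State.setReg_reg] at hle
      · exact h
    have hc' := hc.2 hi
    refine (Spec.of_wp fun _ => ?_).mono (Nat.le_add_right _ _) fun _ h => h
    have hev : (Expr.add numPaths (.lit 1)).eval τ = I.m + 1 := by
      simp [Expr.eval, numPaths, hTτ.mem_one]
    have hev' : (Expr.arr .hi (.reg 1)).eval τ = I.hi i := by
      simp [Expr.eval, e1, ahi]
    constructor
    · intro hle
      rw [hev, hev'] at hle
      rw [if_pos hle] at hc'
      refine wp_assign hev' hhiV ⟨em, ?_, ?_⟩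
      · simp [State.setReg_reg, e1]
      · simp [State.setReg_reg, hc']
    · intro hlt
      rw [hev, hev'] at hlt
      rw [if_neg (by omega)] at hc'
      refine wp_assign (x := I.lo i) (by simp [Expr.eval, e1, alo]) hloV ⟨em, ?_, ?_⟩
      · simp [State.setReg_reg, e1]
      · simp [State.setReg_reg, hc']
  have hi : i ∈ I.jobsOn I.paths := by
    rcases h with ⟨h, -⟩ | ⟨-, rfl⟩
    · exact h
    · simp [Expr.eval, State.setReg_reg] at hlt
  refine (Spec.seq (R := I.Descending top ch τ.mem i c) (Spec.of_wp fun _ => ?_)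
    fun τ₁ h₁ => ?_).mono (Nat.le_add_left _ _) fun _ h => h
  · refine wp_seq_assign (x := (root n : ℕ)) ?_ ?_ ?_
    · simp only [rootState, Expr.eval]
      rw [eval_numEnds_of_mem hTτ.mem_zero]
      simp [Algorithm.numJobs, Expr.eval, hTτ.mem_zero, root]
    · rw [Nat.abs_cast]
      exact le_trans (by exact_mod_cast (root_lt n).le) hB.numStates_le
    · refine wp_assign (x := 1) rfl (by rw [abs_one]; linarith) ⟨rfl, ?_, Or.inl ⟨?_, _, root_lt n,
        ?_, hc.1 hi⟩⟩ <;> simp [State.setReg_reg, e1]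
  have hT₁ : I.Tables top ch τ₁ := hTτ.congr fun z _ => by rw [h₁.1]
  refine Spec.seq (spec_descend hB hT₁ (h₁.1 ▸ h₁)) ?_
  rintro τ₂ ⟨f0, f1, u, hu, f7, rfl⟩
  have hT₂ : I.Tables top ch τ₂ := hT₁.congr fun z _ => by rw [f0]
  have fm : τ₂.mem = σ.mem := f0.trans (h₁.1.trans em)
  obtain ⟨alo, ahi, -⟩ := hT₂.jobs i i.2
  have hru := abs_le.1 (hB.rightEnd_le u)
  refine Spec.of_wp fun _ => ?_
  refine wp_seq_assign (x := I.rightEnd u + 1) ?_ ?_ ?_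
  · simp [Expr.eval, f7, hT₂.rightEnds u hu]
  · rw [abs_le]; constructor <;> linarith
  refine wp_seq (R := fun τ => τ.mem = σ.mem ∧ τ.reg 1 = (i : ℕ) ∧
    τ.reg 21 = min (I.hi i) (I.rightEnd u + 1)) ⟨fun hle => ?_, fun hlt => ?_⟩ ?_
  · have hle' : I.hi i ≤ I.rightEnd u + 1 := by
      simpa [Expr.eval, State.setReg_reg, f1, ahi] using hle
    refine wp_assign (x := I.hi i) (by simp [Expr.eval, State.setReg_reg, f1, ahi]) hhiV
      ⟨fm, ?_, ?_⟩ <;> simp [State.setReg_reg, f1, hle']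
  · have hlt' : I.rightEnd u + 1 < I.hi i := by
      simpa [Expr.eval, State.setReg_reg, f1, ahi] using hlt
    refine ⟨fm, ?_, ?_⟩ <;> simp [State.setReg_reg, f1, hlt'.le]
  rintro τ₃ ⟨g0, g1, g21⟩
  have hT₃ : I.Tables top ch τ₃ := hT.congr fun z _ => by rw [g0]
  obtain ⟨alo, -, -⟩ := hT₃.jobs i i.2
  constructor
  · intro hle
    have hle' : min (I.hi i) (I.rightEnd u + 1) ≤ I.lo i := by
      simpa only [Expr.eval, Expr.eval_arr, g1, g21, alo] using hle
    refine wp_assign (x := I.lo i) (by simp [Expr.eval, g1, alo]) hloV ⟨g0, ?_, ?_⟩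
    · simp [State.setReg_reg, g1]
    · rw [max_eq_left hle']
      simp [State.setReg_reg]
  · intro hlt
    have hlt' : I.lo i < min (I.hi i) (I.rightEnd u + 1) := by
      simpa only [Expr.eval, Expr.eval_arr, g1, g21, alo] using hlt
    exact ⟨g0, g1, by rw [max_eq_right hlt'.le, g21]⟩

end Instance
namespace Instance

open Algorithm Program

variable {n : ℕ} {I : Instance n} {V B : ℤ}

/-- A product of two computed quantities appears here, hence the square in `WordBound.sq_le`. The
factor is `19 = 2 * 7 + 4 + 1`. -/
theorem WordBound.scaledStart_le (hB : I.WordBound V B) {j : Fin n} {a : ℤ} (ha : |a| ≤ 7 * B) :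
    |I.scaledStart j a| ≤ V := by
  have hB1 := hB.one_le
  have hsq := hB.sq_le
  have h1 := abs_le.1 (hB.release_le j)
  have h2 := abs_le.1 (hB.due_le j)
  have h3 := abs_le.1 (hB.proc_le j)
  have h4 := abs_le.1 (hB.entry_le j)
  have h5 := abs_le.1 (hB.exit_le j)
  have h6 := hB.len_le j
  have h7 : |(2 * a + I.len j - 1) * I.scaledHeadway j| ≤ 19 * B * B := by
    rw [abs_mul]
    refine mul_le_mul ?_ (hB.headway_le j) (abs_nonneg _) (by linarith)
    have ha' := abs_le.1 ha
    rw [abs_le]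
    constructor <;> omega
  have h7' := abs_le.1 h7
  have h8 : B ≤ B * B := by nlinarith
  unfold scaledStart
  split_ifs <;> rw [abs_le] <;> constructor <;> linarith

theorem wp_writeStart (hB : I.WordBound V B) {σ : State} {j : Fin n} {a : ℤ} (hj : I.HasJob σ j)
    (h1 : σ.reg 1 = (j : ℕ)) (h21 : σ.reg 21 = a) (ha : |a| ≤ 7 * B) :
    writeStart.wp V (fun τ => τ.mem =
      ((σ.setMem (8 + 10 * (j : ℕ)) (I.scaledStart j a)).setMem (9 + 10 * (j : ℕ))
        (2 * I.scale j)).mem ∧ τ.reg 1 = (j : ℕ)) σ := by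
  have hBV := hB.le
  have hB1 := hB.one_le
  have hV := hB.scaledStart_le (j := j) ha
  refine wp_seq (spec_loadJob hB hj h1) ?_
  rintro τ ⟨e0, e1, e17, -, -, e6, e10, e11, e12, e13, e14, e15, e16⟩
  have e21 : τ.reg 21 = a := (e17 21 (by norm_num)).trans h21
  refine wp_seq (R := fun τ' => τ'.mem = σ.mem ∧ τ'.reg 1 = (j : ℕ) ∧
    τ'.reg 7 = I.scaledStart j a ∧ τ'.reg 10 = I.scale j) ?_ ?_
  · have key : ∀ {e : Expr}, e.eval τ = I.scaledStart j a → (assign 7 e).wp V (fun τ' =>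
        τ'.mem = σ.mem ∧ τ'.reg 1 = (j : ℕ) ∧ τ'.reg 7 = I.scaledStart j a ∧
          τ'.reg 10 = I.scale j) τ := by
      intro e he
      refine wp_assign he hV ⟨e0, ?_, ?_, ?_⟩ <;> simp [State.setReg_reg, e1, e10]
    refine ⟨fun c => ?_, fun c => ⟨fun c' => ?_, fun c' => ?_⟩⟩
    · refine key ?_
      simp only [Expr.eval, e6, e12, e13, e14, e16, e21] at c ⊢
      rw [scaledStart, if_pos c]
    · refine key ?_
      simp only [Expr.eval, e6, e11, e12, e14, e15, e16, e21] at c c' ⊢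
      rw [scaledStart, if_neg (not_le.2 c), if_pos c']
    · refine key ?_
      simp only [Expr.eval, e6, e11, e12, e13, e14, e15, e16, e21] at c c' ⊢
      rw [scaledStart, if_neg (not_le.2 c), if_neg (not_le.2 c')]
  rintro τ' ⟨f0, f1, f7, f10⟩
  have hs := abs_le.1 (hB.scale_le j)
  simp only [Program.wp, Expr.eval, State.setMem_reg, f1, f7, f10]
  refine ⟨hV, ?_, ?_, trivial⟩
  · rw [abs_le]; constructor <;> linarith
  · unfold State.setMem
    rw [f0]

variable (I) in
/-- The memory after the start times of the first `i` jobs have been written. -/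
structure Writing (top ch : ℕ → ℤ) (b : Fin n → ℤ) (i : ℕ) (σ : State) : Prop where
  tables : I.Tables top ch σ
  head : ∀ z, 0 ≤ z → z < 8 → σ.mem z = I.initial.mem z
  tail : ∀ z, 8 + 10 * (i : ℤ) ≤ z → σ.mem z = I.initial.mem z
  written : ∀ j : Fin n, (j : ℕ) < i → σ.mem (8 + 10 * (j : ℕ)) = I.scaledStart j (b j) ∧
    σ.mem (9 + 10 * (j : ℕ)) = 2 * I.scale j

theorem Writing.congr {top ch : ℕ → ℤ} {b : Fin n → ℤ} {i : ℕ} {σ τ : State}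
    (h : I.Writing top ch b i σ) (hm : τ.mem = σ.mem) : I.Writing top ch b i τ where
  tables := h.tables.congr fun z _ => by rw [hm]
  head z h0 h8 := by rw [hm]; exact h.head z h0 h8
  tail z hz := by rw [hm]; exact h.tail z hz
  written j hj := by rw [hm]; exact h.written j hj

theorem Writing.hasJob {top ch : ℕ → ℤ} {b : Fin n → ℤ} {σ : State} {j : Fin n}
    (h : I.Writing top ch b j σ) : I.HasJob σ j :=
  HasJob.congr I (I.hasJob_initial j) h.head h.tail

/-- The two words written belong to the input of job `j`, after the results of the earlier jobs and
before the input of the later ones. -/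
theorem Writing.succ {top ch : ℕ → ℤ} {b : Fin n → ℤ} {σ τ : State} {j : Fin n}
    (h : I.Writing top ch b j σ) (hm : τ.mem =
      ((σ.setMem (8 + 10 * (j : ℕ)) (I.scaledStart j (b j))).setMem (9 + 10 * (j : ℕ))
        (2 * I.scale j)).mem) : I.Writing top ch b (j + 1) τ := by
  have hz : ∀ z, τ.mem z = if z = 9 + 10 * (j : ℕ) then 2 * I.scale j else
      if z = 8 + 10 * (j : ℕ) then I.scaledStart j (b j) else σ.mem z := by
    intro z
    rw [hm, State.setMem_mem, State.setMem_mem]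
  have hlt : ∀ z : ℤ, z < 8 + 10 * (j : ℕ) → τ.mem z = σ.mem z := by
    intro z h'
    rw [hz, if_neg (by omega), if_neg (by omega)]
  refine ⟨h.tables.congr fun z _ => hlt z (by omega), fun z h0 h8 => ?_, fun z h' => ?_,
    fun i hi => ?_⟩
  · rw [hlt z (by omega)]
    exact h.head z h0 h8
  · push_cast at h'
    rw [hz, if_neg (by omega), if_neg (by omega)]
    exact h.tail z (by omega)
  · rcases Nat.lt_succ_iff_lt_or_eq.1 hi with hi | hi
    · rw [hlt _ (by omega), hlt _ (by omega)]
      exact h.written i hi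
    · obtain rfl : i = j := Fin.ext hi
      constructor
      · rw [hz, if_neg (by omega), if_pos rfl]
      · rw [hz, if_pos rfl]

theorem spec_writeStarts : ∃ K, ∀ {n : ℕ} {I : Instance n} {V B : ℤ}, I.WordBound V B →
    ∀ {top ch : ℕ → ℤ} {b : Fin n → ℤ}, I.Valid b → (∀ j, I.IsPlaced top ch j (b j)) →
    ∀ {σ : State}, I.Writing top ch b 0 σ →
    Spec V writeStarts σ (K * (n + 1) ^ 4) (I.Writing top ch b n) := by
  refine ⟨placeJobTime + writeStart.cost + Algorithm.numJobs.time + 10, ?_⟩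
  intro n I V B hB top ch b hb hpl σ hσ
  have hBV := hB.le
  have hB1 := hB.one_le
  refine (Spec.forLt_const (T := placeJobTime * (n + 1) + writeStart.cost) n
    (I.Writing top ch b) (hB.n_le.trans (by linarith)) ?_ ?_ ?_ hσ).mono ?_ fun _ h => h
  · exact fun i σ x h => h.congr rfl
  · exact fun i σ h => h.tables.mem_zero
  · intro i hi σ h h1
    refine Spec.seq (spec_placeJob hB h.tables (hpl ⟨i, hi⟩) h1) ?_
    rintro τ ⟨e0, e1, e21⟩
    refine Spec.of_wp fun _ => ?_
    have h' : I.Writing top ch b i τ := h.congr e0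
    refine wp_mono ?_ (wp_writeStart hB (j := ⟨i, hi⟩) h'.hasJob e1 e21 ?_)
    · exact fun τ' hτ' => ⟨h'.succ (j := ⟨i, hi⟩) hτ'.1, hτ'.2⟩
    · have h1 := hb ⟨i, hi⟩
      have h2 := abs_le.1 (hB.lo_le ⟨i, hi⟩)
      have h3 := abs_le.1 (hB.hi_le ⟨i, hi⟩)
      rw [abs_le]
      constructor <;> linarith
  · generalize placeJobTime = a
    generalize writeStart.cost = c
    generalize Algorithm.numJobs.time = e
    have hN : 1 ≤ n + 1 := by omega
    generalize n + 1 = N at *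
    have h1 : N ≤ N ^ 4 := Nat.le_self_pow (by norm_num) N
    have h2 : N * N ≤ N ^ 4 := by
      calc N * N = N ^ 2 := by ring
        _ ≤ N ^ 4 := Nat.pow_le_pow_right hN (by norm_num)
    calc N * (a * N + c + e + 10) = a * (N * N) + (c + e + 10) * N := by ring
      _ ≤ a * N ^ 4 + (c + e + 10) * N ^ 4 := by gcongr
      _ = _ := by ring

/-! ### The solution -/

/-- A job that can avoid the paths can do so at an extreme start: at the latest one if that lies
beyond `m`, and otherwise at the earliest one, unless its block or the set of paths is empty anyway.
-/
theorem disjoint_block_paths {j : Fin n} (hj : j ∉ I.jobsOn I.paths) {c : ℤ}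
    (hc : c = if (I.m : ℤ) + 1 ≤ I.hi j then I.hi j else I.lo j) :
    Disjoint (I.block j c) I.paths := by
  rw [paths, mem_jobsOn_Icc] at hj
  rw [Set.disjoint_left]
  intro x hx hx'
  rw [mem_block] at hx
  rw [paths, Set.mem_Icc] at hx'
  have := I.lo_le_hi j
  split_ifs at hc <;> omega

theorem exists_isPlaced {top ch : ℕ → ℤ}
    (h : ∀ s < Instance.numStates n, 0 < I.numJobs s →
      ∃ (j : Fin n) (u : ℕ), top s = (j : ℕ) ∧ ch s = u ∧ I.IsChoice s j u) :
    ∃ b, I.Valid b ∧ I.Avoiding b ∧ (I.covered b I.paths).ncard ≤ I.cost I.paths ∧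
      ∀ j, I.IsPlaced top ch j (b j) := by
  classical
  obtain ⟨b, h1, h2, h3⟩ := I.exists_descent (fun s hs hne => h s hs (I.numJobs_pos_iff.2 hne))
    (root_lt n)
  rw [region_root] at h2 h3
  refine ⟨fun j => if j ∈ I.jobsOn I.paths then b j else
    if (I.m : ℤ) + 1 ≤ I.hi j then I.hi j else I.lo j, fun j => ?_, fun j hj => ?_, ?_,
    fun j => ⟨fun hj => ?_, fun hj => ?_⟩⟩
  · have h4 := I.lo_le_hi j
    have h5 := h1 j
    simp only
    split_ifs <;> omega
  · exact disjoint_block_paths hj (if_neg hj)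
  · refine le_of_eq_of_le ?_ h2
    congr 1
    refine Set.iUnion₂_congr fun j hj => ?_
    simp only [if_pos hj]
  · simp only [if_pos hj]
    exact h3 j hj
  · exact if_neg hj

theorem initial_arr (c : Arr) {i : ℤ} (hi : 0 ≤ i) : I.initial.arr c i = 0 :=
  if_neg (not_le.2 (c.addr_neg hi))

theorem bounded_initial {M : ℕ} (hM : ∀ z ∈ I.words, |z| ≤ (M : ℤ)) {V : ℤ} (hV : 2 ≤ V)
    (hMV : (M : ℤ) ≤ V) : I.initial.Bounded V := by
  refine ⟨hV, fun k => ?_, fun z => ?_⟩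
  · simp only [initial, abs_zero]
    linarith
  · simp only [initial]
    split_ifs
    · rcases lt_or_ge z.toNat I.words.length with h | h
      · rw [List.getD_eq_getElem _ _ h]
        exact (hM _ (List.getElem_mem h)).trans hMV
      · rw [List.getD_eq_default _ _ h, abs_zero]
        linarith
    · rw [abs_zero]
      linarith

/-- The fractions in memory equal `startTime`, so each job crosses exactly its planned block and
`isOptimal_of_covered` applies. -/
theorem Writing.solvedBy {top ch : ℕ → ℤ} {b : Fin n → ℤ} {σ : State}
    (h : I.Writing top ch b n σ) (hb : I.Valid b) (ha : I.Avoiding b)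
    (hcost : (I.covered b I.paths).ncard ≤ I.cost I.paths) {τ : State} (hm : τ.mem = σ.mem)
    (h0 : τ.reg 0 = I.cost I.paths) : I.SolvedBy τ := by
  have hden : ∀ j : Fin n, τ.mem (8 + 10 * (j : ℤ) + 1) = 2 * I.scale j := by
    intro j
    have := (h.written j j.2).2
    rw [hm, ← this]
    congr 1
    ring
  have hst : (fun j => (I.outputStart τ j : ℝ)) = fun j => I.startTime j (b j) := by
    ext j
    rw [← scaledStart_div, ← (h.written j j.2).1, ← hden, hm, outputStart, hm]
    push_cast
    rfl
  have hspec := fun j => I.startTime_spec (hb j).1 (hb j).2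
  have hopt := I.isOptimal_of_covered ha hcost (fun j => (hspec j).1) fun j => (hspec j).2
  refine ⟨fun j => ?_, ?_, ?_⟩
  · rw [hden]
    have := I.scale_pos j
    omega
  · rw [hst]
    exact hopt.1
  · rw [hst, hopt.2, h0]

theorem spec_main : ∃ K, ∀ {n : ℕ} {I : Instance n} {V B : ℤ}, I.WordBound V B →
    Spec V Algorithm.main I.initial (K * (n + 1) ^ 4) I.SolvedBy := by
  obtain ⟨K₂, h₂⟩ := spec_storeLeftEnds
  obtain ⟨K₃, h₃⟩ := spec_countJobs
  obtain ⟨K₄, h₄⟩ := spec_solveStates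
  obtain ⟨K₅, h₅⟩ := spec_writeStarts
  obtain ⟨c₁, hc₁⟩ : ∃ c₁, c₁ = loadJob.cost + storeJob.cost + 40 := ⟨_, rfl⟩
  obtain ⟨c₆, hc₆⟩ : ∃ c₆, c₆ = (assign 0 (.arr .cost rootState)).cost := ⟨_, rfl⟩
  refine ⟨c₁ + K₂ + K₃ + K₄ + K₅ + c₆, ?_⟩
  intro n I V B hB
  have hBV := hB.le
  have hB1 := hB.one_le
  have key : Spec V Algorithm.main I.initial (c₁ * (n + 1) + (K₂ * (n + 1) ^ 4 +
      (K₃ * (n + 1) ^ 4 + (K₄ * (n + 1) ^ 4 + (K₅ * (n + 1) ^ 4 + c₆))))) I.SolvedBy := by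
    subst hc₁ hc₆
    refine Spec.seq (spec_loadJobs hB I.hasInput_initial fun s => initial_arr _ (by positivity))
      ?_
    rintro σ₁ ⟨a1, a2, a3, a4⟩
    refine Spec.seq (h₂ hB ⟨a1, a2, a3⟩ a4) ?_
    rintro σ₂ ⟨b1, b2, b3⟩
    refine Spec.seq (h₃ hB b1 b2 b3) ?_
    rintro σ₃ ⟨d1, d2, d3, d4⟩
    refine Spec.seq (h₄ hB d1 d2 d3 d4) ?_
    rintro σ₄ ⟨e1, e2, e3⟩
    -- The recorded choices are frozen as functions at this point, since writing the results leaves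
    -- the arrays unchanged.
    obtain ⟨b, hb, ha, hcost, hpl⟩ := exists_isPlaced (I := I) (top := fun s => σ₄.arr .top s)
      (ch := fun s => σ₄.arr .choice s) fun s hs hpos => (e3 s hs).2 hpos
    refine Spec.seq (R := I.Writing (fun s => σ₄.arr .top s) (fun s => σ₄.arr .choice s) b n)
      (h₅ hB hb hpl ⟨⟨eval_numJobs e1.input, eval_numPaths e1.input, e1.jobs, e1.rightEnds, e2,
        fun _ => rfl, fun _ => rfl, ?_⟩, fun z hz _ => e1.input z hz,
        fun z hz => e1.input z (by push_cast at hz; omega), fun j hj => absurd hj (by omega)⟩) ?_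
    · rw [(e3 _ (root_lt n)).1, region_root]
    intro σ₅ hσ₅
    refine Spec.of_wp fun hbd => ?_
    have hcost' := hσ₅.tables.cost_eq
    refine wp_assign (x := I.cost I.paths) ?_ ?_ ?_
    · have hroot : rootState.eval σ₅ = (root n : ℕ) := by
        simp only [rootState, Expr.eval]
        rw [eval_numEnds_of_mem hσ₅.tables.mem_zero]
        simp [Algorithm.numJobs, Expr.eval, hσ₅.tables.mem_zero, root]
      rw [Expr.eval_arr, hroot, hcost']
    · rw [← hcost']
      exact hbd.2.2 _
    · exact hσ₅.solvedBy hb ha hcost rfl (by simp [State.setReg_reg])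
  refine key.mono ?_ fun _ h => h
  have h1 : n + 1 ≤ (n + 1) ^ 4 := Nat.le_self_pow (by norm_num) _
  have h2 : 1 ≤ (n + 1) ^ 4 := Nat.one_le_pow _ _ (by omega)
  generalize (n + 1) ^ 4 = X at *
  calc _ ≤ c₁ * X + (K₂ * X + (K₃ * X + (K₄ * X + (K₅ * X + c₆ * X)))) := by
        gcongr
        exact Nat.le_mul_of_pos_right _ h2
    _ = _ := by ring

end Instance

/-- With `V = (M + 2) ^ 30` the words fit into `V ^ 2 ^ depth`, and `depth` belongs to the program
alone. The factor `16` replaces `(n + 1) ^ 4` by `n ^ 4 + 1`. -/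
theorem exists_solvableInTime : ∃ K : ℕ, SolvableInTime (fun n => K * (n ^ 4 + 1)) := by
  obtain ⟨K, hK⟩ := Instance.spec_main
  refine ⟨16 * K, Algorithm.main, 30 * 2 ^ Algorithm.main.depth, fun n I M hM => ?_⟩
  have hB := I.wordBound hM
  have h2 : (2 : ℤ) ≤ (M : ℤ) + 2 := by omega
  have hle : (M : ℤ) + 2 ≤ ((M : ℤ) + 2) ^ 30 := le_self_pow₀ (by omega) (by norm_num)
  obtain ⟨σ, t, h3, h4, -, h5⟩ :=
    hK hB (Instance.bounded_initial hM (h2.trans hle) (le_trans (by omega) hle))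
  refine ⟨σ, t, by rwa [pow_mul], h4.trans ?_, h5⟩
  have h6 : (n + 1) ^ 4 ≤ 16 * (n ^ 4 + 1) := by
    have h7 : (n + 1) ^ 4 ≤ (2 : ℕ) ^ 3 * (n ^ 4 + 1 ^ 4) :=
      add_pow_le (Nat.zero_le n) zero_le_one 4
    rw [one_pow] at h7
    omega
  calc K * (n + 1) ^ 4 ≤ K * (16 * (n ^ 4 + 1)) := Nat.mul_le_mul_left _ h6
    _ = _ := by ring

end MaintenanceScheduling

/-! ### The main theorem -/

theorem mainTheorem2 :
    -- the problem can be solved in time O(n ^ 4)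
    (∃ K : ℕ, MaintenanceScheduling.SolvableInTime (fun n => K * (n ^ 4 + 1))) ∧
    -- only O(n ^ 3) sets of paths come up in the dynamic program
    (∃ K : ℕ, ∀ (n : ℕ) (I : MaintenanceScheduling.Instance n),
      {P : Set ℤ | I.Arises P}.encard ≤ ((K * (n ^ 3 + 1) : ℕ) : ℕ∞)) ∧
    ∀ (n : ℕ) (I : MaintenanceScheduling.Instance n),
      -- they are intervals
      (∀ P : Set ℤ, I.Arises P → P ⊆ I.paths ∧ ∃ a b : ℤ, P = Set.Icc a b) ∧
      -- all possessions of a job have the same length, and O(n) of them are candidates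
      (∀ j, ∀ R ∈ I.possessions j, R.Finite ∧ R.ncard = I.len j) ∧
      (∀ j, (I.candidates j).encard ≤ ((n + 1 : ℕ) : ℕ∞)) ∧
      -- jobs of maximal length are splitting
      (∀ P ⊆ I.paths, ∀ j, I.IsLongest P j → I.IsSplitting P j) ∧
      -- the recursion, branching on any job of maximal length, gives the optimal value
      IsLeast {k : ℕ | ∃ s, I.Feasible s ∧ k = (I.cancelled s).ncard} (I.cost I.paths) ∧
      (∀ P : Set ℤ, I.Arises P →
        (I.jobsOn P = ∅ → I.cost P = 0) ∧
        ∀ j, I.IsLongest P j →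
          IsLeast {k : ℕ | ∃ X ∈ I.candidates j,
            k = (X ∩ P).ncard
              + I.cost (MaintenanceScheduling.Instance.rightOf X P)
              + I.cost (MaintenanceScheduling.Instance.leftOf X P)} (I.cost P)) := by
  refine ⟨MaintenanceScheduling.exists_solvableInTime, ⟨8, fun n I => I.encard_arises_le⟩,
    fun n I => ⟨fun P hP => ?_, fun j R hR => ?_, I.encard_candidates_le,
      fun P _ j hj => hj.isSplitting, I.isLeast_cost_paths, fun P hP =>
      ⟨I.cost_eq_zero, fun j hj => I.isLeast_cost_of_isLongest hP hj⟩⟩⟩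
  · obtain ⟨-, -, p, q, hp, hq, rfl, -⟩ :=
      MaintenanceScheduling.Instance.Arises.exists_eq_Icc I hP
    exact ⟨Set.Icc_subset_Icc hp hq, p, q, rfl⟩
  · obtain ⟨a, -, -, rfl⟩ := I.mem_possessions.1 hR
    exact ⟨I.block_finite j a, I.ncard_block j a⟩
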